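/- Let $n\ge 3$ and let $z\in\{0,1\}$ with $z\equiv n \pmod 2$. The Brauer monoid $\mathcal B_n$ consists of all set partitions of $\{1,\dots,n\}\cup\{1',\dots,n'\}$ into blocks of size $2$, multiplied as in the partition monoid (stack two diagrams, identify the lower row of the first with the upper row of the second, and take connectivity between the two outer rows). The rank of $\alpha$ is the number of its transversals, i.e. blocks meeting both rows; $\alpha\mapsto\alpha^*$ exchanges the two rows. Put $I_q=\{\alpha\in\mathcal B_n:\operatorname{rank}\alpha\le q\}$, and for $\sigma\in S_q$ (with $q\le n$, $q\equiv n\pmod 2$) let $\overline\sigma\in\mathcal B_n$ have the blocks $\{i,(i\sigma)'\}$ $(1\le i\le q)$ and $\{q+1,q+2\},\dots,\{n-1,n\}$, $\{(q+1)',(q+2)'\},\dots,\{(n-1)',n'\}$; $\overline N=\{\overline\sigma:\sigma\in N\}$. For a finite monoid $S$ with minimal ideal $M$ and Green's relations $\mathscr R,\mathscr L,\mathscr H,\mathscr J$: an ideal is non-empty, and $R_I=\Delta\cup(I\times I)$ for an ideal $I$. An ideal $I$ is retractable if there is a (necessarily unique) homomorphism $f:I\to M$ fixing $M$ pointwise.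 An IN-pair is a pair $(I,N)$ where $I$ is an ideal and $N$ is a normal subgroup of a maximal subgroup contained in a (stable, regular) $\mathscr J$-class $J$ that is minimal among the $\mathscr J$-classes outside $I$; it is proper if $|N|\ge2$, and retractable if $I$ is retractable and $|xN|=|Nx|=1$ for all $x\in M$. Put $\nu_N=\{(sxt,syt)\in J\times J: x,y\in N,\ s,t\in S\}$ and $R_{I,N}=R_I\cup\nu_N$; for a retractable IN-pair put $$\lambda_{I,N}=\Delta\cup\nu_N\cup\{(x,y)\in I\times I: xf\,\mathscr L\,yf\},$$ and define $\rho_{I,N}$, $\mu_{I,N}$ likewise with $\mathscr R$, $\mathscr H$ in place of $\mathscr L$. In $\mathcal B_n$, call $N$ distinguished if it is contained in $\overline{S_q}$ for some $q\in\{z,z+2,\dots,n\}$. For every IN-pair $(I,N)$ there is an IN-pair $(I,N')$ with $N'$ distinguished and $\nu_N=\nu_{N'}$, and $(I,N)$ is proper, respectively retractable, if and only if $(I,N')$ is. Moreover: (i) The ideals of $\mathcal B_n$ are exactly the sets $I_q$, $q=z,z+2,\dots,n$; write $R_q=R_{I_q}$. (ii) The proper IN-pairs with distinguished group are exactly the pairs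 $(I_{q-2},\overline N)$ for $q=z+2,z+4,\dots,n$ and $N$ a non-trivial normal subgroup of $S_q$; write $R_N=R_{I_{q-2},\overline N}$. (iii) If $n$ is odd, the only retractable IN-pair with distinguished group is $\mathcal C_1=(I_1,\{\overline{\mathrm{id}}_3\})$, yielding $\lambda_1,\rho_1,\mu_1$. (iv) If $n$ is even, the retractable IN-pairs with distinguished group are exactly $\mathcal C_0=(I_0,\{\overline{\mathrm{id}}_2\})$, $\mathcal C_{S_2}=(I_0,\overline{S_2})$, $\mathcal C_2=(I_2,\{\overline{\mathrm{id}}_4\})$ and $\mathcal C_K=(I_2,\overline K)$, with $K\le S_4$ the Klein four-group of double transpositions and the identity, yielding $\lambda_j,\rho_j,\mu_j$ for $j\in\{0,S_2,2,K\}$. The retraction $I_2\to I_0$ fixes $I_0$ and replaces the two transversals $\{i,j'\},\{k,l'\}$ of an element of rank $2$ by $\{i,k\},\{j',l'\}$. (v) The relations $R_q$, $R_N$ of (i) and (ii), together with those of (iii) for $n$ odd and of (iv) for $n$ even, are pairwise distinct congruences on $\mathcal B_n$, and every congruence on $\mathcal B_n$ is one of them. (vi) The covering pairs $\xi\prec\zeta$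 of the lattice of congruences of $\mathcal B_n$ are exactly the following. For $n$ odd: $\mu_1\prec\lambda_1\prec R_1$, $\mu_1\prec\rho_1\prec R_1$. For $n$ even, with $T_0=R_0$, $T_{S_2}=R_{S_2}$, $T_2=R_2$, $T_K=R_K$: $\mu_j\prec\lambda_j\prec T_j$ and $\mu_j\prec\rho_j\prec T_j$ for $j\in\{0,S_2,2,K\}$; $\xi_0\prec\xi_{S_2}\prec\xi_2\prec\xi_K$ for each $\xi\in\{\lambda,\rho,\mu,T\}$; and, for $q=4$, $R_K\prec R_{A_4}\prec R_{S_4}\prec R_4$. In both cases: $R_{q-2}\prec R_{A_q}\prec R_{S_q}\prec R_q$ for $q=3$ and for all $q\ge5$ with $q\le n$, $q\equiv n\pmod 2$. (vii) All these congruences are compatible with $*$ (that is, $(\alpha,\beta)\in\xi$ implies $(\alpha^*,\beta^*)\in\xi$), except for $\lambda_1,\rho_1$ ($n$ odd), respectively $\lambda_j,\rho_j$ with $j\in\{0,S_2,2,K\}$ ($n$ even). -/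

import Mathlib

namespace DiagramMonoid

/-! ### Semigroup-theoretic notions (for a monoid `S`, so that `S¹ = S`) -/

section Semigroup

/-- Green's relation `R`: `a` and `b` generate the same principal right ideal. -/
def GreenR {S : Type*} [Monoid S] (a b : S) : Prop :=
  Set.range (fun s : S => a * s) = Set.range (fun s : S => b * s)

/-- Green's relation `L`: `a` and `b` generate the same principal left ideal. -/
def GreenL {S : Type*} [Monoid S] (a b : S) : Prop :=
  Set.range (fun s : S => s * a) = Set.range (fun s : S => s * b)

/-- Green's relation `H`. -/
def GreenH {S : Type*} [Monoid S] (a b : S) : Prop :=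
  GreenR a b ∧ GreenL a b

/-- The principal two-sided ideal generated by `a`. -/
def principalIdeal {S : Type*} [Monoid S] (a : S) : Set S :=
  {x | ∃ s t : S, x = s * a * t}

/-- Green's relation `J`. -/
def GreenJ {S : Type*} [Monoid S] (a b : S) : Prop :=
  principalIdeal a = principalIdeal b

/-- Ideals are non-empty. -/
def IsIdeal {S : Type*} [Monoid S] (I : Set S) : Prop :=
  I.Nonempty ∧ ∀ x ∈ I, ∀ a : S, a * x ∈ I ∧ x * a ∈ I

/-- `M` is a (equivalently, the) minimal ideal. -/
def IsMinimalIdeal {S : Type*} [Monoid S] (M : Set S) : Prop :=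
  Minimal (fun I : Set S => IsIdeal I) M

/-- `f`, restricted to `I`, is a homomorphism `I → M` fixing `M` pointwise.  The values of `f`
outside `I` are irrelevant. -/
def IsRetraction {S : Type*} [Monoid S] (I M : Set S) (f : S → S) : Prop :=
  (∀ x ∈ I, f x ∈ M) ∧ (∀ x ∈ I, ∀ y ∈ I, f (x * y) = f x * f y) ∧ ∀ x ∈ M, f x = x

/-- The `J`-class of `e` is stable. -/
def IsStableClass {S : Type*} [Monoid S] (e : S) : Prop :=
  ∀ x : S, GreenJ x e → ∀ a : S,
    (GreenJ (x * a) x → GreenR (x * a) x) ∧ (GreenJ (a * x) x → GreenL (a * x) x)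

/-- Every element of the `J`-class of `e` is regular. -/
def IsRegularClass {S : Type*} [Monoid S] (e : S) : Prop :=
  ∀ x : S, GreenJ x e → ∃ y : S, x = x * y * x

/-- `N` is a normal subgroup of the maximal subgroup (group `H`-class) with identity `e`. -/
def IsNormalSubgroupAt {S : Type*} [Monoid S] (e : S) (N : Set S) : Prop :=
  e * e = e ∧ e ∈ N ∧ (∀ x ∈ N, GreenH x e) ∧ (∀ x ∈ N, ∀ y ∈ N, x * y ∈ N) ∧
    (∀ x ∈ N, ∃ y ∈ N, x * y = e ∧ y * x = e) ∧
    ∀ g h : S, GreenH g e → GreenH h e → g * h = e → h * g = e → ∀ x ∈ N, g * x * h ∈ N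

/-- `(I, N)` is an IN-pair: `I` is an ideal, and `N` is a normal subgroup of a maximal subgroup
contained in a stable regular `J`-class which is minimal among the `J`-classes outside `I`. -/
def IsINPair {S : Type*} [Monoid S] (I N : Set S) : Prop :=
  IsIdeal I ∧ ∃ e : S, IsNormalSubgroupAt e N ∧ IsStableClass e ∧ IsRegularClass e ∧
    e ∉ I ∧ ∀ b : S, b ∉ I → b ∈ principalIdeal e → GreenJ b e

/-- A proper IN-pair: the group is non-trivial. -/
def IsProperINPair {S : Type*} [Monoid S] (I N : Set S) : Prop :=
  IsINPair I N ∧ N.Nontrivial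

/-- A retractable IN-pair: the ideal is retractable, and all elements of `N` act in the same way
on the minimal ideal. -/
def IsRetractableINPair {S : Type*} [Monoid S] (I N : Set S) : Prop :=
  IsINPair I N ∧ ∃ M : Set S, IsMinimalIdeal M ∧ (∃ f : S → S, IsRetraction I M f) ∧
    ∀ x ∈ M, ∀ u ∈ N, ∀ v ∈ N, x * u = x * v ∧ u * x = v * x

/-- The relation `ν_N`, on the `J`-class containing `N`. -/
def nuRel {S : Type*} [Monoid S] (N : Set S) (a b : S) : Prop :=
  ∃ u ∈ N, ∃ v ∈ N, ∃ s t : S, a = s * u * t ∧ b = s * v * t ∧ GreenJ a u ∧ GreenJ b v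

/-- The Rees relation `R_I`. -/
def reesRel {S : Type*} [Monoid S] (I : Set S) (a b : S) : Prop :=
  a = b ∨ (a ∈ I ∧ b ∈ I)

/-- The relation `R_{I,N}`. -/
def inRel {S : Type*} [Monoid S] (I N : Set S) (a b : S) : Prop :=
  reesRel I a b ∨ nuRel N a b

/-- The pullback to `I` of a relation `K` on the minimal ideal along the (unique) retraction. -/
def pullbackRel {S : Type*} [Monoid S] (I : Set S) (K : S → S → Prop) (a b : S) : Prop :=
  a ∈ I ∧ b ∈ I ∧ ∃ (M : Set S) (f : S → S), IsMinimalIdeal M ∧ IsRetraction I M f ∧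
    K (f a) (f b)

/-- The relation `λ_{I,N}`. -/
def lamRel {S : Type*} [Monoid S] (I N : Set S) (a b : S) : Prop :=
  a = b ∨ nuRel N a b ∨ pullbackRel I GreenL a b

/-- The relation `ρ_{I,N}`. -/
def rhoRel {S : Type*} [Monoid S] (I N : Set S) (a b : S) : Prop :=
  a = b ∨ nuRel N a b ∨ pullbackRel I GreenR a b

/-- The relation `μ_{I,N}`. -/
def muRel {S : Type*} [Monoid S] (I N : Set S) (a b : S) : Prop :=
  a = b ∨ nuRel N a b ∨ pullbackRel I GreenH a b

end Semigroup

/-! ### The partition monoid -/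

section Partition

/-- The upper vertices `1, …, n` (left summand) and the lower vertices `1', …, n'`
(right summand); indices start at `0`. -/
abbrev Vertex (n : ℕ) : Type := Fin n ⊕ Fin n

/-- A set partition of the upper and lower vertices, given by its equivalence relation. -/
@[ext]
structure Diagram (n : ℕ) : Type where
  toSetoid : Setoid (Vertex n)

/-- Two vertices lie in the same block. -/
def Diagram.Rel {n : ℕ} (α : Diagram n) (x y : Vertex n) : Prop := α.toSetoid x y

/-- Place the upper vertices in row `i` and the lower ones in row `j`. -/
def place {n : ℕ} (i j : Fin 3) : Vertex n → Fin 3 × Fin n :=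
  Sum.elim (fun a => (i, a)) (fun a => (j, a))

/-- The product graph: `α` joins rows `0` and `1`, and `β` joins rows `1` and `2`. -/
def productGraph {n : ℕ} (α β : Diagram n) (u v : Fin 3 × Fin n) : Prop :=
  (∃ x y, α.Rel x y ∧ u = place 0 1 x ∧ v = place 0 1 y) ∨
    ∃ x y, β.Rel x y ∧ u = place 1 2 x ∧ v = place 1 2 y

/-- Two vertices are in the same block of `α * β` if and only if they are connected by a path in
the product graph. -/
instance {n : ℕ} : Mul (Diagram n) where
  mul α β := ⟨Setoid.comap (place 0 2) (Relation.EqvGen.setoid (productGraph α β))⟩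

/-- The identity has the blocks `{i, i'}`. -/
instance {n : ℕ} : One (Diagram n) where
  one := ⟨Setoid.ker (Sum.elim id id)⟩

theorem Diagram.rel_refl {n : ℕ} (α : Diagram n) (x : Vertex n) : α.Rel x x :=
  α.toSetoid.refl' x

theorem Diagram.rel_symm {n : ℕ} {α : Diagram n} {x y : Vertex n} (h : α.Rel x y) : α.Rel y x :=
  α.toSetoid.symm' h

theorem Diagram.rel_trans {n : ℕ} {α : Diagram n} {x y z : Vertex n} (h : α.Rel x y)
    (h' : α.Rel y z) : α.Rel x z :=
  α.toSetoid.trans' h h'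

theorem Diagram.rel_ext {n : ℕ} {α β : Diagram n} (h : ∀ x y, α.Rel x y ↔ β.Rel x y) : α = β := by
  cases α; cases β
  congr 1
  exact Setoid.ext h

theorem mul_rel {n : ℕ} (α β : Diagram n) (x y : Vertex n) :
    (α * β).Rel x y ↔ Relation.EqvGen (productGraph α β) (place 0 2 x) (place 0 2 y) :=
  Iff.rfl

/-- A two-colouring of the vertices that is constant on the blocks. -/
def IsColouring {n : ℕ} (α : Diagram n) (p q : Fin n → Prop) : Prop :=
  ∀ x y, α.Rel x y → (Sum.elim p q x ↔ Sum.elim p q y)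

theorem colouring_ext {n : ℕ} {α β : Diagram n} (h : ∀ p q, IsColouring α p q ↔ IsColouring β p q) : α = β := by
  have key : ∀ {α β : Diagram n}, (∀ p q, IsColouring α p q → IsColouring β p q) →
      ∀ x y, β.Rel x y → α.Rel x y := by
    intro α β h x y hxy
    have hc : Sum.elim (fun i => α.Rel x (Sum.inl i)) (fun i => α.Rel x (Sum.inr i))
        = α.Rel x := by
      funext z; cases z <;> rfl
    have h1 := h (fun i => α.Rel x (Sum.inl i)) (fun i => α.Rel x (Sum.inr i))
      (by
        intro u v huv
        rw [hc]
        exact ⟨fun h => Diagram.rel_trans h huv, fun h => Diagram.rel_trans h (Diagram.rel_symm huv)⟩) x y hxy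
    rw [hc] at h1
    exact h1.1 (α.rel_refl x)
  exact Diagram.rel_ext fun x y =>
    ⟨key (fun p q => (h p q).2) x y, key (fun p q => (h p q).1) x y⟩

theorem colouring_mul {n : ℕ} (α β : Diagram n) (p q : Fin n → Prop) :
    IsColouring (α * β) p q ↔ ∃ m, IsColouring α p m ∧ IsColouring β m q := by
  constructor
  · intro h
    let c : Fin 3 × Fin n → Prop := fun v =>
      ∃ x : Vertex n, Relation.EqvGen (productGraph α β) v (place 0 2 x) ∧ Sum.elim p q x
    have hc : ∀ u v, productGraph α β u v → (c u ↔ c v) := by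
      intro u v huv
      constructor
      · rintro ⟨x, hx, hp⟩
        exact ⟨x, .trans _ _ _ (.symm _ _ (.rel _ _ huv)) hx, hp⟩
      · rintro ⟨x, hx, hp⟩
        exact ⟨x, .trans _ _ _ (.rel _ _ huv) hx, hp⟩
    have ho : ∀ x, c (place 0 2 x) ↔ Sum.elim p q x := by
      intro x
      constructor
      · rintro ⟨y, hy, hp⟩
        exact (h x y hy).2 hp
      · intro hp
        exact ⟨x, .refl _, hp⟩
    have hu : ∀ x, Sum.elim p (fun i => c (1, i)) x ↔ c (place 0 1 x) := by
      rintro (i | i)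
      · exact (ho (Sum.inl i)).symm
      · exact Iff.rfl
    have hl : ∀ x, Sum.elim (fun i => c (1, i)) q x ↔ c (place 1 2 x) := by
      rintro (i | i)
      · exact Iff.rfl
      · exact (ho (Sum.inr i)).symm
    refine ⟨fun i => c (1, i), ?_, ?_⟩
    · intro x y hxy
      rw [hu, hu]
      exact hc _ _ (Or.inl ⟨x, y, hxy, rfl, rfl⟩)
    · intro x y hxy
      rw [hl, hl]
      exact hc _ _ (Or.inr ⟨x, y, hxy, rfl, rfl⟩)
  · rintro ⟨m, h1, h2⟩
    let c : Fin 3 × Fin n → Prop := fun v => (![p, m, q] v.1) v.2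
    have hu : ∀ x, c (place 0 1 x) ↔ Sum.elim p m x := by rintro (i | i) <;> rfl
    have hl : ∀ x, c (place 1 2 x) ↔ Sum.elim m q x := by rintro (i | i) <;> rfl
    have ho : ∀ x, c (place 0 2 x) ↔ Sum.elim p q x := by rintro (i | i) <;> rfl
    have hc : ∀ u v, Relation.EqvGen (productGraph α β) u v → (c u ↔ c v) := by
      intro u v huv
      induction huv with
      | rel u v h =>
        rcases h with ⟨x, y, hxy, rfl, rfl⟩ | ⟨x, y, hxy, rfl, rfl⟩
        · rw [hu, hu]; exact h1 x y hxy
        · rw [hl, hl]; exact h2 x y hxy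
      | refl => exact Iff.rfl
      | symm _ _ _ ih => exact ih.symm
      | trans _ _ _ _ _ ih ih' => exact ih.trans ih'
    intro x y hxy
    rw [← ho, ← ho]
    exact hc _ _ hxy

theorem colouring_one {n : ℕ} (p q : Fin n → Prop) :
    IsColouring (1 : Diagram n) p q ↔ p = q := by
  constructor
  · intro h
    funext i
    exact propext (h (Sum.inl i) (Sum.inr i) rfl)
  · rintro rfl x y (hxy : Sum.elim id id x = Sum.elim id id y)
    rcases x with i | i <;> rcases y with j | j <;> (cases hxy; exact Iff.rfl)

/-- The partition monoid. -/
instance {n : ℕ} : Monoid (Diagram n) where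
  mul_assoc α β γ := by
    apply colouring_ext
    intro p q
    simp only [colouring_mul]
    constructor
    · rintro ⟨m, ⟨l, h1, h2⟩, h3⟩
      exact ⟨l, h1, m, h2, h3⟩
    · rintro ⟨l, h1, m, h2, h3⟩
      exact ⟨m, ⟨l, h1, h2⟩, h3⟩
  one_mul α := by
    apply colouring_ext
    intro p q
    simp [colouring_mul, colouring_one]
  mul_one α := by
    apply colouring_ext
    intro p q
    simp [colouring_mul, colouring_one]

/-- The involution `α ↦ α*`, exchanging the two rows. -/
def Diagram.star {n : ℕ} (α : Diagram n) : Diagram n :=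
  ⟨Setoid.comap Sum.swap α.toSetoid⟩

/-- The rank: the number of blocks that meet both rows. -/
noncomputable def Diagram.rank {n : ℕ} (α : Diagram n) : ℕ :=
  Set.ncard {A ∈ α.toSetoid.classes | (∃ i, Sum.inl i ∈ A) ∧ ∃ j, Sum.inr j ∈ A}

/-- `x` lies in a block that meets both rows. -/
def Diagram.OnTransversal {n : ℕ} (α : Diagram n) (x : Vertex n) : Prop :=
  (∃ i, α.Rel x (Sum.inl i)) ∧ ∃ j, α.Rel x (Sum.inr j)

theorem Diagram.OnTransversal.of_rel {n : ℕ} {α : Diagram n} {x y : Vertex n}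
    (h : α.OnTransversal x) (hxy : α.Rel x y) : α.OnTransversal y := by
  obtain ⟨⟨i, hi⟩, j, hj⟩ := h
  exact ⟨⟨i, rel_trans (rel_symm hxy) hi⟩, j, rel_trans (rel_symm hxy) hj⟩

/-- The diagram of rank `0` whose blocks are the non-transversal blocks of `α`, the set of all
upper vertices on transversals of `α`, and the set of all lower vertices on transversals of `α`
(if `α` has transversals).  For a Brauer element `α` of rank `2` with transversals `{i, j'}` and
`{k, l'}` these two transversals are replaced by `{i, k}` and `{j', l'}`; an element `α` of rank
`0` is left unchanged. -/
def Diagram.hat {n : ℕ} (α : Diagram n) : Diagram n where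
  toSetoid :=
    { r := fun x y => x.isLeft = y.isLeft ∧
        (α.Rel x y ∨ (α.OnTransversal x ∧ α.OnTransversal y))
      iseqv :=
        { refl := fun x => ⟨rfl, Or.inl (α.rel_refl x)⟩
          symm := fun h => ⟨h.1.symm, h.2.imp rel_symm And.symm⟩
          trans := by
            rintro x y z ⟨h, h1⟩ ⟨h', h2⟩
            refine ⟨h.trans h', ?_⟩
            rcases h1 with h1 | h1 <;> rcases h2 with h2 | h2
            · exact Or.inl (rel_trans h1 h2)
            · exact Or.inr ⟨h2.1.of_rel (rel_symm h1), h2.2⟩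
            · exact Or.inr ⟨h1.1, h1.2.of_rel h2⟩
            · exact Or.inr ⟨h1.1, h2.2⟩ } }

end Partition

/-! ### The Brauer monoid -/

section Brauer

theorem blocks_two_iff {n : ℕ} (α : Diagram n) :
    (∀ A ∈ α.toSetoid.classes, A.ncard = 2) ↔ ∀ x, ∃! y, y ≠ x ∧ α.Rel x y := by
  constructor
  · intro h x
    obtain ⟨u, v, huv, hA⟩ := Set.ncard_eq_two.1 (h _ (α.toSetoid.mem_classes x))
    have hA' : ∀ y, α.Rel x y ↔ y = u ∨ y = v := by
      intro y
      have := Set.ext_iff.1 hA y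
      simp only [Set.mem_ofPred_eq, Set.mem_insert_iff, Set.mem_singleton_iff] at this
      rw [← this]
      exact ⟨Diagram.rel_symm, Diagram.rel_symm⟩
    rcases (hA' x).1 (α.rel_refl x) with rfl | rfl
    · refine ⟨v, ⟨huv.symm, (hA' v).2 (Or.inr rfl)⟩, ?_⟩
      rintro y ⟨hy, hxy⟩
      exact ((hA' y).1 hxy).resolve_left hy
    · refine ⟨u, ⟨huv, (hA' u).2 (Or.inl rfl)⟩, ?_⟩
      rintro y ⟨hy, hxy⟩
      exact ((hA' y).1 hxy).resolve_right hy
  · rintro h A ⟨x, rfl⟩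
    obtain ⟨y, ⟨hy, hxy⟩, hu⟩ := h x
    refine Set.ncard_eq_two.2 ⟨x, y, hy.symm, ?_⟩
    ext z
    simp only [Set.mem_ofPred_eq, Set.mem_insert_iff, Set.mem_singleton_iff]
    constructor
    · intro hz
      by_cases hzx : z = x
      · exact Or.inl hzx
      · exact Or.inr (hu z ⟨hzx, Diagram.rel_symm hz⟩)
    · rintro (rfl | rfl)
      · exact α.rel_refl _
      · exact Diagram.rel_symm hxy

/-- In a path formed by two involutions `a` and `b`, starting at a point fixed by `b` only, there
is exactly one other end point. -/
theorem existsUnique_end {V : Type*} [Finite V] (a b : Equiv.Perm V) (ha : a * a = 1)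
    (hb : b * b = 1) (x : V) (hx : b x = x) (hx' : a x ≠ x) (E : V → Prop) (hEx : E x)
    (hEa : ∀ u, E u → E (a u)) (hEb : ∀ u, E u → E (b u))
    (hmin : ∀ P : V → Prop, P x → (∀ u, P u → P (a u)) → (∀ u, P u → P (b u)) → ∀ u, E u → P u) :
    ∃! y, y ≠ x ∧ E y ∧ (a y = y ∨ b y = y) := by
  set c := a * b with hc
  have hbc : ∀ k : ℤ, b ((c ^ k) x) = (c ^ (-k)) x := by
    intro k
    have h1 : b * c * b⁻¹ = c⁻¹ := by
      rw [hc, mul_inv_rev, inv_eq_of_mul_eq_one_left ha, inv_eq_of_mul_eq_one_left hb]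
      rw [mul_assoc, mul_assoc, hb, mul_one]
    have h2 : b * c ^ k * b⁻¹ = c ^ (-k) := by
      rw [← conj_zpow, h1, inv_zpow, zpow_neg]
    have h3 : b⁻¹ x = x := by rw [Equiv.Perm.inv_eq_iff_eq]; exact hx.symm
    have := congrArg (fun g : Equiv.Perm V => g x) h2
    simpa [Equiv.Perm.mul_apply, h3] using this
  have hac : ∀ k : ℤ, a ((c ^ k) x) = (c ^ (1 - k)) x := by
    intro k
    have h1 : a = c * b := by rw [hc, mul_assoc, hb, mul_one]
    rw [sub_eq_add_neg, zpow_add, zpow_one, Equiv.Perm.mul_apply, ← hbc k]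
    conv_lhs => rw [h1]
    rfl
  have hE : ∀ y, E y ↔ ∃ k : ℤ, y = (c ^ k) x := by
    intro y
    constructor
    · refine hmin (fun y => ∃ k : ℤ, y = (c ^ k) x) ⟨0, rfl⟩ ?_ ?_ y
      · rintro _ ⟨k, rfl⟩
        exact ⟨_, hac k⟩
      · rintro _ ⟨k, rfl⟩
        exact ⟨_, hbc k⟩
    · rintro ⟨k, rfl⟩
      have hp : ∀ k : ℕ, E ((c ^ (k : ℤ)) x) := by
        intro k
        induction k with
        | zero => exact hEx
        | succ k ih =>
          have := hEa _ (hEb _ ih)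
          rw [hbc, hac] at this
          convert this using 3
          push_cast
          ring
      obtain ⟨k, rfl | rfl⟩ := k.eq_nat_or_neg
      · exact hp k
      · rw [← hbc]
        exact hEb _ (hp k)
  simp only [hE]
  obtain ⟨m, hm0, hm⟩ : ∃ m : ℕ, 0 < m ∧ ∀ k : ℤ, (c ^ k) x = x ↔ (m : ℤ) ∣ k := by
    refine ⟨Function.minimalPeriod (c • ·) x, ?_, fun k => ?_⟩
    · apply Function.minimalPeriod_pos_of_mem_periodicPts
      exact Function.mem_periodicPts.2 ⟨orderOf c, orderOf_pos c, by
        change (⇑c)^[orderOf c] x = x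
        rw [Equiv.Perm.iterate_eq_pow, pow_orderOf_eq_one]
        rfl⟩
    · exact MulAction.zpow_smul_eq_iff_minimalPeriod_dvd (a := c) (b := x) (n := k)
  have hm1 : m ≠ 1 := by
    rintro rfl
    have h1 := (hm 1).2 (by simp)
    rw [zpow_one, hc, Equiv.Perm.mul_apply, hx] at h1
    exact hx' h1
  have heq : ∀ k l : ℤ, (c ^ k) x = (c ^ l) x ↔ (m : ℤ) ∣ k - l := by
    intro k l
    rw [← hm, sub_eq_neg_add, zpow_add, Equiv.Perm.mul_apply, zpow_neg,
      Equiv.Perm.inv_eq_iff_eq]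
  have hfix : ∀ k : ℤ, (a ((c ^ k) x) = (c ^ k) x ∨ b ((c ^ k) x) = (c ^ k) x) ↔
      ((m : ℤ) ∣ 2 * k - 1 ∨ (m : ℤ) ∣ 2 * k) := by
    intro k
    rw [hac, hbc, heq, heq, ← dvd_neg, ← dvd_neg (b := -k - k)]
    ring_nf
  have hm2 : 2 ≤ m := by omega
  obtain ⟨j, hj⟩ | ⟨j, hj⟩ := Nat.even_or_odd m
  · refine ⟨(c ^ (j : ℤ)) x, ⟨?_, ⟨j, rfl⟩, (hfix j).2 (Or.inr ⟨1, by omega⟩)⟩, ?_⟩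
    · rw [ne_eq, hm, Int.natCast_dvd_natCast]
      exact Nat.not_dvd_of_pos_of_lt (by omega) (by omega)
    · rintro y ⟨hy, ⟨k, rfl⟩, hk⟩
      rw [hfix] at hk
      rw [ne_eq, hm] at hy
      rw [heq]
      have hmj : (m : ℤ) = 2 * j := by omega
      rw [hmj] at hk hy ⊢
      rcases hk with ⟨t, ht⟩ | ⟨t, ht⟩
      · exfalso
        have : 2 * (k - j * t) = 1 := by linarith
        omega
      · have hk' : k = j * t := by linarith
        obtain ⟨r, hr⟩ | ⟨r, hr⟩ := Int.even_or_odd t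
        · exact absurd ⟨r, by rw [hk', hr]; ring⟩ hy
        · exact ⟨r, by rw [hk', hr]; ring⟩
  · refine ⟨(c ^ ((j + 1 : ℕ) : ℤ)) x, ⟨?_, ⟨_, rfl⟩,
      (hfix _).2 (Or.inl ⟨1, by push_cast; omega⟩)⟩, ?_⟩
    · rw [ne_eq, hm, Int.natCast_dvd_natCast]
      exact Nat.not_dvd_of_pos_of_lt (by omega) (by omega)
    · rintro y ⟨hy, ⟨k, rfl⟩, hk⟩
      rw [hfix] at hk
      rw [ne_eq, hm] at hy
      rw [heq]
      have hmj : (m : ℤ) = 2 * j + 1 := by omega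
      rw [hmj] at hk hy ⊢
      push_cast
      rcases hk with ⟨t, ht⟩ | ⟨t, ht⟩
      · obtain ⟨r, hr⟩ | ⟨r, hr⟩ := Int.even_or_odd t
        · exfalso
          have : 2 * (k - (2 * j + 1) * r) = 1 := by rw [hr] at ht; linarith
          omega
        · refine ⟨r, ?_⟩
          rw [hr] at ht
          have : 2 * k = 2 * ((2 * j + 1) * r + (j + 1)) := by linarith
          linarith
      · exfalso
        obtain ⟨r, hr⟩ | ⟨r, hr⟩ := Int.even_or_odd t
        · apply hy
          refine ⟨r, ?_⟩
          rw [hr] at ht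
          linarith
        · rw [hr] at ht
          have : 2 * (k - (2 * j + 1) * r - j) = 1 := by linarith
          omega

theorem place_injective {n : ℕ} {i j : Fin 3} (h : i ≠ j) :
    Function.Injective (place (n := n) i j) := by
  rintro (x | x) (y | y) hxy <;> simp_all [place]

theorem exists_matching {n : ℕ} (α : Diagram n) (h : ∀ x, ∃! y, y ≠ x ∧ α.Rel x y)
    {i j : Fin 3} (hij : i ≠ j) :
    ∃ a : Equiv.Perm (Fin 3 × Fin n), a * a = 1 ∧ (∀ x, a (place i j x) ≠ place i j x) ∧
      (∀ v, v.1 ≠ i → v.1 ≠ j → a v = v) ∧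
      ∀ x, (∃ y, α.Rel x y ∧ a (place i j x) = place i j y) ∧
        ∀ y, α.Rel x y → place i j y = place i j x ∨ place i j y = a (place i j x) := by
  choose f hf hu using h
  have hu' : ∀ x y, α.Rel x y → y = x ∨ y = f x := by
    intro x y hxy
    by_cases hyx : y = x
    · exact Or.inl hyx
    · exact Or.inr (hu x y ⟨hyx, hxy⟩)
  have hinv : Function.Involutive f := fun x =>
    (hu (f x) x ⟨(hf x).1.symm, Diagram.rel_symm (hf x).2⟩).symm
  let ι : Vertex n ↪ Fin 3 × Fin n := ⟨place i j, place_injective hij⟩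
  have ha : ∀ x, (hinv.toPerm f).viaEmbedding ι (place i j x) = place i j (f x) :=
    fun x => Equiv.Perm.viaEmbedding_apply _ ι x
  refine ⟨(hinv.toPerm f).viaEmbedding ι, ?_, ?_, ?_, ?_⟩
  · rw [← Equiv.Perm.viaEmbeddingHom_apply, ← map_mul]
    have : hinv.toPerm f * hinv.toPerm f = 1 := Equiv.ext hinv
    rw [this, map_one]
  · intro x hx
    rw [ha] at hx
    exact (hf x).1 (place_injective hij hx)
  · intro v hi hj
    apply Equiv.Perm.viaEmbedding_apply_of_notMem
    rintro ⟨x | x, rfl⟩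
    · exact hi rfl
    · exact hj rfl
  · intro x
    refine ⟨⟨f x, (hf x).2, ha x⟩, fun y hxy => ?_⟩
    rw [ha]
    rcases hu' x y hxy with rfl | rfl
    · exact Or.inl rfl
    · exact Or.inr rfl

theorem blocks_two_mul {n : ℕ} (α β : Diagram n) (hα : ∀ x, ∃! y, y ≠ x ∧ α.Rel x y)
    (hβ : ∀ x, ∃! y, y ≠ x ∧ β.Rel x y) : ∀ x, ∃! y, y ≠ x ∧ (α * β).Rel x y := by
  obtain ⟨a, haa, ha1, ha2, ha3⟩ := exists_matching α hα (i := 0) (j := 1) (by decide)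
  obtain ⟨b, hbb, hb1, hb2, hb3⟩ := exists_matching β hβ (i := 1) (j := 2) (by decide)
  have haa' : ∀ v, a (a v) = v := fun v => congrArg (fun g : Equiv.Perm _ => g v) haa
  have hbb' : ∀ v, b (b v) = v := fun v => congrArg (fun g : Equiv.Perm _ => g v) hbb
  have hcases : ∀ v : Fin 3 × Fin n, (∃ x, v = place 0 1 x) ∨ v.1 = 2 := by
    rintro ⟨r, t⟩
    fin_cases r
    · exact Or.inl ⟨Sum.inl t, rfl⟩
    · exact Or.inl ⟨Sum.inr t, rfl⟩
    · exact Or.inr rfl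
  have hcases' : ∀ v : Fin 3 × Fin n, (∃ x, v = place 1 2 x) ∨ v.1 = 0 := by
    rintro ⟨r, t⟩
    fin_cases r
    · exact Or.inr rfl
    · exact Or.inl ⟨Sum.inl t, rfl⟩
    · exact Or.inl ⟨Sum.inr t, rfl⟩
  have hEa : ∀ v, Relation.EqvGen (productGraph α β) v (a v) := by
    intro v
    rcases hcases v with ⟨x, rfl⟩ | hv
    · obtain ⟨y, hxy, hy⟩ := (ha3 x).1
      exact .rel _ _ (Or.inl ⟨x, y, hxy, rfl, hy⟩)
    · rw [ha2 v (by rw [hv]; decide) (by rw [hv]; decide)]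
      exact .refl _
  have hEb : ∀ v, Relation.EqvGen (productGraph α β) v (b v) := by
    intro v
    rcases hcases' v with ⟨x, rfl⟩ | hv
    · obtain ⟨y, hxy, hy⟩ := (hb3 x).1
      exact .rel _ _ (Or.inr ⟨x, y, hxy, rfl, hy⟩)
    · rw [hb2 v (by rw [hv]; decide) (by rw [hv]; decide)]
      exact .refl _
  have hG : ∀ u v, productGraph α β u v → v = u ∨ v = a u ∨ v = b u := by
    rintro u v (⟨x, y, hxy, rfl, rfl⟩ | ⟨x, y, hxy, rfl, rfl⟩)
    · rcases (ha3 x).2 y hxy with h | h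
      · exact Or.inl h
      · exact Or.inr (Or.inl h)
    · rcases (hb3 x).2 y hxy with h | h
      · exact Or.inl h
      · exact Or.inr (Or.inr h)
  have hmin : ∀ P : Fin 3 × Fin n → Prop, (∀ u, P u → P (a u)) → (∀ u, P u → P (b u)) →
      ∀ u v, Relation.EqvGen (productGraph α β) u v → (P u ↔ P v) := by
    intro P hPa hPb u v huv
    induction huv with
    | rel u v h =>
      rcases hG u v h with rfl | rfl | rfl
      · exact Iff.rfl
      · exact ⟨hPa _, fun h => by simpa [haa'] using hPa _ h⟩
      · exact ⟨hPb _, fun h => by simpa [hbb'] using hPb _ h⟩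
    | refl => exact Iff.rfl
    | symm _ _ _ ih => exact ih.symm
    | trans _ _ _ _ _ ih ih' => exact ih.trans ih'
  have hout : ∀ v, (a v = v ∨ b v = v) ↔ ∃ x, v = place 0 2 x := by
    rintro ⟨r, t⟩
    fin_cases r
    · exact ⟨fun _ => ⟨Sum.inl t, rfl⟩, fun _ => Or.inr (hb2 (0, t) (by simp) (by simp))⟩
    · refine ⟨fun h => ?_, ?_⟩
      · rcases h with h | h
        · exact absurd h (ha1 (Sum.inr t))
        · exact absurd h (hb1 (Sum.inl t))
      · rintro ⟨x | x, hx⟩ <;> simp [place] at hx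
    · exact ⟨fun _ => ⟨Sum.inr t, rfl⟩, fun _ => Or.inl (ha2 (2, t) (by simp) (by simp))⟩
  have main : ∀ x, ∃! v, v ≠ place 0 2 x ∧
      Relation.EqvGen (productGraph α β) (place 0 2 x) v ∧ (a v = v ∨ b v = v) := by
    rintro (t | t)
    · exact existsUnique_end a b haa hbb _ (hb2 (0, t) (by simp) (by simp)) (ha1 (Sum.inl t)) _
        (.refl _) (fun u h => .trans _ _ _ h (hEa u)) (fun u h => .trans _ _ _ h (hEb u))
        (fun P h h1 h2 u hu => (hmin P h1 h2 _ _ hu).1 h)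
    · have := existsUnique_end b a hbb haa _ (ha2 (2, t) (by simp) (by simp)) (hb1 (Sum.inr t)) _
        (.refl _) (fun u h => .trans _ _ _ h (hEb u)) (fun u h => .trans _ _ _ h (hEa u))
        (fun P h h1 h2 u hu => (hmin P h2 h1 _ _ hu).1 h)
      simp only [or_comm (a := b _ = _)] at this
      exact this
  intro x
  obtain ⟨v, ⟨hv1, hv2, hv3⟩, hv⟩ := main x
  obtain ⟨y, rfl⟩ := (hout v).1 hv3
  refine ⟨y, ⟨fun h => hv1 (h ▸ rfl), hv2⟩, ?_⟩
  rintro z ⟨hz, hxz⟩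
  have hinj := place_injective (n := n) (i := 0) (j := 2) (by decide)
  exact hinj (hv _ ⟨fun h => hz (hinj h), hxz, (hout _).2 ⟨z, rfl⟩⟩)

theorem blocks_two_one {n : ℕ} : ∀ x, ∃! y, y ≠ x ∧ (1 : Diagram n).Rel x y := by
  intro x
  refine ⟨x.swap, ⟨by cases x <;> simp, ?_⟩, ?_⟩
  · change Sum.elim id id x = Sum.elim id id x.swap
    cases x <;> rfl
  · rintro y ⟨hy, hxy⟩
    change Sum.elim id id x = Sum.elim id id y at hxy
    rcases x with x | x <;> rcases y with y | y <;> simp_all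

/-- The Brauer monoid: all partitions whose blocks all have size `2`. -/
def Brauer (n : ℕ) : Submonoid (Diagram n) where
  carrier := {α | ∀ A ∈ α.toSetoid.classes, A.ncard = 2}
  mul_mem' {α β} hα hβ :=
    (blocks_two_iff _).2 (blocks_two_mul α β ((blocks_two_iff α).1 hα) ((blocks_two_iff β).1 hβ))
  one_mem' := (blocks_two_iff _).2 blocks_two_one

theorem blocks_two_star {n : ℕ} {α : Diagram n} (hα : α ∈ Brauer n) : α.star ∈ Brauer n := by
  refine (blocks_two_iff _).2 fun x => ?_
  obtain ⟨y, ⟨hy, hxy⟩, hu⟩ := (blocks_two_iff α).1 hα x.swap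
  refine ⟨y.swap, ⟨fun h => hy (by rw [← h, Sum.swap_swap]), ?_⟩, ?_⟩
  · change α.Rel x.swap y.swap.swap
    rwa [Sum.swap_swap]
  · rintro z ⟨hz, hxz⟩
    rw [← hu z.swap ⟨fun h => hz (Sum.swap_leftInverse.injective h), hxz⟩, Sum.swap_swap]

/-- The involution `α ↦ α*` of the Brauer monoid. -/
def brauerStar {n : ℕ} (α : Brauer n) : Brauer n :=
  ⟨α.1.star, blocks_two_star α.2⟩

/-- A congruence compatible with the involution. -/
def IsStarCongruence {n : ℕ} (c : Con (Brauer n)) : Prop :=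
  ∀ α β : Brauer n, c α β → c (brauerStar α) (brauerStar β)

/-- The set `I_q` of all Brauer elements of rank at most `q`. -/
def rankIdeal (n q : ℕ) : Set (Brauer n) :=
  {α | α.1.rank ≤ q}

/-- The edges `{i, (iσ)'}` for the first `q` vertices, and the edges joining vertices number
`q + 1, q + 2`, then `q + 3, q + 4`, and so on, in both rows. -/
inductive BarEdge {n q : ℕ} (σ : Equiv.Perm (Fin q)) : Vertex n → Vertex n → Prop
  | cross (i : Fin q) (a b : Fin n) (ha : a.val = i.val) (hb : b.val = (σ i).val) :
      BarEdge σ (Sum.inl a) (Sum.inr b)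
  | upper (k : ℕ) (a b : Fin n) (ha : a.val = q + 2 * k) (hb : b.val = q + 2 * k + 1) :
      BarEdge σ (Sum.inl a) (Sum.inl b)
  | lower (k : ℕ) (a b : Fin n) (ha : a.val = q + 2 * k) (hb : b.val = q + 2 * k + 1) :
      BarEdge σ (Sum.inr a) (Sum.inr b)

/-- The copy of a permutation `σ` of `q` letters among the diagrams of rank `q`
(for `q ≤ n` of the same parity as `n`). -/
def bar (n : ℕ) {q : ℕ} (σ : Equiv.Perm (Fin q)) : Diagram n :=
  ⟨Relation.EqvGen.setoid (BarEdge σ)⟩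

/-- The copy inside the Brauer monoid of a set (here: a subgroup) of permutations. -/
def barSubgroup (n : ℕ) {q : ℕ} (N : Subgroup (Equiv.Perm (Fin q))) : Set (Brauer n) :=
  {α | ∃ σ ∈ N, α.1 = bar n σ}

/-- `N` lies in one of the distinguished maximal subgroups, the copies of the symmetric groups of
degree `q`, one for each `J`-class. -/
def IsDistinguished {n : ℕ} (N : Set (Brauer n)) : Prop :=
  ∃ q : ℕ, q ≤ n ∧ q ≡ n [MOD 2] ∧ N ⊆ barSubgroup n (⊤ : Subgroup (Equiv.Perm (Fin q)))

/-- The Klein four-group of permutations of four letters. -/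
def klein : Subgroup (Equiv.Perm (Fin 4)) where
  carrier := {σ | σ = 1 ∨ σ = Equiv.swap 0 1 * Equiv.swap 2 3 ∨
    σ = Equiv.swap 0 2 * Equiv.swap 1 3 ∨ σ = Equiv.swap 0 3 * Equiv.swap 1 2}
  mul_mem' := by
    rintro a b (rfl | rfl | rfl | rfl) (rfl | rfl | rfl | rfl) <;>
      simp only [Set.mem_ofPred_eq] <;> decide
  one_mem' := Or.inl rfl
  inv_mem' := by
    rintro a (rfl | rfl | rfl | rfl) <;> simp only [Set.mem_ofPred_eq] <;> decide

/-- Names for the retractable IN-pairs: one for `n` odd, four for `n` even. -/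
inductive RetrPair (n : ℕ) : Type
  | C1 (h : Odd n)
  | C0 (h : Even n)
  | CS2 (h : Even n)
  | C2 (h : Even n)
  | CK (h : Even n)

/-- The ideal of the pair. -/
def RetrPair.ideal {n : ℕ} : RetrPair n → Set (Brauer n)
  | C1 _ => rankIdeal n 1
  | C0 _ => rankIdeal n 0
  | CS2 _ => rankIdeal n 0
  | C2 _ => rankIdeal n 2
  | CK _ => rankIdeal n 2

/-- The group of the pair. -/
def RetrPair.group {n : ℕ} : RetrPair n → Set (Brauer n)
  | C1 _ => barSubgroup n (⊥ : Subgroup (Equiv.Perm (Fin 3)))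
  | C0 _ => barSubgroup n (⊥ : Subgroup (Equiv.Perm (Fin 2)))
  | CS2 _ => barSubgroup n (⊤ : Subgroup (Equiv.Perm (Fin 2)))
  | C2 _ => barSubgroup n (⊥ : Subgroup (Equiv.Perm (Fin 4)))
  | CK _ => barSubgroup n klein

/-- Names for the congruences `R_q`, `R_N`, and `λ`, `ρ`, `μ` for the retractable pairs.  Here `q`
runs over the numbers up to `n` of the same parity as `n`, and `N` over the non-trivial normal
subgroups of the symmetric group of such a degree `q ≥ 2`. -/
inductive CongName (n : ℕ) : Type
  | R (q : ℕ) (hq : q ≤ n) (hp : q ≡ n [MOD 2])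
  | RN (q : ℕ) (h2 : 2 ≤ q) (hq : q ≤ n) (hp : q ≡ n [MOD 2])
      (N : Subgroup (Equiv.Perm (Fin q))) (hN : N.Normal) (h1 : N ≠ ⊥)
  | lam (C : RetrPair n)
  | rho (C : RetrPair n)
  | mu (C : RetrPair n)

/-- The relation with the given name. -/
def CongName.rel {n : ℕ} : CongName n → Brauer n → Brauer n → Prop
  | R q _ _ => reesRel (rankIdeal n q)
  | RN q _ _ _ N _ _ => inRel (rankIdeal n (q - 2)) (barSubgroup n N)
  | lam C => lamRel C.ideal C.group
  | rho C => rhoRel C.ideal C.group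
  | mu C => muRel C.ideal C.group

/-- The name of `R_{I,N}` for a retractable pair `(I, N)`: the top of the diamond belonging to
the pair. -/
inductive DiamondTop {n : ℕ} : RetrPair n → CongName n → Prop
  | C1 (h hq hp) : DiamondTop (.C1 h) (.R 1 hq hp)
  | C0 (h hq hp) : DiamondTop (.C0 h) (.R 0 hq hp)
  | CS2 (h h2 hq hp hN h1) : DiamondTop (.CS2 h) (.RN 2 h2 hq hp ⊤ hN h1)
  | C2 (h hq hp) : DiamondTop (.C2 h) (.R 2 hq hp)
  | CK (h h2 hq hp hN h1) : DiamondTop (.CK h) (.RN 4 h2 hq hp klein hN h1)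

/-- Consecutive retractable pairs (for `n` even). -/
inductive PairStep {n : ℕ} : RetrPair n → RetrPair n → Prop
  | C0 (h h') : PairStep (.C0 h) (.CS2 h')
  | CS2 (h h') : PairStep (.CS2 h) (.C2 h')
  | C2 (h h') : PairStep (.C2 h) (.CK h')

/-- The edges of the Hasse diagram of the congruence lattice, from the lower to the upper end. -/
inductive HasseEdge {n : ℕ} : CongName n → CongName n → Prop
  /- the diamonds -/
  | mu_lam (C) : HasseEdge (.mu C) (.lam C)
  | mu_rho (C) : HasseEdge (.mu C) (.rho C)
  | lam_top (C T) (h : DiamondTop C T) : HasseEdge (.lam C) T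
  | rho_top (C T) (h : DiamondTop C T) : HasseEdge (.rho C) T
  /- from each diamond to the next -/
  | mu_mu (C C') (h : PairStep C C') : HasseEdge (.mu C) (.mu C')
  | lam_lam (C C') (h : PairStep C C') : HasseEdge (.lam C) (.lam C')
  | rho_rho (C C') (h : PairStep C C') : HasseEdge (.rho C) (.rho C')
  /- the chain of the congruences `R_q` and `R_N` -/
  | R_S2 (hq hp h2 hq' hp' hN h1) :
      HasseEdge (.R 0 hq hp) (.RN 2 h2 hq' hp' ⊤ hN h1)
  | R_K (hq hp h2 hq' hp' hN h1) :
      HasseEdge (.R 2 hq hp) (.RN 4 h2 hq' hp' klein hN h1)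
  | K_A4 (h2 hq hp hN h1 hN' h1') :
      HasseEdge (.RN 4 h2 hq hp klein hN h1) (.RN 4 h2 hq hp (alternatingGroup (Fin 4)) hN' h1')
  | R_A (q) (h : q = 1 ∨ 3 ≤ q) (hq hp h2 hq' hp' hN h1) :
      HasseEdge (.R q hq hp) (.RN (q + 2) h2 hq' hp' (alternatingGroup (Fin (q + 2))) hN h1)
  | A_S (q) (h : 3 ≤ q) (h2 hq hp hN h1 hN' h1') :
      HasseEdge (.RN q h2 hq hp (alternatingGroup (Fin q)) hN h1) (.RN q h2 hq hp ⊤ hN' h1')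
  | S_R (q) (h2 hq hp hN h1 hq' hp') :
      HasseEdge (.RN q h2 hq hp ⊤ hN h1) (.R q hq' hp')

/-- The names of the congruences that are not compatible with the involution. -/
def CongName.IsOneSided {n : ℕ} : CongName n → Prop
  | lam _ => True
  | rho _ => True
  | _ => False

end Brauer

end DiagramMonoid

open DiagramMonoid

/-!
The congruences of the Brauer monoid are found by comparing a congruence with the minimal ideal
`M`, which consists of the elements of rank at most `1` and is a rectangular band.  A Brauer element
is handled through its fixed-point-free involution `mate` of the vertices, and multiplication by a
`hook` (a pair of horizontal edges, all other edges being vertical) switches two edges of it.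

*Green's relations.*  Two elements are `R`-related if and only if they have the same upper blocks
(`greenR_iff`), dually for `L`, and an element divides another if and only if its rank is not smaller
(`mem_principalIdeal_iff`).  This gives the ideals (`isIdeal_iff`), and shows that `ν_N` is determined
by translating to a distinguished maximal subgroup (`nuRel_iff`).

*Retractions.*  The map `retr`, `x ↦ x m x` with `m ∈ M`, is the only candidate for a retraction onto
`M`.  It is one on the elements of rank at most `2`, whose two transversals can be closed up in one
way only; three transversals can be closed up in several ways (`isRetraction_retr`,
`not_isRetraction`).  Among the normal subgroups of the symmetric groups of degree `2`, `3` and `4`,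
those whose elements all act alike on `M` are the trivial ones, `S_2` and the Klein four-group
(`actsAlike_two`, `eq_one_of_actsAlike_three`, `actsAlike_four_iff`).  Hence the list of retractable IN-pairs.

*One form for all congruences.*  Each relation of the list is of the form `LatRel s r N`: it is `ν_N`
in rank `r + 2`, and in rank at most `r` it is the pullback along `retr` of one of the four relations
`H`, `L`, `R`, universal on `M`, which `s` encodes.  Conversely every congruence `c` has this form
(`exists_latCon_eq`).  If `c` identifies elements of `M` with different lower rows, then it identifies
all elements of `M` with the same upper row (`lowFull_of_not_greenL`), so that there are only four
possibilities on `M`.  A related pair outside `H` makes `c` contract the whole ideal generated by the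
larger element into `M` (`retr_rel_of_not_greenH`), and a related pair of different elements inside
`H` becomes a pair outside `H`, of rank smaller by `2`, when two transversals are hooked together
(`exists_hook_not_greenL`).  So if `r` is the largest rank that `c` contracts into `M`, then related
elements of rank `r + 2` are `H`-related, and there are no related pairs above.  A contracted rank
`≥ 3`, or a group of permutations that do not act alike on `M`, forces `c` to collapse `M`
(`full_of_rank_lt`, `full_of_acts_ne`), which singles out the retractable pairs.

*The lattice.*  The congruences `LatRel s r N` are ordered componentwise by `s` and lexicographically
by `r` and `N` (`latCon_le_iff`), and the normal subgroups of a symmetric group form a chain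
(`normal_cases`).  So the lattice embeds into a product `(Bool × Bool) × ℕ` by `CongName.code` in such
a way that the edges of the Hasse diagram are coverings of codes (`HasseEdge.code_covBy`), and every
strict inequality starts with an edge (`exists_hasseEdge`).
-/

namespace DiagramMonoid

/-! ### Brauer elements as matchings -/

section Mate

variable {n : ℕ}

/-- The vertex sharing a block with `x`; a Brauer element is the same thing as the fixed-point-free
involution `mate α` of the vertices. -/
noncomputable def mate (α : Brauer n) (x : Vertex n) : Vertex n :=
  ((blocks_two_iff α.1).1 α.2 x).choose

theorem mate_ne (α : Brauer n) (x : Vertex n) : mate α x ≠ x :=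
  ((blocks_two_iff α.1).1 α.2 x).choose_spec.1.1

theorem rel_mate (α : Brauer n) (x : Vertex n) : α.1.Rel x (mate α x) :=
  ((blocks_two_iff α.1).1 α.2 x).choose_spec.1.2

theorem mate_eq {α : Brauer n} {x y : Vertex n} (hne : y ≠ x) (h : α.1.Rel x y) :
    mate α x = y :=
  (((blocks_two_iff α.1).1 α.2 x).choose_spec.2 y ⟨hne, h⟩).symm

theorem rel_iff {α : Brauer n} {x y : Vertex n} : α.1.Rel x y ↔ y = x ∨ y = mate α x := by
  constructor
  · intro h
    by_cases hy : y = x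
    · exact Or.inl hy
    · exact Or.inr (mate_eq hy h).symm
  · rintro (rfl | rfl)
    · exact α.1.rel_refl _
    · exact rel_mate α x

theorem rel_of_mate {α : Brauer n} {x y : Vertex n} (h : mate α x = y) : α.1.Rel x y :=
  rel_iff.2 (Or.inr h.symm)

@[simp] theorem mate_mate (α : Brauer n) (x : Vertex n) : mate α (mate α x) = x :=
  mate_eq (mate_ne α x).symm (Diagram.rel_symm (rel_mate α x))

theorem mate_injective (α : Brauer n) : Function.Injective (mate α) :=
  Function.LeftInverse.injective (mate_mate α)

theorem mate_comm {α : Brauer n} {x y : Vertex n} (h : mate α x = y) : mate α y = x := by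
  rw [← h, mate_mate]

theorem ext_mate {α β : Brauer n} (h : ∀ x, mate α x = mate β x) : α = β := by
  apply Subtype.ext
  apply Diagram.rel_ext
  intro x y
  rw [rel_iff, rel_iff, h]

/-- The Brauer element with a given fixed-point-free involution. -/
def ofMate (f : Vertex n → Vertex n) (hf : ∀ x, f (f x) = x) (hne : ∀ x, f x ≠ x) : Brauer n :=
  ⟨⟨{ r := fun x y => y = x ∨ y = f x
      iseqv :=
        { refl := fun _ => Or.inl rfl
          symm := by
            rintro x y (rfl | rfl)
            · exact Or.inl rfl
            · exact Or.inr (hf x).symm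
          trans := by
            rintro x y z (rfl | rfl) (rfl | rfl)
            · exact Or.inl rfl
            · exact Or.inr rfl
            · exact Or.inr rfl
            · exact Or.inl (hf x) } }⟩, by
    refine (blocks_two_iff _).2 fun x => ⟨f x, ⟨hne x, Or.inr rfl⟩, ?_⟩
    rintro y ⟨hy, h | h⟩
    · exact absurd h hy
    · exact h⟩

@[simp] theorem mate_ofMate (f : Vertex n → Vertex n) (hf : ∀ x, f (f x) = x)
    (hne : ∀ x, f x ≠ x) (x : Vertex n) : mate (ofMate f hf hne) x = f x :=
  mate_eq (hne x) (Or.inr rfl)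

/-- Renaming the vertices along a permutation, which may mix the two rows. -/
noncomputable def relabel (π : Equiv.Perm (Vertex n)) (α : Brauer n) : Brauer n :=
  ofMate (fun x => π (mate α (π⁻¹ x))) (by intro x; simp) (by
    intro x h
    apply mate_ne α (π⁻¹ x)
    rw [Equiv.Perm.eq_inv_iff_eq]
    exact h)

theorem mate_relabel (π : Equiv.Perm (Vertex n)) (α : Brauer n) (x : Vertex n) :
    mate (relabel π α) x = π (mate α (π⁻¹ x)) :=
  mate_ofMate _ _ _ _

@[simp] theorem mate_relabel_apply (π : Equiv.Perm (Vertex n)) (α : Brauer n) (x : Vertex n) :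
    mate (relabel π α) (π x) = π (mate α x) := by
  rw [mate_relabel]; simp

@[simp] theorem relabel_one (α : Brauer n) : relabel 1 α = α :=
  ext_mate fun x => by simp [mate_relabel]

theorem relabel_eq_iff {π : Equiv.Perm (Vertex n)} {α β : Brauer n} :
    relabel π α = β ↔ ∀ x, mate β (π x) = π (mate α x) := by
  constructor
  · rintro rfl x
    simp
  · intro h
    refine ext_mate fun x => ?_
    have := h (π⁻¹ x)
    rw [mate_relabel, ← this]
    simp

/-- Join `x` to `y`, and their former partners to each other. -/
noncomputable def switch (α : Brauer n) (x y : Vertex n) : Brauer n :=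
  relabel (Equiv.swap y (mate α x)) α

theorem mate_switch_left (α : Brauer n) {x y : Vertex n} (h : x ≠ y) :
    mate (switch α x y) x = y := by
  have h1 : Equiv.swap y (mate α x) x = x :=
    Equiv.swap_apply_of_ne_of_ne h (mate_ne α x).symm
  have h2 := mate_relabel_apply (Equiv.swap y (mate α x)) α x
  rw [h1, Equiv.swap_apply_right] at h2
  exact h2

theorem mate_switch_mate (α : Brauer n) {x y : Vertex n} (hxy : x ≠ y) (_ : mate α x ≠ y) :
    mate (switch α x y) (mate α x) = mate α y := by
  have h1 : Equiv.swap y (mate α x) (mate α y) = mate α y :=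
    Equiv.swap_apply_of_ne_of_ne (mate_ne α y) (fun h => hxy (mate_injective α h).symm)
  have h2 := mate_relabel_apply (Equiv.swap y (mate α x)) α y
  rw [h1, Equiv.swap_apply_left] at h2
  exact h2

theorem mate_switch_of_ne (α : Brauer n) {x y z : Vertex n} (h1 : z ≠ x) (h2 : z ≠ y)
    (h3 : z ≠ mate α x) (h4 : z ≠ mate α y) : mate (switch α x y) z = mate α z := by
  have e1 : Equiv.swap y (mate α x) z = z := Equiv.swap_apply_of_ne_of_ne h2 h3
  have e2 : Equiv.swap y (mate α x) (mate α z) = mate α z :=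
    Equiv.swap_apply_of_ne_of_ne (fun h => h4 (by rw [← h, mate_mate]))
      (fun h => h1 (mate_injective α h))
  have h := mate_relabel_apply (Equiv.swap y (mate α x)) α z
  rw [e1, e2] at h
  exact h

theorem switch_of_mate (α : Brauer n) {x y : Vertex n} (h : mate α x = y) : switch α x y = α := by
  rw [switch, h, Equiv.swap_self]
  exact relabel_one α

theorem switch_self (α : Brauer n) (x : Vertex n) : switch α x x = α := by
  refine relabel_eq_iff.2 fun z => ?_
  by_cases h1 : z = x
  · rw [h1, Equiv.swap_apply_left, Equiv.swap_apply_right, mate_mate]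
  by_cases h2 : z = mate α x
  · rw [h2, Equiv.swap_apply_right, mate_mate, Equiv.swap_apply_left]
  rw [Equiv.swap_apply_of_ne_of_ne h1 h2, Equiv.swap_apply_of_ne_of_ne]
  · exact fun h => h2 (mate_comm h).symm
  · exact fun h => h1 (mate_injective α h)

theorem mate_switch_right (α : Brauer n) {x y : Vertex n} (h : x ≠ y) :
    mate (switch α x y) y = x :=
  mate_comm (mate_switch_left α h)

/-- Switching at two points is the only change: an element that has the switched edges and agrees
with `α` elsewhere is the switched element. -/
theorem eq_switch {α β : Brauer n} {x y : Vertex n} (hxy : x ≠ y) (h1 : mate β x = y)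
    (h2 : mate α x ≠ y → mate β (mate α x) = mate α y)
    (h3 : ∀ z, z ≠ x → z ≠ y → z ≠ mate α x → z ≠ mate α y → mate β z = mate α z) :
    β = switch α x y := by
  by_cases hm : mate α x = y
  · rw [switch_of_mate α hm]
    refine ext_mate fun z => ?_
    by_cases hzx : z = x
    · rw [hzx, h1, hm]
    by_cases hzy : z = y
    · rw [hzy, mate_comm h1, mate_comm hm]
    exact h3 z hzx hzy (by rwa [hm]) (by rwa [mate_comm hm])
  · refine ext_mate fun z => ?_
    by_cases hzx : z = x
    · rw [hzx, h1, mate_switch_left α hxy]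
    by_cases hzy : z = y
    · rw [hzy, mate_comm h1, mate_switch_right α hxy]
    by_cases hzx' : z = mate α x
    · rw [hzx', h2 hm, mate_switch_mate α hxy hm]
    by_cases hzy' : z = mate α y
    · rw [hzy', mate_comm (h2 hm), mate_comm (mate_switch_mate α hxy hm)]
    rw [h3 z hzx hzy hzx' hzy', mate_switch_of_ne α hzx hzy hzx' hzy']

theorem switch_comm (α : Brauer n) (x y : Vertex n) : switch α x y = switch α y x := by
  by_cases hxy : x = y
  · rw [hxy]
  refine (eq_switch (Ne.symm hxy) (mate_switch_right α hxy) ?_ ?_)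
  · intro h
    exact mate_comm (mate_switch_mate α hxy fun h' => h (mate_comm h'))
  · intro z h1 h2 h3 h4
    exact mate_switch_of_ne α h2 h1 h4 h3

/-- The involution acts on matchings by exchanging the rows. -/
theorem mate_star (α : Brauer n) (x : Vertex n) :
    mate (brauerStar α) x = (mate α x.swap).swap := by
  refine mate_eq ?_ ?_
  · intro h
    apply mate_ne α x.swap
    conv_rhs => rw [← h, Sum.swap_swap]
  · change α.1.Rel x.swap (mate α x.swap).swap.swap
    rw [Sum.swap_swap]
    exact rel_mate α _

@[simp] theorem star_star (α : Brauer n) : brauerStar (brauerStar α) = α :=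
  ext_mate fun x => by simp [mate_star]

end Mate

/-! ### Products of matchings -/

section Product

variable {n : ℕ}

theorem colouring_star (α : Diagram n) (p q : Fin n → Prop) :
    IsColouring α.star p q ↔ IsColouring α q p := by
  have key : ∀ x : Vertex n, Sum.elim p q x ↔ Sum.elim q p x.swap := by
    rintro (i | i) <;> exact Iff.rfl
  constructor
  · intro h x y hxy
    have := h x.swap y.swap (by
      change α.Rel x.swap.swap y.swap.swap
      rwa [Sum.swap_swap, Sum.swap_swap])
    rwa [key, key, Sum.swap_swap, Sum.swap_swap] at this
  · intro h x y hxy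
    rw [key, key]
    exact h _ _ hxy

@[simp] theorem star_mul (α β : Brauer n) :
    brauerStar (α * β) = brauerStar β * brauerStar α := by
  apply Subtype.ext
  change (α.1 * β.1).star = β.1.star * α.1.star
  apply colouring_ext
  intro p q
  simp only [colouring_star, colouring_mul]
  exact exists_congr fun m => and_comm

@[simp] theorem star_one : brauerStar (1 : Brauer n) = 1 := by
  have h := star_mul (1 : Brauer n) (brauerStar 1)
  rw [one_mul, star_star, one_mul] at h
  exact h.symm

/-- In the product with `β` on the right, the vertex `x` of the left factor survives as the outer
vertex `x'`: either it is an upper vertex, or `β` continues it by a transversal. -/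
def Thru (β : Brauer n) (x x' : Vertex n) : Prop :=
  (∃ i, x = Sum.inl i ∧ x' = Sum.inl i) ∨
    ∃ i j, x = Sum.inr i ∧ x' = Sum.inr j ∧ mate β (Sum.inl i) = Sum.inr j

theorem Thru.inl (β : Brauer n) (i : Fin n) : Thru β (Sum.inl i) (Sum.inl i) :=
  Or.inl ⟨i, rfl, rfl⟩

theorem Thru.inr {β : Brauer n} {i j : Fin n} (h : mate β (Sum.inl i) = Sum.inr j) :
    Thru β (Sum.inr i) (Sum.inr j) :=
  Or.inr ⟨i, j, rfl, rfl, h⟩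

theorem Thru.injective {β : Brauer n} {x y x' : Vertex n} (h : Thru β x x') (h' : Thru β y x') :
    x = y := by
  rcases h with ⟨i, rfl, rfl⟩ | ⟨i, j, rfl, rfl, h⟩ <;>
    rcases h' with ⟨k, rfl, h1⟩ | ⟨k, l, rfl, h1, h2⟩
  · rw [h1]
  · cases h1
  · cases h1
  · cases h1
    rw [← h] at h2
    have := mate_injective β h2
    cases this
    rfl

theorem gen_left {α β : Brauer n} {x y : Vertex n} (h : α.1.Rel x y) :
    Relation.EqvGen (productGraph α.1 β.1) (place 0 1 x) (place 0 1 y) :=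
  .rel _ _ (Or.inl ⟨x, y, h, rfl, rfl⟩)

theorem gen_right {α β : Brauer n} {x y : Vertex n} (h : β.1.Rel x y) :
    Relation.EqvGen (productGraph α.1 β.1) (place 1 2 x) (place 1 2 y) :=
  .rel _ _ (Or.inr ⟨x, y, h, rfl, rfl⟩)

theorem Thru.gen {α β : Brauer n} {x x' : Vertex n} (h : Thru β x x') :
    Relation.EqvGen (productGraph α.1 β.1) (place 0 1 x) (place 0 2 x') := by
  rcases h with ⟨i, rfl, rfl⟩ | ⟨i, j, rfl, rfl, h⟩
  · exact .refl _
  · exact gen_right (α := α) (rel_of_mate h)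

/-- An edge of the left factor whose ends survive is an edge of the product. -/
theorem mate_mul_of_thru {α β : Brauer n} {x y x' y' : Vertex n} (h : mate α x = y)
    (hx : Thru β x x') (hy : Thru β y y') : mate (α * β) x' = y' := by
  refine mate_eq ?_ ?_
  · rintro rfl
    have := hx.injective hy
    exact mate_ne α x (h.trans this.symm)
  · exact .trans _ _ _ (.symm _ _ hx.gen) (.trans _ _ _ (gen_left (rel_of_mate h)) hy.gen)

/-- Two edges of the left factor joined by an upper edge of the right factor. -/
theorem mate_mul_of_bridge {α β : Brauer n} {x y x' y' : Vertex n} {i j : Fin n}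
    (h1 : mate α x = Sum.inr i) (h : mate β (Sum.inl i) = Sum.inl j)
    (h2 : mate α (Sum.inr j) = y) (hx : Thru β x x') (hy : Thru β y y') :
    mate (α * β) x' = y' := by
  refine mate_eq ?_ ?_
  · rintro rfl
    have := hx.injective hy
    rw [this, ← h2, mate_mate] at h1
    cases h1
    exact mate_ne β _ h
  · exact .trans _ _ _ (.symm _ _ hx.gen) (.trans _ _ _ (gen_left (rel_of_mate h1))
      (.trans _ _ _ (gen_right (α := α) (rel_of_mate h))
        (.trans _ _ _ (gen_left (rel_of_mate h2)) hy.gen)))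

theorem mate_mul_upper {α : Brauer n} {i j : Fin n} (β : Brauer n)
    (h : mate α (Sum.inl i) = Sum.inl j) : mate (α * β) (Sum.inl i) = Sum.inl j :=
  mate_mul_of_thru h (.inl β i) (.inl β j)

theorem mate_mul_lower {β : Brauer n} {i j : Fin n} (α : Brauer n)
    (h : mate β (Sum.inr i) = Sum.inr j) : mate (α * β) (Sum.inr i) = Sum.inr j := by
  have h1 : mate (brauerStar β) (Sum.inl i) = Sum.inl j := by simp [mate_star, h]
  have h2 := mate_mul_upper (brauerStar α) h1
  rw [← star_mul, mate_star] at h2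
  exact Sum.swap_leftInverse.injective h2

theorem mate_mul_cross {α β : Brauer n} {i j k : Fin n} (h : mate α (Sum.inl i) = Sum.inr j)
    (h' : mate β (Sum.inl j) = Sum.inr k) : mate (α * β) (Sum.inl i) = Sum.inr k :=
  mate_mul_of_thru h (.inl β i) (.inr h')

/-- A lower edge of the left factor, continued by two transversals of the right factor. -/
theorem mate_mul_lower_cross {α β : Brauer n} {i j k l : Fin n}
    (h : mate α (Sum.inr i) = Sum.inr j) (hi : mate β (Sum.inl i) = Sum.inr k)
    (hj : mate β (Sum.inl j) = Sum.inr l) : mate (α * β) (Sum.inr k) = Sum.inr l :=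
  mate_mul_of_thru h (.inr hi) (.inr hj)

/-- An upper edge of the right factor, continued by two transversals of the left factor. -/
theorem mate_mul_upper_cross {α β : Brauer n} {i j k l : Fin n}
    (h : mate β (Sum.inl i) = Sum.inl j) (hi : mate α (Sum.inl k) = Sum.inr i)
    (hj : mate α (Sum.inl l) = Sum.inr j) : mate (α * β) (Sum.inl k) = Sum.inl l :=
  mate_mul_of_bridge hi h (mate_comm hj) (.inl β k) (.inl β l)

/-- The unit `{i, (π i)'}` of the Brauer monoid. -/
noncomputable def unitOf (π : Equiv.Perm (Fin n)) : Brauer n :=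
  ofMate (Sum.elim (fun i => Sum.inr (π i)) (fun i => Sum.inl (π⁻¹ i)))
    (by rintro (i | i) <;> simp) (by rintro (i | i) <;> simp)

theorem mate_unitOf_inl (π : Equiv.Perm (Fin n)) (i : Fin n) :
    mate (unitOf π) (Sum.inl i) = Sum.inr (π i) := mate_ofMate _ _ _ _

theorem mul_unitOf (α : Brauer n) (π : Equiv.Perm (Fin n)) :
    α * unitOf π = relabel (Equiv.sumCongr 1 π) α := by
  symm
  refine relabel_eq_iff.2 fun x => ?_
  have key : ∀ x, Thru (unitOf π) x (Equiv.sumCongr 1 π x) := by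
    rintro (i | i)
    · exact .inl _ i
    · exact .inr (mate_unitOf_inl π i)
  exact mate_mul_of_thru rfl (key x) (key _)

theorem star_unitOf (π : Equiv.Perm (Fin n)) : brauerStar (unitOf π) = unitOf π⁻¹ :=
  ext_mate fun x => by
    rw [mate_star]
    rcases x with i | i <;> simp [unitOf]

/-- The matching with upper edge `{a, b}`, lower edge `{a', b'}`, and vertical edges elsewhere. -/
noncomputable def hook (a b : Fin n) : Brauer n := switch 1 (Sum.inl a) (Sum.inl b)

theorem mate_one (x : Vertex n) : mate (1 : Brauer n) x = x.swap :=
  mate_eq (by rcases x with i | i <;> simp) (by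
    change Sum.elim id id x = Sum.elim id id x.swap
    rcases x with i | i <;> rfl)

theorem mul_hook (α : Brauer n) (a b : Fin n) :
    α * hook a b = switch α (Sum.inr a) (Sum.inr b) := by
  by_cases hab : a = b
  · rw [hab, switch_self, hook, switch_self, mul_one]
  have hab1 : (Sum.inl a : Vertex n) ≠ Sum.inl b := fun h => hab (Sum.inl_injective h)
  have hab2 : (Sum.inr a : Vertex n) ≠ Sum.inr b := fun h => hab (Sum.inr_injective h)
  have e1 : mate (hook a b) (Sum.inl a) = Sum.inl b := mate_switch_left 1 hab1
  have e2 : mate (hook a b) (Sum.inr a) = Sum.inr b := by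
    have := mate_switch_mate (1 : Brauer n) hab1 (by simp [mate_one])
    simpa [mate_one, hook] using this
  have e3 : ∀ x : Vertex n, x ≠ Sum.inr a → x ≠ Sum.inr b → Thru (hook a b) x x := by
    rintro (i | i) h1 h2
    · exact .inl _ i
    · refine .inr ?_
      have h := mate_switch_of_ne (1 : Brauer n) (x := Sum.inl a) (y := Sum.inl b) (z := Sum.inl i)
        (fun h => h1 (by cases h; rfl)) (fun h => h2 (by cases h; rfl))
        (by simp [mate_one]) (by simp [mate_one])
      rw [mate_one] at h
      exact h
  refine eq_switch hab2 (mate_mul_lower α e2) ?_ ?_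
  · intro h
    have hb : mate α (Sum.inr b) ≠ Sum.inr a := fun h' => h (mate_comm h')
    exact mate_mul_of_bridge (mate_mate _ _) e1 rfl (e3 _ (mate_ne _ _) h)
      (e3 _ hb (mate_ne _ _))
  · intro z h1 h2 h3 h4
    exact mate_mul_of_thru rfl (e3 z h1 h2)
      (e3 _ (fun h => h3 (mate_comm h).symm) (fun h => h4 (mate_comm h).symm))

end Product

/-! ### Green's relations in a monoid -/

section Green

variable {S : Type*} [Monoid S] {a b c : S}

theorem greenR_iff_exists : GreenR a b ↔ (∃ s, a * s = b) ∧ ∃ t, b * t = a := by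
  constructor
  · intro h
    have h1 : b ∈ Set.range (fun s : S => b * s) := ⟨1, mul_one b⟩
    have h2 : a ∈ Set.range (fun s : S => a * s) := ⟨1, mul_one a⟩
    rw [GreenR] at h
    rw [← h] at h1
    rw [h] at h2
    exact ⟨h1, h2⟩
  · rintro ⟨⟨s, rfl⟩, t, ht⟩
    apply Set.Subset.antisymm
    · rintro _ ⟨x, rfl⟩
      exact ⟨t * x, by simp only [← mul_assoc] at ht ⊢; rw [ht]⟩
    · rintro _ ⟨x, rfl⟩
      exact ⟨s * x, by simp only [mul_assoc]⟩

theorem greenL_iff_exists : GreenL a b ↔ (∃ s, s * a = b) ∧ ∃ t, t * b = a := by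
  constructor
  · intro h
    have h1 : b ∈ Set.range (fun s : S => s * b) := ⟨1, one_mul b⟩
    have h2 : a ∈ Set.range (fun s : S => s * a) := ⟨1, one_mul a⟩
    rw [GreenL] at h
    rw [← h] at h1
    rw [h] at h2
    exact ⟨h1, h2⟩
  · rintro ⟨⟨s, rfl⟩, t, ht⟩
    apply Set.Subset.antisymm
    · rintro _ ⟨x, rfl⟩
      exact ⟨x * t, by simp only [mul_assoc] at ht ⊢; rw [ht]⟩
    · rintro _ ⟨x, rfl⟩
      exact ⟨x * s, by simp only [mul_assoc]⟩

theorem mem_principalIdeal_self (a : S) : a ∈ principalIdeal a := ⟨1, 1, by simp⟩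

theorem principalIdeal_subset (h : a ∈ principalIdeal b) : principalIdeal a ⊆ principalIdeal b := by
  obtain ⟨s, t, rfl⟩ := h
  rintro _ ⟨x, y, rfl⟩
  exact ⟨x * s, t * y, by simp only [mul_assoc]⟩

theorem greenJ_iff_mem : GreenJ a b ↔ a ∈ principalIdeal b ∧ b ∈ principalIdeal a := by
  constructor
  · intro h
    exact ⟨h ▸ mem_principalIdeal_self a, h.symm ▸ mem_principalIdeal_self b⟩
  · rintro ⟨h1, h2⟩
    exact Set.Subset.antisymm (principalIdeal_subset h1) (principalIdeal_subset h2)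

theorem GreenR.refl (a : S) : GreenR a a := Eq.refl _
theorem GreenR.symm (h : GreenR a b) : GreenR b a := Eq.symm h
theorem GreenR.trans (h : GreenR a b) (h' : GreenR b c) : GreenR a c := Eq.trans h h'
theorem GreenL.refl (a : S) : GreenL a a := Eq.refl _
theorem GreenL.symm (h : GreenL a b) : GreenL b a := Eq.symm h
theorem GreenL.trans (h : GreenL a b) (h' : GreenL b c) : GreenL a c := Eq.trans h h'
theorem GreenH.refl (a : S) : GreenH a a := ⟨.refl a, .refl a⟩
theorem GreenH.symm (h : GreenH a b) : GreenH b a := ⟨h.1.symm, h.2.symm⟩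
theorem GreenH.trans (h : GreenH a b) (h' : GreenH b c) : GreenH a c :=
  ⟨h.1.trans h'.1, h.2.trans h'.2⟩

theorem GreenR.mul_left (x : S) (h : GreenR a b) : GreenR (x * a) (x * b) := by
  obtain ⟨⟨s, hs⟩, t, ht⟩ := greenR_iff_exists.1 h
  exact greenR_iff_exists.2 ⟨⟨s, by rw [mul_assoc, hs]⟩, t, by rw [mul_assoc, ht]⟩

theorem GreenL.mul_right (x : S) (h : GreenL a b) : GreenL (a * x) (b * x) := by
  obtain ⟨⟨s, hs⟩, t, ht⟩ := greenL_iff_exists.1 h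
  exact greenL_iff_exists.2 ⟨⟨s, by rw [← mul_assoc, hs]⟩, t, by rw [← mul_assoc, ht]⟩

end Green

/-! ### Rank and transversals -/

section Rank

variable {n : ℕ}

open Classical in
/-- The upper ends of the transversals. -/
noncomputable def dom (α : Brauer n) : Finset (Fin n) :=
  Finset.univ.filter fun i => ∃ j, mate α (Sum.inl i) = Sum.inr j

theorem mem_dom {α : Brauer n} {i : Fin n} :
    i ∈ dom α ↔ ∃ j, mate α (Sum.inl i) = Sum.inr j := by
  simp [dom]

theorem notMem_dom {α : Brauer n} {i : Fin n} :
    i ∉ dom α ↔ ∃ j, mate α (Sum.inl i) = Sum.inl j := by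
  rw [mem_dom]
  rcases h : mate α (Sum.inl i) with j | j <;> simp

theorem card_dom (α : Brauer n) : (dom α).card = α.1.rank := by
  have key : {A ∈ α.1.toSetoid.classes | (∃ i, Sum.inl i ∈ A) ∧ ∃ j, Sum.inr j ∈ A}
      = (fun i : Fin n => {y | α.1.toSetoid y (Sum.inl i)}) '' (dom α : Set (Fin n)) := by
    ext A
    constructor
    · rintro ⟨⟨x, rfl⟩, ⟨i, hi⟩, j, hj⟩
      have hij : α.1.Rel (Sum.inl i) (Sum.inr j) :=
        Diagram.rel_trans hi (Diagram.rel_symm hj)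
      refine ⟨i, mem_dom.2 ⟨j, mate_eq (by simp) hij⟩, ?_⟩
      ext y
      exact ⟨fun h => Diagram.rel_trans h hi, fun h => Diagram.rel_trans h (Diagram.rel_symm hi)⟩
    · rintro ⟨i, hi, rfl⟩
      obtain ⟨j, hj⟩ := mem_dom.1 hi
      exact ⟨⟨_, rfl⟩, ⟨i, α.1.rel_refl _⟩, j, Diagram.rel_symm (rel_of_mate hj)⟩
  rw [Diagram.rank, key, Set.InjOn.ncard_image, Set.ncard_coe_finset]
  intro i hi j hj hij
  have h1 : α.1.Rel (Sum.inl i) (Sum.inl j) := by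
    have : Sum.inl i ∈ {y | α.1.toSetoid y (Sum.inl i)} := α.1.rel_refl _
    rw [show {y | α.1.toSetoid y (Sum.inl i)} = {y | α.1.toSetoid y (Sum.inl j)} from hij] at this
    exact this
  obtain ⟨k, hk⟩ := mem_dom.1 hi
  rcases rel_iff.1 h1 with h | h
  · exact (Sum.inl_injective h).symm
  · rw [hk] at h
    cases h

theorem rank_le (α : Brauer n) : α.1.rank ≤ n := by
  rw [← card_dom]
  exact (Finset.card_le_univ _).trans (by simp)

theorem rank_star (α : Brauer n) : (brauerStar α).1.rank = α.1.rank := by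
  have key : ∀ β : Brauer n, (dom β).card ≤ (dom (brauerStar β)).card := by
    intro β
    have hc : ∀ i ∈ dom β, ∃ j, mate β (Sum.inl i) = Sum.inr j := fun i hi => mem_dom.1 hi
    choose! f hf using hc
    refine Finset.card_le_card_of_injOn f ?_ ?_
    · intro i hi
      have := mate_comm (hf i hi)
      exact mem_dom.2 ⟨i, by simp [mate_star, this]⟩
    · intro i hi j hj hij
      have h1 := hf i hi
      rw [hij, ← hf j hj] at h1
      exact Sum.inl_injective (mate_injective β h1)
  rw [← card_dom, ← card_dom]
  refine le_antisymm ?_ (key α)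
  simpa using key (brauerStar α)

theorem dom_mul_subset (α β : Brauer n) : dom (α * β) ⊆ dom α := by
  intro i hi
  by_contra h
  obtain ⟨j, hj⟩ := notMem_dom.1 h
  exact notMem_dom.2 ⟨j, mate_mul_upper β hj⟩ hi

theorem rank_mul_le_left (α β : Brauer n) : (α * β).1.rank ≤ α.1.rank := by
  rw [← card_dom, ← card_dom]
  exact Finset.card_le_card (dom_mul_subset α β)

theorem rank_mul_le_right (α β : Brauer n) : (α * β).1.rank ≤ β.1.rank := by
  have h := rank_mul_le_left (brauerStar β) (brauerStar α)
  rwa [← star_mul, rank_star, rank_star] at h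

theorem rank_mul_mul_le (s α t : Brauer n) : (s * α * t).1.rank ≤ α.1.rank :=
  (rank_mul_le_left _ _).trans (rank_mul_le_right _ _)

theorem rank_one : (1 : Brauer n).1.rank = n := by
  rw [← card_dom]
  have : dom (1 : Brauer n) = Finset.univ := by
    ext i
    simp [mem_dom, mate_one]
  rw [this]
  simp

theorem star_switch (α : Brauer n) (x y : Vertex n) :
    brauerStar (switch α x y) = switch (brauerStar α) x.swap y.swap := by
  by_cases hxy : x = y
  · rw [hxy, switch_self, switch_self]
  have hsw := (Sum.swap_leftInverse (α := Fin n) (β := Fin n)).injective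
  refine eq_switch (fun h => hxy (hsw h)) ?_ ?_ ?_
  · rw [mate_star, Sum.swap_swap, mate_switch_left α hxy]
  · intro h
    rw [mate_star, mate_star, mate_star, Sum.swap_swap, Sum.swap_swap, Sum.swap_swap,
      mate_switch_mate α hxy]
    rintro h'
    apply h
    rw [mate_star, Sum.swap_swap, h']
  · intro z h1 h2 h3 h4
    rw [mate_star, mate_star, mate_switch_of_ne]
    · rintro rfl; simp at h1
    · rintro rfl; simp at h2
    · intro h; apply h3; rw [mate_star, Sum.swap_swap, ← h, Sum.swap_swap]
    · intro h; apply h4; rw [mate_star, Sum.swap_swap, ← h, Sum.swap_swap]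

theorem hook_mul (α : Brauer n) (a b : Fin n) :
    hook a b * α = switch α (Sum.inl a) (Sum.inl b) := by
  have h1 : brauerStar (hook a b) = hook a b := by
    have h := mul_hook 1 a b
    rw [one_mul] at h
    rw [hook, star_switch, star_one]
    exact h.symm
  have h2 := congrArg brauerStar (mul_hook (brauerStar α) a b)
  rw [star_mul, h1, star_star, star_switch, star_star] at h2
  exact h2

/-- Hooking two transversals together removes exactly these two. -/
theorem dom_switch_of_mem {α : Brauer n} {i j : Fin n} (hij : i ≠ j) (hi : i ∈ dom α)
    (hj : j ∈ dom α) : dom (switch α (Sum.inl i) (Sum.inl j)) = ((dom α).erase i).erase j := by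
  have hij' : (Sum.inl i : Vertex n) ≠ Sum.inl j := fun h => hij (Sum.inl_injective h)
  obtain ⟨i', hi'⟩ := mem_dom.1 hi
  obtain ⟨j', hj'⟩ := mem_dom.1 hj
  ext k
  simp only [Finset.mem_erase]
  by_cases hki : k = i
  · subst hki
    simp [mem_dom, mate_switch_left α hij']
  by_cases hkj : k = j
  · subst hkj
    simp [mem_dom, mate_switch_right α hij']
  rw [mem_dom, mate_switch_of_ne, ← mem_dom]
  · simp [hki, hkj]
  · simpa using hki
  · simpa using hkj
  · simp [hi']
  · simp [hj']

theorem rank_switch_of_mem {α : Brauer n} {i j : Fin n} (hij : i ≠ j) (hi : i ∈ dom α)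
    (hj : j ∈ dom α) : (switch α (Sum.inl i) (Sum.inl j)).1.rank + 2 = α.1.rank := by
  rw [← card_dom, ← card_dom, dom_switch_of_mem hij hi hj]
  have h1 : j ∈ (dom α).erase i := Finset.mem_erase.2 ⟨hij.symm, hj⟩
  have := Finset.card_erase_add_one h1
  have := Finset.card_erase_add_one hi
  omega

/-- Hooking a transversal to an upper block moves the upper end of the transversal. -/
theorem dom_switch_of_mem_of_mate {α : Brauer n} {i j k : Fin n} (hi : i ∈ dom α)
    (hj : mate α (Sum.inl j) = Sum.inl k) :
    dom (switch α (Sum.inl i) (Sum.inl j)) = insert k ((dom α).erase i) := by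
  obtain ⟨i', hi'⟩ := mem_dom.1 hi
  have hij' : (Sum.inl i : Vertex n) ≠ Sum.inl j := by
    intro h; rw [← h, hi'] at hj; cases hj
  have hkd : k ∉ dom α := notMem_dom.2 ⟨j, mate_comm hj⟩
  have hjd : j ∉ dom α := notMem_dom.2 ⟨k, hj⟩
  ext l
  simp only [Finset.mem_insert, Finset.mem_erase]
  by_cases hli : l = i
  · subst hli
    simp only [mem_dom, mate_switch_left α hij']
    simp
    rintro rfl; exact hkd hi
  by_cases hlj : l = j
  · subst hlj
    simp only [mem_dom, mate_switch_right α hij']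
    simp
    refine ⟨?_, fun _ => mem_dom.not.1 hjd |> not_exists.1⟩
    rintro rfl; exact mate_ne α _ hj
  by_cases hlk : l = k
  · subst hlk
    have h := mate_switch_mate α hij' (by rw [hi']; simp)
    rw [hj, hi'] at h
    simp only [mem_dom, mate_comm h]
    simp
  rw [mem_dom, mate_switch_of_ne, ← mem_dom]
  · simp [hli, hlk]
  · simpa using hli
  · simpa using hlj
  · simp [hi']
  · simpa [hj] using hlk

theorem dom_switch_of_notMem {α : Brauer n} {i j : Fin n} (hi : i ∉ dom α) (hj : j ∉ dom α) :
    dom (switch α (Sum.inl i) (Sum.inl j)) = dom α := by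
  obtain ⟨i', hi'⟩ := notMem_dom.1 hi
  obtain ⟨j', hj'⟩ := notMem_dom.1 hj
  by_cases hij : i = j
  · rw [hij, switch_self]
  by_cases hm : i' = j
  · rw [switch_of_mate α (by rw [hi', hm])]
  have hij' : (Sum.inl i : Vertex n) ≠ Sum.inl j := fun h => hij (Sum.inl_injective h)
  have h := mate_switch_mate α hij' (by rw [hi']; simpa using hm)
  rw [hi', hj'] at h
  ext l
  by_cases hli : l = i
  · subst hli
    exact iff_of_false (notMem_dom.2 ⟨j, mate_switch_left α hij'⟩) hi
  by_cases hlj : l = j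
  · subst hlj
    exact iff_of_false (notMem_dom.2 ⟨i, mate_switch_right α hij'⟩) hj
  by_cases hli' : l = i'
  · subst hli'
    exact iff_of_false (notMem_dom.2 ⟨_, h⟩) (notMem_dom.2 ⟨_, mate_comm hi'⟩)
  by_cases hlj' : l = j'
  · subst hlj'
    exact iff_of_false (notMem_dom.2 ⟨_, mate_comm h⟩) (notMem_dom.2 ⟨_, mate_comm hj'⟩)
  rw [mem_dom, mate_switch_of_ne, ← mem_dom]
  · simpa using hli
  · simpa using hlj
  · simpa [hi'] using hli'
  · simpa [hj'] using hlj'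

theorem rank_switch_of_not_both {α : Brauer n} {i j : Fin n} (h : ¬ (i ∈ dom α ∧ j ∈ dom α)) :
    (switch α (Sum.inl i) (Sum.inl j)).1.rank = α.1.rank := by
  have key : ∀ {i j : Fin n}, i ∈ dom α → j ∉ dom α →
      (switch α (Sum.inl i) (Sum.inl j)).1.rank = α.1.rank := by
    intro i j hi hj
    obtain ⟨k, hk⟩ := notMem_dom.1 hj
    have hkd : k ∉ dom α := notMem_dom.2 ⟨j, mate_comm hk⟩
    rw [← card_dom, ← card_dom, dom_switch_of_mem_of_mate hi hk,
      Finset.card_insert_of_notMem (fun h => hkd (Finset.mem_of_mem_erase h)),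
      Finset.card_erase_add_one hi]
  by_cases hi : i ∈ dom α
  · exact key hi fun hj => h ⟨hi, hj⟩
  by_cases hj : j ∈ dom α
  · rw [switch_comm]
    exact key hj hi
  · rw [← card_dom, ← card_dom, dom_switch_of_notMem hi hj]

/-- The involution of the upper vertices given by the upper blocks; it fixes the ends of the
transversals. -/
noncomputable def upInv (α : Brauer n) : Equiv.Perm (Fin n) :=
  Function.Involutive.toPerm
    (fun i => Sum.elim id (fun _ => i) (mate α (Sum.inl i))) (by
      intro i
      rcases h : mate α (Sum.inl i) with j | j
      · simp [h, mate_comm h]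
      · simp [h])

theorem upInv_of_inl {α : Brauer n} {i j : Fin n} (h : mate α (Sum.inl i) = Sum.inl j) :
    upInv α i = j := by
  change Sum.elim id (fun _ => i) (mate α (Sum.inl i)) = j
  rw [h]; rfl

theorem upInv_of_inr {α : Brauer n} {i j : Fin n} (h : mate α (Sum.inl i) = Sum.inr j) :
    upInv α i = i := by
  change Sum.elim id (fun _ => i) (mate α (Sum.inl i)) = i
  rw [h]; rfl

theorem upInv_eq_self_iff {α : Brauer n} {i : Fin n} : upInv α i = i ↔ i ∈ dom α := by
  constructor
  · intro h
    by_contra h'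
    obtain ⟨j, hj⟩ := notMem_dom.1 h'
    rw [upInv_of_inl hj] at h
    exact mate_ne α _ (h ▸ hj)
  · intro h
    obtain ⟨j, hj⟩ := mem_dom.1 h
    exact upInv_of_inr hj

theorem upInv_cycleType (α : Brauer n) :
    ∃ k, (upInv α).cycleType = Multiset.replicate k 2 ∧ α.1.rank + 2 * k = n := by
  have h2 : upInv α ^ 2 = 1 := by
    rw [pow_two]
    ext i
    exact congrArg Fin.val (Function.Involutive.toPerm_involutive _ i)
  refine ⟨_, Equiv.Perm.cycleType_of_pow_prime_eq_one (p := 2) h2, ?_⟩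
  have h3 := (upInv α).sum_cycleType
  rw [Equiv.Perm.cycleType_of_pow_prime_eq_one (p := 2) h2] at h3
  simp only [Multiset.sum_replicate, smul_eq_mul] at h3
  have h4 : dom α = (upInv α).supportᶜ := by
    ext i
    simp [upInv_eq_self_iff]
  have h5 := Finset.card_compl (upInv α).support
  have h6 := Finset.card_le_univ (upInv α).support
  rw [← h4, card_dom] at h5
  simp only [Fintype.card_fin] at h5 h6
  omega

theorem rank_mod_two (α : Brauer n) : α.1.rank % 2 = n % 2 := by
  obtain ⟨k, -, hk⟩ := upInv_cycleType α
  omega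

end Rank

/-! ### Green's relations in the Brauer monoid -/

section BrauerGreen

variable {n : ℕ}

theorem mate_mul_star_inl {α : Brauer n} {i j : Fin n} (h : mate α (Sum.inl i) = Sum.inr j) :
    mate (α * brauerStar α) (Sum.inl i) = Sum.inr i :=
  mate_mul_cross h (by simp [mate_star, mate_comm h])

theorem mate_mul_star_inr {α : Brauer n} {i j : Fin n} (h : mate α (Sum.inl i) = Sum.inl j) :
    mate (α * brauerStar α) (Sum.inr i) = Sum.inr j :=
  mate_mul_lower α (by simp [mate_star, h])

theorem mul_proj {α γ : Brauer n}
    (h : ∀ i j, mate α (Sum.inl i) = Sum.inl j → mate γ (Sum.inr i) = Sum.inr j) :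
    γ * (α * brauerStar α) = γ := by
  have key : ∀ x, (∀ i, x = Sum.inr i → i ∈ dom α) → Thru (α * brauerStar α) x x := by
    rintro (i | i) hi
    · exact .inl _ i
    · obtain ⟨j, hj⟩ := mem_dom.1 (hi i rfl)
      exact .inr (mate_mul_star_inl hj)
  refine ext_mate fun x => ?_
  by_cases hx : ∃ i, x = Sum.inr i ∧ i ∉ dom α
  · obtain ⟨i, rfl, hi⟩ := hx
    obtain ⟨j, hj⟩ := notMem_dom.1 hi
    rw [mate_mul_lower γ (mate_mul_star_inr hj), h i j hj]
  · refine mate_mul_of_thru rfl (key x ?_) (key _ ?_)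
    · intro i hi
      by_contra h'
      exact hx ⟨i, hi, h'⟩
    · intro i hi
      by_contra h'
      obtain ⟨j, hj⟩ := notMem_dom.1 h'
      have h1 := h i j hj
      rw [← hi, mate_mate] at h1
      exact hx ⟨j, h1, notMem_dom.2 ⟨i, mate_comm hj⟩⟩

/-- The projection `α α*` is a left identity for all elements that have the upper blocks of `α`. -/
theorem proj_mul {α γ : Brauer n}
    (h : ∀ i j, mate α (Sum.inl i) = Sum.inl j → mate γ (Sum.inl i) = Sum.inl j) :
    α * brauerStar α * γ = γ := by
  have h1 := mul_proj (α := α) (γ := brauerStar γ) (by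
    intro i j hij
    simp [mate_star, h i j hij])
  have h2 := congrArg brauerStar h1
  simpa using h2

@[simp] theorem mul_star_mul_self (α : Brauer n) : α * brauerStar α * α = α :=
  proj_mul fun _ _ h => h

/-- Two elements are `R`-related if and only if they have the same upper blocks. -/
theorem greenR_iff {α β : Brauer n} :
    GreenR α β ↔ ∀ i j, mate α (Sum.inl i) = Sum.inl j ↔ mate β (Sum.inl i) = Sum.inl j := by
  rw [greenR_iff_exists]
  constructor
  · rintro ⟨⟨s, rfl⟩, t, ht⟩ i j
    exact ⟨mate_mul_upper s, fun h => ht ▸ mate_mul_upper t h⟩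
  · intro h
    exact ⟨⟨brauerStar α * β, by rw [← mul_assoc, proj_mul fun i j => (h i j).1]⟩,
      brauerStar β * α, by rw [← mul_assoc, proj_mul fun i j => (h i j).2]⟩

/-- Inclusion of upper blocks and comparison of ranks give the relation `R`. -/
theorem greenR_of_upper {α β : Brauer n}
    (h : ∀ i j, mate α (Sum.inl i) = Sum.inl j → mate β (Sum.inl i) = Sum.inl j)
    (hr : α.1.rank ≤ β.1.rank) : GreenR α β := by
  have h1 : dom β ⊆ dom α := by
    intro i hi
    by_contra h'
    obtain ⟨j, hj⟩ := notMem_dom.1 h'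
    exact notMem_dom.2 ⟨j, h i j hj⟩ hi
  have h2 : dom β = dom α := Finset.eq_of_subset_of_card_le h1 (by rwa [card_dom, card_dom])
  refine greenR_iff.2 fun i j => ⟨h i j, fun hb => ?_⟩
  have hi : i ∉ dom α := by
    rw [← h2]
    exact notMem_dom.2 ⟨j, hb⟩
  obtain ⟨k, hk⟩ := notMem_dom.1 hi
  rw [hk, ← h i k hk, hb]

theorem greenR_mul_of_rank {α x : Brauer n} (h : α.1.rank ≤ (α * x).1.rank) :
    GreenR α (α * x) :=
  greenR_of_upper (fun _ _ => mate_mul_upper x) h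

theorem greenR_star {α β : Brauer n} :
    GreenR (brauerStar α) (brauerStar β) ↔ GreenL α β := by
  rw [greenR_iff_exists, greenL_iff_exists]
  constructor
  · rintro ⟨⟨s, hs⟩, t, ht⟩
    exact ⟨⟨brauerStar s, by simpa using congrArg brauerStar hs⟩,
      brauerStar t, by simpa using congrArg brauerStar ht⟩
  · rintro ⟨⟨s, hs⟩, t, ht⟩
    exact ⟨⟨brauerStar s, by simpa using congrArg brauerStar hs⟩,
      brauerStar t, by simpa using congrArg brauerStar ht⟩

theorem greenL_star {α β : Brauer n} :
    GreenL (brauerStar α) (brauerStar β) ↔ GreenR α β := by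
  rw [← greenR_star, star_star, star_star]

theorem greenL_mul_of_rank {α x : Brauer n} (h : α.1.rank ≤ (x * α).1.rank) :
    GreenL α (x * α) := by
  rw [← greenR_star, star_mul]
  apply greenR_mul_of_rank
  rwa [← star_mul, rank_star, rank_star]

/-- Two elements are `L`-related if and only if they have the same lower blocks. -/
theorem greenL_iff {α β : Brauer n} :
    GreenL α β ↔ ∀ i j, mate α (Sum.inr i) = Sum.inr j ↔ mate β (Sum.inr i) = Sum.inr j := by
  rw [← greenR_star, greenR_iff]
  have key : ∀ (γ : Brauer n) (i j : Fin n),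
      mate (brauerStar γ) (Sum.inl i) = Sum.inl j ↔ mate γ (Sum.inr i) = Sum.inr j := by
    intro γ i j
    rw [mate_star]
    constructor
    · intro h
      exact Sum.swap_leftInverse.injective h
    · intro h
      change (mate γ (Sum.inr i)).swap = _
      rw [h]; rfl
  simp only [key]

theorem dom_eq_of_greenR {α β : Brauer n} (h : GreenR α β) : dom α = dom β := by
  ext i
  rw [← not_iff_not, notMem_dom, notMem_dom]
  exact exists_congr fun j => greenR_iff.1 h i j

theorem rank_eq_of_greenR {α β : Brauer n} (h : GreenR α β) : α.1.rank = β.1.rank := by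
  rw [← card_dom, ← card_dom, dom_eq_of_greenR h]

theorem rank_eq_of_greenL {α β : Brauer n} (h : GreenL α β) : α.1.rank = β.1.rank := by
  rw [← rank_star α, ← rank_star β]
  exact rank_eq_of_greenR (greenR_star.2 h)

/-- The projection `α α*` depends on the `R`-class of `α` only. -/
theorem proj_eq_of_greenR {α β : Brauer n} (h : GreenR α β) :
    α * brauerStar α = β * brauerStar β := by
  have h1 : α * brauerStar α * (β * brauerStar β) = β * brauerStar β := by
    rw [← mul_assoc, proj_mul fun i j => (greenR_iff.1 h i j).1]
  have h2 : β * brauerStar β * (α * brauerStar α) = α * brauerStar α := by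
    rw [← mul_assoc, proj_mul fun i j => (greenR_iff.1 h i j).2]
  have h3 := congrArg brauerStar h2
  simp only [star_mul, star_star] at h3
  rw [← h3, h1]

theorem proj_mul_of_greenR {α β : Brauer n} (h : GreenR α β) :
    α * brauerStar α * β = β := by
  rw [proj_eq_of_greenR h, mul_star_mul_self]

theorem mul_proj_of_greenL {α β : Brauer n} (h : GreenL α β) :
    β * (brauerStar α * α) = β := by
  have := congrArg brauerStar (proj_mul_of_greenR (greenR_star.2 h))
  simpa using this

theorem unitOf_mul (α : Brauer n) (π : Equiv.Perm (Fin n)) :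
    unitOf π * α = relabel (Equiv.sumCongr π⁻¹ 1) α := by
  have h := congrArg brauerStar (mul_unitOf (brauerStar α) π⁻¹)
  rw [star_mul, star_unitOf, inv_inv, star_star] at h
  rw [h]
  refine ext_mate fun x => ?_
  rw [mate_star, mate_relabel, mate_relabel]
  rcases x with i | i
  · rcases h : mate α (Sum.inl (π i)) with j | j <;> simp [mate_star, h]
  · rcases h : mate α (Sum.inr i) with j | j <;> simp [mate_star, h]

theorem unitOf_mul_unitOf_inv (π : Equiv.Perm (Fin n)) : unitOf π * unitOf π⁻¹ = 1 := by
  refine ext_mate fun x => ?_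
  rw [mul_unitOf, mate_relabel, mate_one]
  rcases x with i | i <;> simp [unitOf]

theorem unitOf_inv_mul_unitOf (π : Equiv.Perm (Fin n)) : unitOf π⁻¹ * unitOf π = 1 := by
  simpa using unitOf_mul_unitOf_inv π⁻¹

theorem rank_unitOf_mul (π : Equiv.Perm (Fin n)) (α : Brauer n) :
    (unitOf π * α).1.rank = α.1.rank := by
  apply le_antisymm (rank_mul_le_right _ _)
  have := rank_mul_le_right (unitOf π⁻¹) (unitOf π * α)
  rwa [← mul_assoc, unitOf_inv_mul_unitOf, one_mul] at this

/-- Elements of the same rank are `R`-related up to a renaming of the upper vertices, because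
involutions with the same number of fixed points are conjugate. -/
theorem exists_unitOf_mul_greenR {α β : Brauer n} (h : α.1.rank = β.1.rank) :
    ∃ π, GreenR (unitOf π * α) β := by
  obtain ⟨k, hk, hk'⟩ := upInv_cycleType α
  obtain ⟨l, hl, hl'⟩ := upInv_cycleType β
  have hkl : k = l := by omega
  have hc : IsConj (upInv α) (upInv β) := by
    rw [Equiv.Perm.isConj_iff_cycleType_eq, hk, hl, hkl]
  obtain ⟨π, hπ⟩ := isConj_iff.1 hc
  refine ⟨π⁻¹, greenR_of_upper ?_ (by rw [rank_unitOf_mul, h])⟩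
  intro i j hij
  rw [unitOf_mul, inv_inv, mate_relabel] at hij
  have h1 : mate α (Sum.inl (π⁻¹ i)) = Sum.inl (π⁻¹ j) := by
    rw [← Equiv.Perm.eq_inv_iff_eq] at hij
    exact hij
  have h2 : upInv β i = j := by
    rw [← hπ, Equiv.Perm.mul_apply, Equiv.Perm.mul_apply, upInv_of_inl h1]
    simp
  have hij' : i ≠ j := by
    rintro rfl
    exact mate_ne _ _ h1
  have h3 : i ∉ dom β := fun hi => hij' (by rw [← h2, upInv_eq_self_iff.2 hi])
  obtain ⟨k, hk⟩ := notMem_dom.1 h3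
  rw [upInv_of_inl hk] at h2
  rw [hk, h2]

/-- Elements of the same rank divide each other, with a unit on the left. -/
theorem exists_eq_unitOf_mul_mul {α β : Brauer n} (h : α.1.rank = β.1.rank) :
    ∃ π t, β = unitOf π * α * t := by
  obtain ⟨π, hπ⟩ := exists_unitOf_mul_greenR h
  obtain ⟨⟨s, hs⟩, -⟩ := greenR_iff_exists.1 hπ
  exact ⟨π, s, hs.symm⟩

theorem exists_hook_rank {α : Brauer n} (h : 2 ≤ α.1.rank) :
    ∃ i j, i ≠ j ∧ i ∈ dom α ∧ j ∈ dom α ∧ (hook i j * α).1.rank + 2 = α.1.rank := by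
  rw [← card_dom] at h
  obtain ⟨i, hi, j, hj, hij⟩ := Finset.one_lt_card.1 h
  exact ⟨i, j, hij, hi, hj, by rw [hook_mul, rank_switch_of_mem hij hi hj]⟩

/-- The principal two-sided ideal of `α` consists of the elements of at most the rank of `α`. -/
theorem mem_principalIdeal_iff {α β : Brauer n} :
    β ∈ principalIdeal α ↔ β.1.rank ≤ α.1.rank := by
  constructor
  · rintro ⟨s, t, rfl⟩
    exact rank_mul_mul_le s α t
  · intro h
    obtain ⟨k, hk⟩ : ∃ k, α.1.rank = β.1.rank + k := ⟨_, (Nat.add_sub_of_le h).symm⟩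
    induction k using Nat.strong_induction_on generalizing α with
    | _ k ih =>
      rcases Nat.eq_zero_or_pos k with rfl | hpos
      · obtain ⟨π, t, ht⟩ := exists_eq_unitOf_mul_mul (α := α) (β := β) (by omega)
        exact ⟨_, _, ht⟩
      · have h1 := rank_mod_two α
        have h2 := rank_mod_two β
        obtain ⟨i, j, -, -, -, hr⟩ := exists_hook_rank (α := α) (by omega)
        have h3 := ih (k - 2) (by omega) (α := hook i j * α) (by omega) (by omega)
        exact principalIdeal_subset ⟨hook i j, 1, (mul_one _).symm⟩ h3

theorem greenJ_iff {α β : Brauer n} : GreenJ α β ↔ α.1.rank = β.1.rank := by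
  rw [greenJ_iff_mem, mem_principalIdeal_iff, mem_principalIdeal_iff]
  exact ⟨fun h => le_antisymm h.1 h.2, fun h => ⟨h.le, h.ge⟩⟩

theorem isStableClass (α : Brauer n) : IsStableClass α := by
  intro x _ a
  rw [greenJ_iff, greenJ_iff]
  exact ⟨fun h => (greenR_mul_of_rank h.ge).symm, fun h => (greenL_mul_of_rank h.ge).symm⟩

theorem isRegularClass (α : Brauer n) : IsRegularClass α :=
  fun x _ => ⟨brauerStar x, (mul_star_mul_self x).symm⟩

theorem exists_rank {q : ℕ} (hq : q ≤ n) (hp : q ≡ n [MOD 2]) :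
    ∃ α : Brauer n, α.1.rank = q := by
  obtain ⟨k, hk⟩ : ∃ k, n = q + 2 * k := by
    have h : q % 2 = n % 2 := hp
    exact ⟨(n - q) / 2, by omega⟩
  have key : ∀ j, j ≤ k → ∃ α : Brauer n, α.1.rank + 2 * j = n := by
    intro j
    induction j with
    | zero => exact fun _ => ⟨1, rank_one⟩
    | succ j ih =>
      intro hj
      obtain ⟨α, hα⟩ := ih (by omega)
      obtain ⟨i, i', -, -, -, hr⟩ := exists_hook_rank (α := α) (by omega)
      exact ⟨hook i i' * α, by omega⟩
  obtain ⟨α, hα⟩ := key k le_rfl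
  exact ⟨α, by omega⟩

theorem isIdeal_rankIdeal {q : ℕ} (hq : q ≤ n) (hp : q ≡ n [MOD 2]) :
    IsIdeal (rankIdeal n q) := by
  obtain ⟨α, hα⟩ := exists_rank hq hp
  exact ⟨⟨α, hα.le⟩, fun x hx a =>
    ⟨(rank_mul_le_right a x).trans hx, (rank_mul_le_left x a).trans hx⟩⟩

theorem isIdeal_iff (I : Set (Brauer n)) :
    IsIdeal I ↔ ∃ q : ℕ, q ≤ n ∧ q ≡ n [MOD 2] ∧ I = rankIdeal n q := by
  constructor
  · rintro ⟨⟨x, hx⟩, h⟩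
    have hex : ∃ q, ∃ α ∈ I, α.1.rank = q := ⟨_, x, hx, rfl⟩
    classical
    obtain ⟨α, hα, hq⟩ := Nat.findGreatest_spec (P := fun q => ∃ α ∈ I, α.1.rank = q)
      (rank_le x) ⟨x, hx, rfl⟩
    refine ⟨α.1.rank, rank_le α, rank_mod_two α, ?_⟩
    ext β
    constructor
    · intro hβ
      change β.1.rank ≤ α.1.rank
      rw [hq]
      exact Nat.le_findGreatest (rank_le β) ⟨β, hβ, rfl⟩
    · intro hβ
      obtain ⟨s, t, rfl⟩ := mem_principalIdeal_iff.2 hβ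
      exact (h _ (h _ hα s).1 t).2
  · rintro ⟨q, hq, hp, rfl⟩
    exact isIdeal_rankIdeal hq hp

end BrauerGreen

/-! ### The minimal ideal -/

section Minimal

variable {n : ℕ}

theorem rank_eq_of_le_one {α β : Brauer n} (hα : α.1.rank ≤ 1) (hβ : β.1.rank ≤ 1) :
    α.1.rank = β.1.rank := by
  have h1 := rank_mod_two α
  have h2 := rank_mod_two β
  omega

theorem mul_rank_le_one_left {α : Brauer n} (hα : α.1.rank ≤ 1) (β : Brauer n) :
    (α * β).1.rank ≤ 1 := (rank_mul_le_left α β).trans hα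

theorem mul_rank_le_one_right {β : Brauer n} (α : Brauer n) (hβ : β.1.rank ≤ 1) :
    (α * β).1.rank ≤ 1 := (rank_mul_le_right α β).trans hβ

/-- In the minimal ideal the upper row of a product is that of the left factor. -/
theorem greenR_mul {α : Brauer n} (hα : α.1.rank ≤ 1) (β : Brauer n) : GreenR α (α * β) :=
  greenR_mul_of_rank (rank_eq_of_le_one hα (mul_rank_le_one_left hα β)).le

theorem greenL_mul {β : Brauer n} (hβ : β.1.rank ≤ 1) (α : Brauer n) : GreenL β (α * β) :=
  greenL_mul_of_rank (rank_eq_of_le_one hβ (mul_rank_le_one_right α hβ)).le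

theorem dom_unique {α : Brauer n} (hα : α.1.rank ≤ 1) {i j : Fin n} (hi : i ∈ dom α)
    (hj : j ∈ dom α) : i = j := by
  rw [← card_dom, Finset.card_le_one] at hα
  exact hα i hi j hj

theorem cod_unique {α : Brauer n} (hα : α.1.rank ≤ 1) {i j k l : Fin n}
    (hi : mate α (Sum.inr i) = Sum.inl k) (hj : mate α (Sum.inr j) = Sum.inl l) : i = j := by
  have := dom_unique hα (mem_dom.2 ⟨_, mate_comm hi⟩) (mem_dom.2 ⟨_, mate_comm hj⟩)
  rw [this, ← hj] at hi
  exact Sum.inr_injective (mate_injective α hi)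

/-- An element of the minimal ideal is determined by its blocks inside the rows. -/
theorem eq_of_greenH {α β : Brauer n} (hα : α.1.rank ≤ 1) (h : GreenH α β) : α = β := by
  have hR := greenR_iff.1 h.1
  have hL := greenL_iff.1 h.2
  have hβ : β.1.rank ≤ 1 := by rwa [← rank_eq_of_greenR h.1]
  have key : ∀ i j, mate α (Sum.inl i) = Sum.inr j → mate β (Sum.inl i) = Sum.inr j := by
    intro i j hij
    have hi : i ∈ dom β := by
      rw [← dom_eq_of_greenR h.1]
      exact mem_dom.2 ⟨j, hij⟩
    obtain ⟨k, hk⟩ := mem_dom.1 hi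
    rcases hj : mate β (Sum.inr j) with l | l
    · rw [hk, cod_unique hβ (mate_comm hk) hj]
    · have := mate_comm hij
      rw [(hL j l).2 hj] at this
      cases this
  refine ext_mate fun x => ?_
  rcases x with i | i
  · rcases hi : mate α (Sum.inl i) with j | j
    · exact ((hR i j).1 hi).symm
    · exact (key i j hi).symm
  · rcases hi : mate α (Sum.inr i) with j | j
    · exact (mate_comm (key j i (mate_comm hi))).symm
    · exact ((hL i j).1 hi).symm

theorem exists_rank_le_one (n : ℕ) : ∃ α : Brauer n, α.1.rank ≤ 1 := by
  obtain ⟨α, hα⟩ := exists_rank (n := n) (q := n % 2) (Nat.mod_le _ _) (Nat.mod_mod _ _)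
  exact ⟨α, by omega⟩

/-- The minimal ideal is a rectangular band. -/
theorem mul_mul_eq_self {α : Brauer n} (hα : α.1.rank ≤ 1) (β : Brauer n) : α * β * α = α := by
  symm
  refine eq_of_greenH hα ⟨?_, greenL_mul hα _⟩
  rw [mul_assoc]
  exact greenR_mul hα _

/-- For `i ≠ j` there is an element of the minimal ideal with the lower block `{i', j'}`. -/
theorem exists_lower {i j : Fin n} (hij : i ≠ j) :
    ∃ m : Brauer n, m.1.rank ≤ 1 ∧ mate m (Sum.inr i) = Sum.inr j := by
  obtain ⟨m, hm⟩ := exists_rank_le_one n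
  refine ⟨m * hook i j, mul_rank_le_one_left hm _, ?_⟩
  rw [mul_hook]
  exact mate_switch_left m (fun h => hij (Sum.inr_injective h))

theorem mem_rankIdeal {q : ℕ} {α : Brauer n} : α ∈ rankIdeal n q ↔ α.1.rank ≤ q := Iff.rfl

theorem isMinimalIdeal_iff (M : Set (Brauer n)) : IsMinimalIdeal M ↔ M = rankIdeal n 1 := by
  have h0 : rankIdeal n 1 = rankIdeal n (n % 2) := by
    ext α
    have := rank_mod_two α
    rw [mem_rankIdeal, mem_rankIdeal]
    omega
  have h1 : IsIdeal (rankIdeal n 1) := by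
    rw [h0]
    exact isIdeal_rankIdeal (Nat.mod_le _ _) (Nat.mod_mod _ _)
  have h2 : ∀ I : Set (Brauer n), IsIdeal I → rankIdeal n 1 ⊆ I := by
    intro I hI
    obtain ⟨q, hq, hp, rfl⟩ := (isIdeal_iff I).1 hI
    intro α hα
    have h3 := rank_mod_two α
    have h4 : q % 2 = n % 2 := hp
    rw [mem_rankIdeal] at hα ⊢
    omega
  constructor
  · intro h
    exact Set.Subset.antisymm (h.2 h1 (h2 M h.1)) (h2 M h.1)
  · rintro rfl
    exact ⟨h1, fun I hI _ => h2 I hI⟩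

end Minimal

/-! ### Congruences and the minimal ideal -/

section MinimalCollapse

variable {n : ℕ}

/-- The image of a congruence under the involution. -/
def starCon (c : Con (Brauer n)) : Con (Brauer n) where
  r α β := c (brauerStar α) (brauerStar β)
  iseqv := ⟨fun _ => c.refl _, fun h => c.symm h, fun h h' => c.trans h h'⟩
  mul' {a b x y} h h' := by
    simp only [star_mul]
    exact c.mul h' h

theorem starCon_iff {c : Con (Brauer n)} {α β : Brauer n} :
    starCon c α β ↔ c (brauerStar α) (brauerStar β) := Iff.rfl

/-- `c` identifies any two elements of the minimal ideal with the same upper row. -/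
def LowFull (c : Con (Brauer n)) : Prop :=
  ∀ f g : Brauer n, f.1.rank ≤ 1 → GreenR f g → c f g

/-- `c` identifies any two elements of the minimal ideal with the same lower row. -/
def UpFull (c : Con (Brauer n)) : Prop :=
  ∀ f g : Brauer n, f.1.rank ≤ 1 → GreenL f g → c f g

/-- `c` collapses the minimal ideal to a point. -/
def Full (c : Con (Brauer n)) : Prop :=
  ∀ f g : Brauer n, f.1.rank ≤ 1 → g.1.rank ≤ 1 → c f g

theorem lowFull_starCon {c : Con (Brauer n)} : LowFull (starCon c) ↔ UpFull c := by
  constructor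
  · intro h f g hf hfg
    have := h (brauerStar f) (brauerStar g) (by rwa [rank_star]) (greenR_star.2 hfg)
    simpa [starCon_iff] using this
  · intro h f g hf hfg
    exact h _ _ (by rwa [rank_star]) (greenL_star.2 hfg)

theorem full_iff {c : Con (Brauer n)} : Full c ↔ LowFull c ∧ UpFull c := by
  constructor
  · intro h
    exact ⟨fun f g hf hfg => h f g hf (rank_eq_of_greenR hfg ▸ hf),
      fun f g hf hfg => h f g hf (rank_eq_of_greenL hfg ▸ hf)⟩
  · rintro ⟨h1, h2⟩ f g hf hg
    exact c.trans (h1 f (f * g) hf (greenR_mul hf g))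
      (c.symm (h2 g (f * g) hg (greenL_mul hg f)))

theorem unitOf_mul_unitOf (π ρ : Equiv.Perm (Fin n)) :
    unitOf π * unitOf ρ = unitOf (ρ * π) := by
  refine ext_mate fun x => ?_
  rcases x with i | i
  · rw [mate_unitOf_inl]
    exact mate_mul_cross (mate_unitOf_inl π i) (mate_unitOf_inl ρ (π i))
  · have h1 := mate_unitOf_inl (ρ * π) ((ρ * π)⁻¹ i)
    have h2 := mate_mul_cross (mate_unitOf_inl π ((ρ * π)⁻¹ i)) (mate_unitOf_inl ρ _)
    rw [← Equiv.Perm.mul_apply] at h2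
    have h3 : (ρ * π) ((ρ * π)⁻¹ i) = i := (Equiv.Perm.eq_inv_iff_eq).1 rfl
    rw [h3] at h1 h2
    rw [mate_comm h1, mate_comm h2]

@[simp] theorem unitOf_one : unitOf (1 : Equiv.Perm (Fin n)) = 1 :=
  ext_mate fun x => by rcases x with i | i <;> simp [unitOf, mate_one]

theorem mate_mul_unitOf {α : Brauer n} {i j : Fin n} (π : Equiv.Perm (Fin n))
    (h : mate α (Sum.inr i) = Sum.inr j) :
    mate (α * unitOf π) (Sum.inr (π i)) = Sum.inr (π j) :=
  mate_mul_lower_cross h (mate_unitOf_inl π i) (mate_unitOf_inl π j)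

theorem mate_mul_unitOf_inl {α : Brauer n} {i j : Fin n} (π : Equiv.Perm (Fin n))
    (h : mate α (Sum.inr i) = Sum.inl j) :
    mate (α * unitOf π) (Sum.inr (π i)) = Sum.inl j :=
  mate_comm (mate_mul_cross (mate_comm h) (mate_unitOf_inl π i))

/-- Hooking `a'` to `b'` has the same effect as exchanging `b'` with the partner of `a'`. -/
theorem mul_hook_eq_mul_unitOf {α : Brauer n} {a x : Fin n} (b : Fin n)
    (h : mate α (Sum.inr a) = Sum.inr x) :
    α * hook a b = α * unitOf (Equiv.swap b x) := by
  rw [mul_hook, switch, h, mul_unitOf]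
  congr 1
  ext z
  rcases z with z | z
  · simp [Equiv.swap_apply_def]
  · simp only [Equiv.swap_apply_def, Equiv.sumCongr_apply, Sum.map_inr, Sum.inr.injEq]
    split_ifs <;> rfl

theorem mul_unitOf_swap_eq {α : Brauer n} {x x' y y' : Fin n}
    (hx : mate α (Sum.inr x) = Sum.inr x') (hy : mate α (Sum.inr y) = Sum.inr y') :
    α * unitOf (Equiv.swap x y) = α * unitOf (Equiv.swap x' y') := by
  rw [Equiv.swap_comm x y, ← mul_hook_eq_mul_unitOf y (mate_comm hx),
    ← mul_hook_eq_mul_unitOf x' hy, mul_hook, mul_hook, switch_comm]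

/-- Any two lower vertices on lower blocks are exchanged by a symmetry of the lower row, which
fixes all other blocks. -/
theorem exists_lower_symmetry {α : Brauer n} {x x' y y' : Fin n}
    (hx : mate α (Sum.inr x) = Sum.inr x') (hy : mate α (Sum.inr y) = Sum.inr y') :
    ∃ ρ : Equiv.Perm (Fin n), α * unitOf ρ = α ∧ ρ x = y ∧
      ∀ z, z ≠ x → z ≠ y → z ≠ x' → z ≠ y' → ρ z = z := by
  by_cases hxy : y = x'
  · refine ⟨Equiv.swap x y, ?_, Equiv.swap_apply_left _ _,
      fun z h1 h2 _ _ => Equiv.swap_apply_of_ne_of_ne h1 h2⟩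
    rw [Equiv.swap_comm, ← mul_hook_eq_mul_unitOf y (hxy ▸ mate_comm hx), mul_hook, hxy,
      switch_self]
  · have hyx : x ≠ y' := by
      rintro rfl
      rw [mate_comm hy] at hx
      exact hxy (Sum.inr_injective hx)
    have hx' : x ≠ x' := by
      rintro rfl
      exact mate_ne _ _ hx
    have hy' : y ≠ y' := by
      rintro rfl
      exact mate_ne _ _ hy
    refine ⟨Equiv.swap x y * Equiv.swap x' y', ?_, ?_, ?_⟩
    · rw [← unitOf_mul_unitOf, ← mul_assoc, ← mul_unitOf_swap_eq hx hy, mul_assoc,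
        unitOf_mul_unitOf, Equiv.swap_mul_self, unitOf_one, mul_one]
    · rw [Equiv.Perm.mul_apply, Equiv.swap_apply_of_ne_of_ne hx' hyx, Equiv.swap_apply_left]
    · intro z h1 h2 h3 h4
      rw [Equiv.Perm.mul_apply, Equiv.swap_apply_of_ne_of_ne h3 h4,
        Equiv.swap_apply_of_ne_of_ne h1 h2]

/-- `c` identifies `α` with the element obtained by exchanging the lower vertices `p` and `q`. -/
def Exchanges (c : Con (Brauer n)) (α : Brauer n) (p q : Fin n) : Prop :=
  c α (α * unitOf (Equiv.swap p q))

theorem Exchanges.refl (c : Con (Brauer n)) (α : Brauer n) (p : Fin n) : Exchanges c α p p := by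
  rw [Exchanges, Equiv.swap_self, ← Equiv.Perm.one_def, unitOf_one, mul_one]
  exact c.refl α

theorem Exchanges.mul_unitOf {c : Con (Brauer n)} {α : Brauer n} {p q : Fin n}
    (h : Exchanges c α p q) (π : Equiv.Perm (Fin n)) :
    Exchanges c (α * unitOf π) (π p) (π q) := by
  have h1 := c.mul h (c.refl (unitOf π))
  have h2 : Equiv.swap (π p) (π q) * π = π * Equiv.swap p q := by
    rw [Equiv.mul_swap_eq_swap_mul]
  rw [Exchanges, mul_assoc, unitOf_mul_unitOf, h2, ← unitOf_mul_unitOf, ← mul_assoc]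
  exact h1

theorem Exchanges.of_greenL {c : Con (Brauer n)} {α β : Brauer n} {p q : Fin n}
    (h : Exchanges c α p q) (hL : GreenL α β) : Exchanges c β p q := by
  obtain ⟨⟨s, rfl⟩, -⟩ := greenL_iff_exists.1 hL
  rw [Exchanges, mul_assoc]
  exact c.mul (c.refl s) h

theorem exists_greenL_mul_unitOf {α β : Brauer n} (h : α.1.rank = β.1.rank) :
    ∃ π, GreenL (α * unitOf π) β := by
  obtain ⟨π, hπ⟩ := exists_unitOf_mul_greenR (α := brauerStar α) (β := brauerStar β)
    (by rwa [rank_star, rank_star])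
  refine ⟨π⁻¹, ?_⟩
  rw [← greenR_star, star_mul, star_unitOf, inv_inv]
  exact hπ

/-- If all exchanges of lower vertices are identified with the identity on the minimal ideal, then
only the upper row matters modulo `c`. -/
theorem lowFull_of_exchanges {c : Con (Brauer n)}
    (h : ∀ α : Brauer n, α.1.rank ≤ 1 → ∀ p q, Exchanges c α p q) : LowFull c := by
  have key : ∀ π : Equiv.Perm (Fin n), ∀ α : Brauer n, α.1.rank ≤ 1 → c α (α * unitOf π) := by
    intro π
    induction π using Equiv.Perm.swap_induction_on' with
    | one =>
      intro α _
      rw [unitOf_one, mul_one]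
      exact c.refl α
    | mul_swap f x y _ ih =>
      intro α hα
      rw [← unitOf_mul_unitOf, ← mul_assoc]
      exact c.trans (h α hα x y) (ih _ (mul_rank_le_one_left hα _))
  intro f g hf hfg
  obtain ⟨π, hπ⟩ := exists_greenL_mul_unitOf (rank_eq_of_greenR hfg)
  have : f * unitOf π = g :=
    eq_of_greenH (mul_rank_le_one_left hf _) ⟨(greenR_mul hf _).symm.trans hfg, hπ⟩
  rw [← this]
  exact key π f hf

/-- Transitivity of the symmetry group of a perfect matching on pairs of points from different
edges, and in the odd case on edges when the unmatched point is involved. -/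
theorem exchanges_of_exchanges {c : Con (Brauer n)} {g : Brauer n} (hg : g.1.rank ≤ 1)
    {p p' q : Fin n} (hp : mate g (Sum.inr p) = Sum.inr p') (hpq : p ≠ q) (hpq' : p' ≠ q)
    (hq : (dom g).Nonempty → ∃ k, mate g (Sum.inr q) = Sum.inl k) (h : Exchanges c g p q) :
    LowFull c := by
  apply lowFull_of_exchanges
  have h0 : ∀ α : Brauer n, α.1.rank ≤ 1 → (dom α = ∅ ↔ dom g = ∅) := by
    intro α hα
    rw [← Finset.card_eq_zero, ← Finset.card_eq_zero, card_dom, card_dom,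
      rank_eq_of_le_one hα hg]
  have h1 : ∀ α : Brauer n, α.1.rank ≤ 1 → ∃ p p' q, mate α (Sum.inr p) = Sum.inr p' ∧
      p ≠ q ∧ p' ≠ q ∧ ((dom α).Nonempty → ∃ k, mate α (Sum.inr q) = Sum.inl k) ∧
      Exchanges c α p q := by
    intro α hα
    obtain ⟨π, hπ⟩ := exists_greenL_mul_unitOf (rank_eq_of_le_one hg hα)
    refine ⟨π p, π p', π q, (greenL_iff.1 hπ _ _).1 (mate_mul_unitOf π hp),
      fun h => hpq (π.injective h), fun h => hpq' (π.injective h), ?_,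
      (h.mul_unitOf π).of_greenL hπ⟩
    intro hd
    obtain ⟨k, hk⟩ := hq (Finset.nonempty_iff_ne_empty.2 fun h =>
      Finset.nonempty_iff_ne_empty.1 hd ((h0 α hα).2 h))
    have hk' := mate_mul_unitOf_inl π hk
    rcases hm : mate α (Sum.inr (π q)) with l | l
    · exact ⟨l, rfl⟩
    · rw [← greenL_iff.1 hπ] at hm
      rw [hm] at hk'
      cases hk'
  by_cases hd : dom g = ∅
  · intro α hα P Q
    have hm : ∀ i, ∃ j, mate α (Sum.inr i) = Sum.inr j := by
      intro i
      rcases hi : mate α (Sum.inr i) with j | j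
      · have := mem_dom.2 ⟨i, mate_comm hi⟩
        rw [(h0 α hα).2 hd] at this
        simp at this
      · exact ⟨j, rfl⟩
    obtain ⟨p, p', q, hp, hpq, hpq', -, h⟩ := h1 α hα
    obtain ⟨P', hP⟩ := hm P
    obtain ⟨Q', hQ⟩ := hm Q
    by_cases hQP : Q = P
    · rw [hQP]
      exact .refl c α _
    by_cases hQP' : Q = P'
    · rw [Exchanges, Equiv.swap_comm, ← mul_hook_eq_mul_unitOf Q (hQP' ▸ mate_comm hP), mul_hook,
        hQP', switch_self]
      exact c.refl α
    obtain ⟨ρ, hρ, hρp, -⟩ := exists_lower_symmetry hp hP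
    have h2 := h.mul_unitOf ρ
    have h3 := mate_mul_unitOf ρ hp
    rw [hρ, hρp] at h2 h3
    rw [hP] at h3
    obtain ⟨q', hq'⟩ := hm (ρ q)
    obtain ⟨ρ', hρ', hρq, hfix⟩ := exists_lower_symmetry hq' hQ
    have h4 := h2.mul_unitOf ρ'
    have h5 : P ≠ ρ q := fun h => hpq (ρ.injective (by rw [hρp, h]))
    rw [hρ', hρq, hfix P h5 (Ne.symm hQP)] at h4
    · exact h4
    · rintro rfl
      have := mate_comm hq'
      rw [hP, h3] at this
      exact hpq' (ρ.injective (Sum.inr_injective this))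
    · rintro rfl
      have := mate_comm hQ
      rw [hP] at this
      exact hQP' (Sum.inr_injective this).symm
  · have hne : ∀ α : Brauer n, α.1.rank ≤ 1 → (dom α).Nonempty := fun α hα =>
      Finset.nonempty_iff_ne_empty.2 fun h => hd ((h0 α hα).1 h)
    -- exchanges with the unmatched point
    have h2 : ∀ α : Brauer n, α.1.rank ≤ 1 → ∀ d k P, mate α (Sum.inr d) = Sum.inl k → P ≠ d →
        Exchanges c α P d := by
      intro α hα d k P hdk hPd
      obtain ⟨p, p', q, hp, hpq, hpq', hq, h⟩ := h1 α hα
      obtain ⟨l, hl⟩ := hq (hne α hα)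
      obtain rfl := cod_unique hα hl hdk
      rcases hP : mate α (Sum.inr P) with P' | P'
      · exact absurd (cod_unique hα hP hdk) hPd
      obtain ⟨ρ, hρ, hρp, hfix⟩ := exists_lower_symmetry hp hP
      have h2 := h.mul_unitOf ρ
      rwa [hρ, hρp, hfix q hpq.symm hPd.symm hpq'.symm] at h2
      rintro rfl
      rw [mate_comm hP] at hl
      cases hl
    intro α hα P Q
    obtain ⟨k, hk⟩ := hne α hα
    obtain ⟨d, hd'⟩ := mem_dom.1 hk
    have hdk := mate_comm hd'
    by_cases hPQ : P = Q
    · rw [hPQ]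
      exact .refl c α _
    by_cases hP : P = d
    · rw [hP, Exchanges, Equiv.swap_comm]
      exact h2 α hα d k Q hdk (fun h => hPQ (hP.trans h.symm))
    by_cases hQ : Q = d
    · rw [hQ]
      exact h2 α hα d k P hdk hP
    -- `(P Q)` is the product of the exchanges `(P d)`, `(Q P)`, `(d Q)`, each of which moves the
    -- point that is unmatched at that stage
    have e1 := h2 α hα d k P hdk hP
    have m1 := mate_mul_unitOf_inl (Equiv.swap P d) hdk
    rw [Equiv.swap_apply_right] at m1
    have r1 := mul_rank_le_one_left hα (unitOf (Equiv.swap P d))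
    have e2 := h2 _ r1 P k Q m1 (Ne.symm hPQ)
    have m2 := mate_mul_unitOf_inl (Equiv.swap Q P) m1
    rw [Equiv.swap_apply_right] at m2
    have r2 := mul_rank_le_one_left r1 (unitOf (Equiv.swap Q P))
    have e3 := h2 _ r2 Q k d m2 (Ne.symm hQ)
    have e4 := c.trans e1 (c.trans e2 e3)
    have e5 : Equiv.swap d Q * (Equiv.swap Q P * Equiv.swap P d) = Equiv.swap P Q := by
      rw [Equiv.mul_swap_eq_swap_mul, Equiv.swap_apply_right,
        Equiv.swap_apply_of_ne_of_ne (Ne.symm hQ) (Ne.symm hP), ← mul_assoc,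
        Equiv.swap_comm d Q, Equiv.swap_mul_self, one_mul, Equiv.swap_comm]
    rw [mul_assoc, mul_assoc, unitOf_mul_unitOf, unitOf_mul_unitOf, mul_assoc, e5] at e4
    exact e4

/-- A congruence that identifies two elements of the minimal ideal with different lower rows
identifies all elements with the same upper row. -/
theorem lowFull_of_not_greenL {c : Con (Brauer n)} {f g : Brauer n} (hf : f.1.rank ≤ 1)
    (hg : g.1.rank ≤ 1) (h : c f g) (hL : ¬ GreenL f g) : LowFull c := by
  have key : ∀ {f g : Brauer n}, g.1.rank ≤ 1 → c f g → ∀ {a b x : Fin n},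
      mate f (Sum.inr a) = Sum.inr b → mate g (Sum.inr a) = Sum.inr x → x ≠ b →
      ((dom g).Nonempty → ∃ k, mate g (Sum.inr b) = Sum.inl k) → LowFull c := by
    intro f g hg h a b x hfa hga hxb hd
    have h1 : f * hook a b = f := by rw [mul_hook, switch_of_mate f hfa]
    have h2 := c.mul h (c.refl (hook a b))
    rw [h1, mul_hook_eq_mul_unitOf b hga, Equiv.swap_comm] at h2
    refine exchanges_of_exchanges hg (mate_comm hga) hxb ?_ hd (c.trans (c.symm h) h2)
    rintro rfl
    exact mate_ne _ _ hfa
  have h1 : ∃ a b, mate f (Sum.inr a) = Sum.inr b ∧ mate g (Sum.inr a) ≠ Sum.inr b := by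
    by_contra! h'
    apply hL
    rw [← greenR_star]
    apply greenR_of_upper
    · intro i j hij
      have h2 : mate f (Sum.inr i) = Sum.inr j := by
        rw [mate_star] at hij
        exact Sum.swap_leftInverse.injective hij
      simp [mate_star, h' i j h2]
    · rw [rank_star, rank_star]
      exact (rank_eq_of_le_one hf hg).le
  obtain ⟨a, b, hfa, hga⟩ := h1
  rcases (dom g).eq_empty_or_nonempty with hd | ⟨k, hk⟩
  · rcases hx : mate g (Sum.inr a) with x | x
    · have := mem_dom.2 ⟨a, mate_comm hx⟩
      rw [hd] at this
      simp at this
    · refine key hg h hfa hx ?_ ?_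
      · rintro rfl
        exact hga hx
      · rw [hd]
        simp
  · obtain ⟨d, hd⟩ := mem_dom.1 hk
    have hd' := mate_comm hd
    rcases he : mate f (Sum.inr d) with l | e
    · -- the unmatched points agree: hook the unmatched point to `a'` in order to separate them
      rcases hx : mate g (Sum.inr a) with x | x
      · rw [cod_unique hg hx hd'] at hfa
        rw [he] at hfa
        cases hfa
      · have had : (Sum.inr a : Vertex n) ≠ Sum.inr d := by
          intro h'
          rw [h', he] at hfa
          cases hfa
        have hxb : x ≠ b := by
          rintro rfl
          exact hga hx
        have f1 : mate (f * hook a d) (Sum.inr b) = Sum.inl l := by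
          rw [mul_hook]
          have := mate_switch_mate f had (by
            rw [hfa]; intro h'; have := mate_comm hfa; rw [h', he] at this; cases this)
          rwa [hfa, he] at this
        have g1 : mate (g * hook a d) (Sum.inr x) = Sum.inl k := by
          rw [mul_hook]
          have := mate_switch_mate g had (by
            rw [hx]; intro h'; have := mate_comm hx; rw [h', hd'] at this; cases this)
          rwa [hx, hd'] at this
        have rf := mul_rank_le_one_left hf (hook a d)
        have rg := mul_rank_le_one_left hg (hook a d)
        have h2 := c.mul h (c.refl (hook a d))
        rcases hy : mate (f * hook a d) (Sum.inr x) with y | y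
        · exact absurd (cod_unique rf hy f1) hxb
        rcases hz : mate (g * hook a d) (Sum.inr y) with z | z
        · have := cod_unique rg hz g1
          rw [this] at hy
          exact absurd hy (mate_ne _ _)
        refine key rg h2 (mate_comm hy) hz ?_ fun _ => ⟨k, g1⟩
        rintro rfl
        rw [mate_comm hz] at g1
        cases g1
    · rcases hz : mate g (Sum.inr e) with z | z
      · have := cod_unique hg hz hd'
        rw [this] at he
        exact absurd he (mate_ne _ _)
      refine key hg h (mate_comm he) hz ?_ fun _ => ⟨k, hd'⟩
      rintro rfl
      rw [mate_comm hz] at hd'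
      cases hd'

theorem upFull_of_not_greenR {c : Con (Brauer n)} {f g : Brauer n} (hf : f.1.rank ≤ 1)
    (hg : g.1.rank ≤ 1) (h : c f g) (hR : ¬ GreenR f g) : UpFull c := by
  rw [← lowFull_starCon]
  refine lowFull_of_not_greenL (f := brauerStar f) (g := brauerStar g) (by rwa [rank_star])
    (by rwa [rank_star]) ?_ (by rwa [greenL_star])
  rw [starCon_iff, star_star, star_star]
  exact h

end MinimalCollapse

/-! ### Congruences and elements of larger rank -/

section Rank

variable {n : ℕ}

theorem exists_upper {i j : Fin n} (hij : i ≠ j) :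
    ∃ m : Brauer n, m.1.rank ≤ 1 ∧ mate m (Sum.inl i) = Sum.inl j := by
  obtain ⟨m, hm, h⟩ := exists_lower hij
  exact ⟨brauerStar m, by rwa [rank_star], by simp [mate_star, h]⟩

theorem exists_block_of_not_greenR {f g : Brauer n} (h : ¬ GreenR f g)
    (hr : f.1.rank ≤ g.1.rank) :
    ∃ a b, mate f (Sum.inl a) = Sum.inl b ∧ mate g (Sum.inl a) ≠ Sum.inl b := by
  by_contra! h'
  exact h (greenR_of_upper h' hr)

/-- Related elements of the same rank that are not `R`-related can be separated by their ranks. -/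
theorem exists_drop_of_not_greenR {c : Con (Brauer n)} {f g : Brauer n} (h : c f g)
    (hr : g.1.rank = f.1.rank) (h2 : 2 ≤ f.1.rank) (hR : ¬ GreenR f g) :
    ∃ f' g', c f' g' ∧ f'.1.rank = f.1.rank ∧ g'.1.rank < f.1.rank := by
  have key : ∀ {f g : Brauer n}, c f g → g.1.rank = f.1.rank → 2 ≤ f.1.rank → dom f ≠ dom g →
      ∃ f' g', c f' g' ∧ f'.1.rank = f.1.rank ∧ g'.1.rank < f.1.rank := by
    intro f g h hr h2 hd
    obtain ⟨x, hx, hx'⟩ : ∃ x ∈ dom g, x ∉ dom f := by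
      by_contra! h'
      exact hd (Finset.eq_of_subset_of_card_le h' (by rw [card_dom, card_dom, hr])).symm
    obtain ⟨y, hy, hyx⟩ := Finset.exists_mem_ne (s := dom g) (by rw [card_dom]; omega) x
    refine ⟨hook x y * f, hook x y * g, c.mul (c.refl _) h, ?_, ?_⟩
    · rw [hook_mul, rank_switch_of_not_both fun h => hx' h.1]
    · have := rank_switch_of_mem hyx.symm hx hy
      rw [hook_mul]
      omega
  by_cases hd : dom f = dom g
  · obtain ⟨a, b, hfa, hga⟩ := exists_block_of_not_greenR hR hr.ge
    obtain ⟨u, hu⟩ : (dom f).Nonempty := by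
      rw [← Finset.card_pos, card_dom]
      omega
    have hag : a ∉ dom g := hd ▸ notMem_dom.2 ⟨b, hfa⟩
    obtain ⟨c', hga'⟩ := notMem_dom.1 hag
    have hf1 : (hook u a * f).1.rank = f.1.rank := by
      rw [hook_mul, rank_switch_of_not_both fun h => notMem_dom.2 ⟨b, hfa⟩ h.2]
    have hg1 : (hook u a * g).1.rank = g.1.rank := by
      rw [hook_mul, rank_switch_of_not_both fun h => hag h.2]
    rw [← hf1]
    refine key (c.mul (c.refl (hook u a)) h) (by rw [hf1, hg1, hr]) (by rw [hf1]; exact h2) ?_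
    rw [hook_mul, hook_mul, dom_switch_of_mem_of_mate hu hfa,
      dom_switch_of_mem_of_mate (hd ▸ hu) hga']
    intro h'
    have hb : b ∈ insert c' ((dom g).erase u) := h' ▸ Finset.mem_insert_self _ _
    rcases Finset.mem_insert.1 hb with rfl | hb
    · exact hga hga'
    · have := Finset.mem_of_mem_erase hb
      rw [← hd] at this
      exact notMem_dom.2 ⟨a, mate_comm hfa⟩ this
  · exact key h hr h2 hd

theorem exists_drop {c : Con (Brauer n)} {f g : Brauer n} (h : c f g)
    (hr : g.1.rank ≤ f.1.rank) (h2 : 2 ≤ f.1.rank) (hH : ¬ GreenH f g) :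
    ∃ f' g', c f' g' ∧ f'.1.rank = f.1.rank ∧ g'.1.rank < f.1.rank := by
  rcases hr.lt_or_eq with hr | hr
  · exact ⟨f, g, h, rfl, hr⟩
  by_cases hR : GreenR f g
  · have hL : ¬ GreenR (brauerStar f) (brauerStar g) := by
      rw [greenR_star]
      exact fun hL => hH ⟨hR, hL⟩
    obtain ⟨f', g', h', hf', hg'⟩ := exists_drop_of_not_greenR (c := starCon c)
      (f := brauerStar f) (g := brauerStar g) (by simpa [starCon_iff] using h)
      (by rwa [rank_star, rank_star]) (by rwa [rank_star]) hL
    rw [rank_star] at hf' hg'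
    exact ⟨_, _, h', by rwa [rank_star], by rwa [rank_star]⟩
  · exact exists_drop_of_not_greenR h hr h2 hR

/-- A pair with ranks `≥ 3` and smaller forces a collapse of the minimal ideal: multiplied by
elements of the minimal ideal, the larger element gives several upper rows. -/
theorem upFull_of_rank_lt {c : Con (Brauer n)} {f g : Brauer n} (h : c f g)
    (hr : g.1.rank < f.1.rank) (h3 : 3 ≤ f.1.rank) : UpFull c := by
  obtain ⟨a, ha, ha'⟩ : ∃ a ∈ dom f, a ∉ dom g := by
    by_contra! h'
    have := Finset.card_le_card h'
    rw [card_dom, card_dom] at this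
    omega
  obtain ⟨b, hb⟩ := notMem_dom.1 ha'
  obtain ⟨y, hy⟩ : (((dom f).erase a).erase b).Nonempty := by
    rw [← Finset.card_pos]
    have h1 := Finset.card_erase_add_one ha
    have h2 := Finset.pred_card_le_card_erase (s := (dom f).erase a) (a := b)
    rw [card_dom] at h1
    omega
  simp only [Finset.mem_erase] at hy
  obtain ⟨hyb, hya, hy⟩ := hy
  obtain ⟨a', hfa⟩ := mem_dom.1 ha
  obtain ⟨y', hfy⟩ := mem_dom.1 hy
  have hay' : a' ≠ y' := by
    rintro rfl
    rw [← hfa] at hfy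
    exact hya (Sum.inl_injective (mate_injective f hfy))
  obtain ⟨m, hm, hm'⟩ := exists_upper hay'
  refine upFull_of_not_greenR (mul_rank_le_one_right f hm) (mul_rank_le_one_right g hm)
    (c.mul h (c.refl m)) fun hR => ?_
  have h1 := (greenR_iff.1 hR _ _).1 (mate_mul_upper_cross hm' hfa hfy)
  rw [mate_mul_upper m hb] at h1
  exact hyb (Sum.inl_injective h1).symm

theorem full_of_rank_lt {c : Con (Brauer n)} {f g : Brauer n} (h : c f g)
    (hr : g.1.rank < f.1.rank) (h3 : 3 ≤ f.1.rank) : Full c := by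
  refine full_iff.2 ⟨?_, upFull_of_rank_lt h hr h3⟩
  have := upFull_of_rank_lt (c := starCon c) (f := brauerStar f) (g := brauerStar g)
    (by simpa [starCon_iff] using h) (by rwa [rank_star, rank_star]) (by rwa [rank_star])
  intro f g hf hfg
  simpa [starCon_iff] using this (brauerStar f) (brauerStar g) (by rwa [rank_star])
    (greenL_star.2 hfg)

theorem full_of_not_greenH {c : Con (Brauer n)} {f g : Brauer n} (h : c f g)
    (hr : g.1.rank ≤ f.1.rank) (h3 : 3 ≤ f.1.rank) (hH : ¬ GreenH f g) : Full c := by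
  obtain ⟨f', g', h', hf', hg'⟩ := exists_drop h hr (by omega) hH
  exact full_of_rank_lt h' (by omega) (by omega)

theorem exists_rank_le_of_rank_eq {c : Con (Brauer n)} {f g f' : Brauer n} (h : c f g)
    (hf' : f'.1.rank = f.1.rank) :
    ∃ g', c f' g' ∧ g'.1.rank ≤ g.1.rank := by
  obtain ⟨s, t, rfl⟩ := mem_principalIdeal_iff.2 hf'.le
  exact ⟨s * g * t, c.mul (c.mul (c.refl s) h) (c.refl t), rank_mul_mul_le s g t⟩

/-- Once the minimal ideal is collapsed, every pair that is not `H`-related generates a Rees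
congruence. -/
theorem rees_of_full {c : Con (Brauer n)} (hc : Full c) {f g : Brauer n} (h : c f g)
    (hr : g.1.rank ≤ f.1.rank) (h2 : 2 ≤ f.1.rank) (hH : ¬ GreenH f g) :
    ∀ x y : Brauer n, x.1.rank ≤ f.1.rank → y.1.rank ≤ f.1.rank → c x y := by
  obtain ⟨q, hq⟩ : ∃ q, f.1.rank = q := ⟨_, rfl⟩
  induction q using Nat.strong_induction_on generalizing f g with
  | _ q ih =>
    obtain ⟨f, g, h, hf, hg⟩ := exists_drop h hr h2 hH
    rw [← hf] at hq h2 hg ⊢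
    clear hf hH hr
    have hpf := rank_mod_two f
    -- everything below rank `q` is identified
    have hlow : ∀ x y : Brauer n, x.1.rank + 2 ≤ q → y.1.rank + 2 ≤ q → c x y := by
      by_cases h4 : 4 ≤ q
      · obtain ⟨a, ha, ha'⟩ : ∃ a ∈ dom f, a ∉ dom g := by
          by_contra! h'
          have := Finset.card_le_card h'
          rw [card_dom, card_dom] at this
          omega
        obtain ⟨b, hb⟩ := notMem_dom.1 ha'
        obtain ⟨y, hy⟩ : (((dom f).erase a).erase b).Nonempty := by
          rw [← Finset.card_pos]
          have h1 := Finset.card_erase_add_one ha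
          have h2 := Finset.pred_card_le_card_erase (s := (dom f).erase a) (a := b)
          rw [card_dom] at h1
          omega
        simp only [Finset.mem_erase] at hy
        obtain ⟨hyb, hya, hy⟩ := hy
        obtain ⟨a', hfa⟩ := mem_dom.1 ha
        obtain ⟨y', hfy⟩ := mem_dom.1 hy
        have hay' : (Sum.inr a' : Vertex n) ≠ Sum.inr y' := by
          intro h'
          rw [← hfa, ← hfy] at h'
          exact hya (Sum.inl_injective (mate_injective f h')).symm
        have hrank : (f * hook a' y').1.rank + 2 = f.1.rank := by
          rw [mul_hook, ← rank_star, star_switch, ← rank_star f]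
          exact rank_switch_of_mem (fun h => hay' (by rw [h]))
            (mem_dom.2 ⟨a, by simp [mate_star, mate_comm hfa]⟩)
            (mem_dom.2 ⟨y, by simp [mate_star, mate_comm hfy]⟩)
        have hg' := rank_mul_le_left g (hook a' y')
        have hpg := rank_mod_two g
        have hay : mate (f * hook a' y') (Sum.inl a) = Sum.inl y := by
          have := mate_switch_mate f hay' (by
            rw [mate_comm hfa]
            simp)
          rw [mate_comm hfa, mate_comm hfy] at this
          rwa [mul_hook]
        intro x z hx hz
        refine ih (q - 2) (by omega) (c.mul h (c.refl (hook a' y'))) (by omega) (by omega) ?_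
          (by omega) x z (by omega) (by omega)
        intro hH
        have h1 := (greenR_iff.1 hH.1 _ _).1 hay
        rw [mate_mul_upper _ hb] at h1
        exact hyb (Sum.inl_injective h1).symm
      · intro x y hx hy
        exact hc x y (by omega) (by omega)
    have hsmall : ∀ x : Brauer n, x.1.rank ≤ f.1.rank → ∃ y : Brauer n, c x y ∧ y.1.rank + 2 ≤ q := by
      intro x hx
      have hpx := rank_mod_two x
      have hpg := rank_mod_two g
      rcases hx.lt_or_eq with hx | hx
      · exact ⟨x, c.refl x, by omega⟩
      · obtain ⟨y, hy, hy'⟩ := exists_rank_le_of_rank_eq h hx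
        exact ⟨y, hy, by omega⟩
    intro x y hx hy
    obtain ⟨x', hx, hx'⟩ := hsmall x hx
    obtain ⟨y', hy, hy'⟩ := hsmall y hy
    exact c.trans hx (c.trans (hlow x' y' hx' hy') (c.symm hy))

theorem exists_mate_ne_of_greenH {f g : Brauer n} (hH : GreenH f g) (hne : f ≠ g) :
    ∃ x y y', y ≠ y' ∧ mate f (Sum.inl x) = Sum.inr y ∧ mate g (Sum.inl x) = Sum.inr y' := by
  have hd := dom_eq_of_greenR hH.1
  by_contra! h
  apply hne
  have key : ∀ x, mate f (Sum.inl x) = mate g (Sum.inl x) := by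
    intro x
    rcases hx : mate f (Sum.inl x) with y | y
    · rw [(greenR_iff.1 hH.1 _ _).1 hx]
    · obtain ⟨y', hy'⟩ := mem_dom.1 (hd ▸ mem_dom.2 ⟨y, hx⟩)
      by_cases hyy : y = y'
      · rw [hy', hyy]
      · exact absurd hy' (h x y y' hyy hx)
  refine ext_mate fun x => ?_
  rcases x with x | x
  · exact key x
  · rcases hx : mate f (Sum.inr x) with y | y
    · rw [mate_comm ((key y).symm.trans (mate_comm hx))]
    · rw [(greenL_iff.1 hH.2 _ _).1 hx]

/-- Different `H`-related elements of rank at least `3` yield, after hooking two transversals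
together, elements with different lower rows. -/
theorem exists_hook_not_greenL {f g : Brauer n} (hH : GreenH f g) (hne : f ≠ g)
    (h3 : 3 ≤ f.1.rank) :
    ∃ x y, (hook x y * f).1.rank + 2 = f.1.rank ∧ (hook x y * g).1.rank + 2 = f.1.rank ∧
      ¬ GreenL (hook x y * f) (hook x y * g) := by
  have hd := dom_eq_of_greenR hH.1
  obtain ⟨x, y, y', hyy, hfx, hgx⟩ := exists_mate_ne_of_greenH hH hne
  have hx : x ∈ dom f := mem_dom.2 ⟨y, hfx⟩
  -- the upper end `w` of the transversal of `g` that ends at `y`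
  obtain ⟨w, hgw⟩ : ∃ w, mate g (Sum.inr y) = Sum.inl w := by
    rcases hw : mate g (Sum.inr y) with w | w
    · exact ⟨w, rfl⟩
    · rw [← greenL_iff.1 hH.2] at hw
      rw [mate_comm hfx] at hw
      cases hw
  obtain ⟨v, hv⟩ : (((dom f).erase x).erase w).Nonempty := by
    rw [← Finset.card_pos]
    have h1 := Finset.card_erase_add_one hx
    have h2 := Finset.pred_card_le_card_erase (s := (dom f).erase x) (a := w)
    rw [card_dom] at h1
    omega
  simp only [Finset.mem_erase] at hv
  obtain ⟨hvw, hvx, hv⟩ := hv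
  obtain ⟨v', hfv⟩ := mem_dom.1 hv
  obtain ⟨v'', hgv⟩ := mem_dom.1 (hd ▸ hv)
  have hxv : (Sum.inl x : Vertex n) ≠ Sum.inl v := fun h => hvx (Sum.inl_injective h).symm
  refine ⟨x, v, ?_, ?_, fun hL => ?_⟩
  · rw [hook_mul, rank_switch_of_mem hvx.symm hx hv]
  · rw [hook_mul, rank_switch_of_mem hvx.symm (hd ▸ hx) (hd ▸ hv), rank_eq_of_greenR hH.1]
  · have h1 := mate_switch_mate f hxv (by rw [hfx]; simp)
    rw [hfx, hfv, ← hook_mul] at h1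
    have h2 := (greenL_iff.1 hL _ _).1 h1
    rw [hook_mul, mate_switch_of_ne, hgw] at h2
    · cases h2
    · simp
    · simp
    · rw [hgx]
      simpa using hyy
    · rw [hgv]
      intro h'
      rw [← hgv] at h'
      have := mate_comm h'.symm
      rw [hgw] at this
      exact hvw (Sum.inl_injective this).symm

end Rank

/-! ### The distinguished maximal subgroups -/

section Bar

variable {n q : ℕ}

/-- The partner of a vertex `a ≥ q` in the pairing `{q, q + 1}, {q + 2, q + 3}, …`. -/
def tailMate (hp : q ≡ n [MOD 2]) (a : Fin n) (h : q ≤ a.val) : Fin n :=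
  ⟨if (a.val - q) % 2 = 0 then a.val + 1 else a.val - 1, by
    have h1 : q % 2 = n % 2 := hp
    have h2 := a.2
    split_ifs <;> omega⟩

theorem le_tailMate (hp : q ≡ n [MOD 2]) (a : Fin n) (h : q ≤ a.val) :
    q ≤ (tailMate hp a h).val := by
  simp only [tailMate]
  split_ifs <;> omega

theorem tailMate_tailMate (hp : q ≡ n [MOD 2]) (a : Fin n) (h : q ≤ a.val) :
    tailMate hp (tailMate hp a h) (le_tailMate hp a h) = a := by
  apply Fin.ext
  simp only [tailMate]
  split_ifs <;> omega

theorem tailMate_ne (hp : q ≡ n [MOD 2]) (a : Fin n) (h : q ≤ a.val) : tailMate hp a h ≠ a := by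
  intro h'
  have := congrArg Fin.val h'
  simp only [tailMate] at this
  split_ifs at this <;> omega

/-- The matching of `bar n σ`. -/
def barMate (hq : q ≤ n) (hp : q ≡ n [MOD 2]) (σ : Equiv.Perm (Fin q)) : Vertex n → Vertex n
  | Sum.inl a => if h : a.val < q then Sum.inr (Fin.castLE hq (σ ⟨a.val, h⟩))
      else Sum.inl (tailMate hp a (not_lt.1 h))
  | Sum.inr a => if h : a.val < q then Sum.inl (Fin.castLE hq (σ⁻¹ ⟨a.val, h⟩))
      else Sum.inr (tailMate hp a (not_lt.1 h))

theorem barMate_barMate (hq : q ≤ n) (hp : q ≡ n [MOD 2]) (σ : Equiv.Perm (Fin q))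
    (x : Vertex n) : barMate hq hp σ (barMate hq hp σ x) = x := by
  rcases x with a | a <;> by_cases h : a.val < q
  · simp [barMate, h]
  · have := le_tailMate hp a (not_lt.1 h)
    simp [barMate, h, not_lt.2 this, tailMate_tailMate]
  · simp [barMate, h]
  · have := le_tailMate hp a (not_lt.1 h)
    simp [barMate, h, not_lt.2 this, tailMate_tailMate]

theorem barMate_ne (hq : q ≤ n) (hp : q ≡ n [MOD 2]) (σ : Equiv.Perm (Fin q))
    (x : Vertex n) : barMate hq hp σ x ≠ x := by
  rcases x with a | a <;> by_cases h : a.val < q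
  · simp [barMate, h]
  · have := tailMate_ne hp a (not_lt.1 h)
    simpa [barMate, h] using this
  · simp [barMate, h]
  · have := tailMate_ne hp a (not_lt.1 h)
    simpa [barMate, h] using this

/-- The Brauer element `bar n σ`. -/
def barB (hq : q ≤ n) (hp : q ≡ n [MOD 2]) (σ : Equiv.Perm (Fin q)) : Brauer n :=
  ofMate (barMate hq hp σ) (barMate_barMate hq hp σ) (barMate_ne hq hp σ)

theorem coe_barB (hq : q ≤ n) (hp : q ≡ n [MOD 2]) (σ : Equiv.Perm (Fin q)) :
    (barB hq hp σ).1 = bar n σ := by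
  have h1 : ∀ x y, BarEdge σ x y → y = barMate hq hp σ x := by
    rintro x y (⟨i, a, b, ha, hb⟩ | ⟨k, a, b, ha, hb⟩ | ⟨k, a, b, ha, hb⟩)
    · have h : a.val < q := by omega
      have hi : (⟨a.val, h⟩ : Fin q) = i := Fin.ext ha
      simp only [barMate, h, dif_pos, hi]
      congr 1
      exact Fin.ext hb
    · have h : ¬ a.val < q := by omega
      simp only [barMate, h, dif_neg, not_false_iff]
      congr 1
      apply Fin.ext
      simp only [tailMate]
      split_ifs <;> omega
    · have h : ¬ a.val < q := by omega
      simp only [barMate, h, dif_neg, not_false_iff]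
      congr 1
      apply Fin.ext
      simp only [tailMate]
      split_ifs <;> omega
  have h2 : ∀ x, (bar n σ).Rel x (barMate hq hp σ x) := by
    have htail : ∀ a : Fin n, ∀ h : q ≤ a.val, ∃ k,
        (a.val = q + 2 * k ∧ (tailMate hp a h).val = q + 2 * k + 1) ∨
        ((tailMate hp a h).val = q + 2 * k ∧ a.val = q + 2 * k + 1) := by
      intro a h
      refine ⟨(a.val - q) / 2, ?_⟩
      simp only [tailMate]
      split_ifs <;> omega
    rintro (a | a) <;> by_cases h : a.val < q
    · have e : barMate hq hp σ (Sum.inl a) = Sum.inr (Fin.castLE hq (σ ⟨a.val, h⟩)) := by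
        simp [barMate, h]
      rw [e]
      exact .rel _ _ (.cross ⟨a.val, h⟩ _ _ rfl rfl)
    · have e : barMate hq hp σ (Sum.inl a) = Sum.inl (tailMate hp a (not_lt.1 h)) := by
        simp [barMate, h]
      rw [e]
      obtain ⟨k, ⟨h1, h2⟩ | ⟨h1, h2⟩⟩ := htail a (not_lt.1 h)
      · exact .rel _ _ (.upper k _ _ h1 h2)
      · exact .symm _ _ (.rel _ _ (.upper k _ _ h1 h2))
    · have e : barMate hq hp σ (Sum.inr a) = Sum.inl (Fin.castLE hq (σ⁻¹ ⟨a.val, h⟩)) := by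
        simp [barMate, h]
      rw [e]
      exact .symm _ _ (.rel _ _ (.cross (σ⁻¹ ⟨a.val, h⟩) _ _ rfl (by simp)))
    · have e : barMate hq hp σ (Sum.inr a) = Sum.inr (tailMate hp a (not_lt.1 h)) := by
        simp [barMate, h]
      rw [e]
      obtain ⟨k, ⟨h1, h2⟩ | ⟨h1, h2⟩⟩ := htail a (not_lt.1 h)
      · exact .rel _ _ (.lower k _ _ h1 h2)
      · exact .symm _ _ (.rel _ _ (.lower k _ _ h1 h2))
  apply Diagram.rel_ext
  intro x y
  constructor
  · rintro (rfl | rfl)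
    · exact Diagram.rel_refl _ _
    · exact h2 x
  · intro h
    change Relation.EqvGen (BarEdge σ) x y at h
    induction h with
    | rel x y h => exact Or.inr (h1 x y h)
    | refl x => exact Diagram.rel_refl _ _
    | symm x y _ ih => exact Diagram.rel_symm ih
    | trans x y z _ _ ih ih' => exact Diagram.rel_trans ih ih'

variable (hq : q ≤ n) (hp : q ≡ n [MOD 2])

theorem mate_barB_inl (σ : Equiv.Perm (Fin q)) (i : Fin q) :
    mate (barB hq hp σ) (Sum.inl (Fin.castLE hq i)) = Sum.inr (Fin.castLE hq (σ i)) := by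
  rw [barB, mate_ofMate]
  simp [barMate]

theorem mate_barB_inr (σ : Equiv.Perm (Fin q)) (i : Fin q) :
    mate (barB hq hp σ) (Sum.inr (Fin.castLE hq (σ i))) = Sum.inl (Fin.castLE hq i) :=
  mate_comm (mate_barB_inl hq hp σ i)

theorem mate_barB_inl_of_le (σ : Equiv.Perm (Fin q)) {a : Fin n} (h : q ≤ a.val) :
    mate (barB hq hp σ) (Sum.inl a) = Sum.inl (tailMate hp a h) := by
  rw [barB, mate_ofMate]
  simp [barMate, not_lt.2 h]

theorem mate_barB_inr_of_le (σ : Equiv.Perm (Fin q)) {a : Fin n} (h : q ≤ a.val) :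
    mate (barB hq hp σ) (Sum.inr a) = Sum.inr (tailMate hp a h) := by
  rw [barB, mate_ofMate]
  simp [barMate, not_lt.2 h]

theorem exists_castLE_or_le (hq : q ≤ n) (a : Fin n) : (∃ i : Fin q, a = Fin.castLE hq i) ∨ q ≤ a.val := by
  by_cases h : a.val < q
  · exact Or.inl ⟨⟨a.val, h⟩, rfl⟩
  · exact Or.inr (not_lt.1 h)

theorem mem_dom_barB {σ : Equiv.Perm (Fin q)} {a : Fin n} : a ∈ dom (barB hq hp σ) ↔ a.val < q := by
  rcases exists_castLE_or_le hq a with ⟨i, rfl⟩ | h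
  · exact iff_of_true (mem_dom.2 ⟨_, mate_barB_inl hq hp σ i⟩) i.2
  · exact iff_of_false (notMem_dom.2 ⟨_, mate_barB_inl_of_le hq hp σ h⟩) (not_lt.2 h)

theorem rank_barB (σ : Equiv.Perm (Fin q)) : (barB hq hp σ).1.rank = q := by
  rw [← card_dom]
  have : dom (barB hq hp σ) = Finset.univ.map (Fin.castLEEmb hq) := by
    ext a
    rw [mem_dom_barB]
    simp only [Finset.mem_map, Finset.mem_univ, true_and]
    constructor
    · intro h
      exact ⟨⟨a.val, h⟩, rfl⟩
    · rintro ⟨i, rfl⟩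
      exact i.2
  rw [this, Finset.card_map, Finset.card_univ, Fintype.card_fin]

theorem barB_mul (σ τ : Equiv.Perm (Fin q)) :
    barB hq hp σ * barB hq hp τ = barB hq hp (τ * σ) := by
  have key : ∀ i : Fin q, mate (barB hq hp σ * barB hq hp τ) (Sum.inl (Fin.castLE hq i))
      = Sum.inr (Fin.castLE hq ((τ * σ) i)) := fun i =>
    mate_mul_cross (mate_barB_inl hq hp σ i) (mate_barB_inl hq hp τ (σ i))
  refine ext_mate fun x => ?_
  rcases x with a | a <;> rcases exists_castLE_or_le hq a with ⟨i, rfl⟩ | h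
  · rw [key, mate_barB_inl]
  · rw [mate_mul_upper _ (mate_barB_inl_of_le hq hp σ h), mate_barB_inl_of_le hq hp _ h]
  · obtain ⟨j, rfl⟩ := (τ * σ).surjective i
    rw [mate_comm (key j), mate_barB_inr]
  · rw [mate_mul_lower _ (mate_barB_inr_of_le hq hp τ h), mate_barB_inr_of_le hq hp _ h]

theorem star_barB (σ : Equiv.Perm (Fin q)) :
    brauerStar (barB hq hp σ) = barB hq hp σ⁻¹ := by
  refine ext_mate fun x => ?_
  rw [mate_star]
  rcases x with a | a <;> rcases exists_castLE_or_le hq a with ⟨i, rfl⟩ | h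
  · obtain ⟨j, rfl⟩ := σ.surjective i
    rw [mate_barB_inl, Sum.swap_inl, mate_barB_inr]
    simp
  · rw [mate_barB_inl_of_le hq hp _ h, Sum.swap_inl, mate_barB_inr_of_le hq hp _ h]
    rfl
  · have := mate_barB_inr hq hp σ⁻¹ (σ i)
    rw [show σ⁻¹ (σ i) = i by simp] at this
    rw [this, Sum.swap_inr, mate_barB_inl]
    rfl
  · rw [mate_barB_inr_of_le hq hp _ h, Sum.swap_inr, mate_barB_inl_of_le hq hp _ h]
    rfl

theorem barB_injective : Function.Injective (barB hq hp) := by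
  intro σ τ h
  ext i
  have h1 := mate_barB_inl hq hp σ i
  rw [h, mate_barB_inl] at h1
  have h2 := congrArg Fin.val (Sum.inr_injective h1)
  simpa using h2.symm

theorem greenH_barB (σ τ : Equiv.Perm (Fin q)) : GreenH (barB hq hp σ) (barB hq hp τ) := by
  have h : ∀ σ τ : Equiv.Perm (Fin q), ∃ s, barB hq hp σ * s = barB hq hp τ := fun σ τ =>
    ⟨barB hq hp (τ * σ⁻¹), by rw [barB_mul]; simp⟩
  have h' : ∀ σ τ : Equiv.Perm (Fin q), ∃ s, s * barB hq hp σ = barB hq hp τ := fun σ τ =>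
    ⟨barB hq hp (σ⁻¹ * τ), by rw [barB_mul]; simp⟩
  exact ⟨greenR_iff_exists.2 ⟨h σ τ, h τ σ⟩, greenL_iff_exists.2 ⟨h' σ τ, h' τ σ⟩⟩

/-- The maximal subgroup with identity `barB 1` is the copy of the symmetric group. -/
theorem exists_eq_barB {α : Brauer n} (h : GreenH α (barB hq hp 1)) : ∃ σ, α = barB hq hp σ := by
  have h1 : ∀ i : Fin q, ∃ j : Fin q,
      mate α (Sum.inl (Fin.castLE hq i)) = Sum.inr (Fin.castLE hq j) := by
    intro i
    have hi : Fin.castLE hq i ∈ dom α := by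
      rw [dom_eq_of_greenR h.1, mem_dom_barB]
      exact i.2
    obtain ⟨a, ha⟩ := mem_dom.1 hi
    rcases exists_castLE_or_le hq a with ⟨j, rfl⟩ | hle
    · exact ⟨j, ha⟩
    · have := (greenL_iff.1 h.2 _ _).2 (mate_barB_inr_of_le hq hp 1 hle)
      rw [mate_comm ha] at this
      cases this
  choose f hf using h1
  have hinj : Function.Injective f := by
    intro i j hij
    have h2 := hf i
    rw [hij, ← hf j] at h2
    exact Fin.castLE_injective hq (Sum.inl_injective (mate_injective α h2))
  refine ⟨Equiv.ofBijective f (Finite.injective_iff_bijective.1 hinj), ?_⟩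
  refine ext_mate fun x => ?_
  rcases x with a | a <;> rcases exists_castLE_or_le hq a with ⟨i, rfl⟩ | hle
  · rw [hf, mate_barB_inl]
    rfl
  · rw [(greenR_iff.1 h.1 _ _).2 (mate_barB_inl_of_le hq hp 1 hle), mate_barB_inl_of_le hq hp _ hle]
  · obtain ⟨j, rfl⟩ := (Finite.injective_iff_surjective.1 hinj) i
    rw [mate_comm (hf j)]
    exact (mate_barB_inr hq hp (Equiv.ofBijective f _) j).symm
  · rw [(greenL_iff.1 h.2 _ _).2 (mate_barB_inr_of_le hq hp 1 hle), mate_barB_inr_of_le hq hp _ hle]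

theorem mem_barSubgroup {N : Subgroup (Equiv.Perm (Fin q))} {α : Brauer n} :
    α ∈ barSubgroup n N ↔ ∃ σ ∈ N, α = barB hq hp σ := by
  refine exists_congr fun σ => and_congr_right fun _ => ?_
  rw [← coe_barB hq hp, Subtype.ext_iff]

theorem barB_mem_barSubgroup {N : Subgroup (Equiv.Perm (Fin q))} {σ : Equiv.Perm (Fin q)} :
    barB hq hp σ ∈ barSubgroup n N ↔ σ ∈ N := by
  rw [mem_barSubgroup hq hp]
  constructor
  · rintro ⟨τ, hτ, h⟩
    rwa [barB_injective hq hp h]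
  · exact fun h => ⟨σ, h, rfl⟩

theorem barSubgroup_nontrivial (hq : q ≤ n) (hp : q ≡ n [MOD 2]) 
    {N : Subgroup (Equiv.Perm (Fin q))} :
    (barSubgroup n N).Nontrivial ↔ N ≠ ⊥ := by
  constructor
  · rintro ⟨x, hx, y, hy, hxy⟩ rfl
    obtain ⟨σ, hσ, rfl⟩ := (mem_barSubgroup hq hp).1 hx
    obtain ⟨τ, hτ, rfl⟩ := (mem_barSubgroup hq hp).1 hy
    rw [Subgroup.mem_bot.1 hσ, Subgroup.mem_bot.1 hτ] at hxy
    exact hxy rfl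
  · intro h
    obtain ⟨σ, h1⟩ := Subgroup.ne_bot_iff_exists_ne_one.1 h
    refine ⟨_, (barB_mem_barSubgroup hq hp).2 σ.2, _, (barB_mem_barSubgroup hq hp).2 N.one_mem, ?_⟩
    intro h2
    exact h1 (Subtype.ext (barB_injective hq hp h2))

end Bar

/-! ### The relation of a normal subgroup -/

section Nu

variable {n q : ℕ}

/-- Multiplications that preserve the rank preserve the relation `H`. -/
theorem GreenH.mul_mul {a b s t : Brauer n} (h : GreenH a b)
    (hr : a.1.rank ≤ (s * a * t).1.rank) : GreenH (s * a * t) (s * b * t) := by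
  have h1 : a.1.rank ≤ (s * a).1.rank := hr.trans (rank_mul_le_left _ _)
  have h2 : GreenR (s * a) (s * b) := h.1.mul_left s
  have h3 : GreenL (s * a) (s * b) :=
    (greenL_mul_of_rank h1).symm.trans (h.2.trans (greenL_mul_of_rank (by
      rw [← rank_eq_of_greenR h2, ← rank_eq_of_greenR h.1]; exact h1)))
  have h4 : GreenL (s * a * t) (s * b * t) := h3.mul_right t
  have h5 : (s * a).1.rank ≤ (s * a * t).1.rank := (rank_mul_le_right _ _).trans hr
  refine ⟨(greenR_mul_of_rank h5).symm.trans (h2.trans (greenR_mul_of_rank ?_)), h4⟩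
  rw [← rank_eq_of_greenL h4, ← rank_eq_of_greenR h2]
  exact h5

variable (hq : q ≤ n) (hp : q ≡ n [MOD 2])

theorem barB_one_mul (σ : Equiv.Perm (Fin q)) :
    barB hq hp 1 * barB hq hp σ = barB hq hp σ := by rw [barB_mul, mul_one]

theorem barB_mul_one (σ : Equiv.Perm (Fin q)) :
    barB hq hp σ * barB hq hp 1 = barB hq hp σ := by rw [barB_mul, one_mul]

/-- An `H`-class of rank `q` is translated to the distinguished one, and back. -/
theorem exists_translation {a : Brauer n} (ha : a.1.rank = q) :
    ∃ s t s' t' : Brauer n, s * a * t = barB hq hp 1 ∧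
      ∀ b, GreenH a b → s' * (s * b * t) * t' = b := by
  obtain ⟨x, y, hxy⟩ := mem_principalIdeal_iff.2
    (show a.1.rank ≤ (barB hq hp 1).1.rank by rw [rank_barB, ha])
  set e := barB hq hp 1 with he
  have hee : e * e = e := barB_mul_one hq hp 1
  have hre : e.1.rank = q := rank_barB hq hp 1
  have hstar : brauerStar e = e := by rw [he, star_barB, inv_one]
  have hpr : a = (x * e) * (e * y) := by
    rw [hxy]
    simp only [mul_assoc]
    rw [← mul_assoc e e y, hee]
  have hpL : GreenL e (x * e) := greenL_mul_of_rank (by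
    rw [hre, ← ha, hpr]; exact rank_mul_le_left _ _)
  have hrR : GreenR e (e * y) := greenR_mul_of_rank (by
    rw [hre, ← ha, hpr]; exact rank_mul_le_right _ _)
  have hpR : GreenR (x * e) a := by
    rw [hpr]
    apply greenR_mul_of_rank
    rw [← hpr, ha, ← hre]
    exact rank_mul_le_right x e
  have hrL : GreenL (e * y) a := by
    rw [hpr]
    apply greenL_mul_of_rank
    rw [← hpr, ha, ← hre]
    exact rank_mul_le_left e y
  have e1 : brauerStar (x * e) * (x * e) = e := by
    have := proj_eq_of_greenR (greenR_star.2 hpL)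
    rw [star_star, star_star, hstar, hee] at this
    exact this.symm
  have e2 : (e * y) * brauerStar (e * y) = e := by
    have := proj_eq_of_greenR hrR
    rw [hstar, hee] at this
    exact this.symm
  refine ⟨brauerStar (x * e), brauerStar (e * y), x * e, e * y, ?_, ?_⟩
  · calc brauerStar (x * e) * a * brauerStar (e * y)
        = (brauerStar (x * e) * (x * e)) * ((e * y) * brauerStar (e * y)) := by
          rw [hpr]; simp only [mul_assoc]
      _ = e := by rw [e1, e2, hee]
  · intro b hb
    calc x * e * (brauerStar (x * e) * b * brauerStar (e * y)) * (e * y)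
        = x * e * brauerStar (x * e) * b * (brauerStar (e * y) * (e * y)) := by
          simp only [mul_assoc]
      _ = b := by
          rw [proj_mul_of_greenR (hpR.trans hb.1), mul_proj_of_greenL (hrL.trans hb.2)]

/-- The relation `ν_N` for a normal subgroup `N` of a distinguished maximal subgroup, tested by
translating the first element to the identity of the subgroup. -/
theorem nuRel_iff {N : Subgroup (Equiv.Perm (Fin q))} (hN : N.Normal) {a b : Brauer n} :
    nuRel (barSubgroup n N) a b ↔ a.1.rank = q ∧ GreenH a b ∧
      ∀ s t, s * a * t = barB hq hp 1 → s * b * t ∈ barSubgroup n N := by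
  constructor
  · rintro ⟨u, hu, v, hv, s, t, rfl, rfl, hJ, -⟩
    obtain ⟨σ, hσ, rfl⟩ := (mem_barSubgroup hq hp).1 hu
    obtain ⟨τ, hτ, rfl⟩ := (mem_barSubgroup hq hp).1 hv
    rw [greenJ_iff] at hJ
    refine ⟨by rw [hJ, rank_barB], (greenH_barB hq hp σ τ).mul_mul hJ.ge, ?_⟩
    intro x y hxy
    have h1 : (x * s) * barB hq hp σ * (t * y) = barB hq hp 1 := by
      rw [← hxy]
      simp only [mul_assoc]
    have h2 : x * (s * barB hq hp τ * t) * y = (x * s) * barB hq hp τ * (t * y) := by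
      simp only [mul_assoc]
    rw [h2]
    generalize x * s = p at h1
    generalize t * y = r at h1
    have hr : (p * barB hq hp σ * r).1.rank = q := by rw [h1, rank_barB]
    have hpu : GreenH (p * barB hq hp σ) (barB hq hp 1) := by
      constructor
      · rw [← h1]
        apply greenR_mul_of_rank
        rw [hr]
        exact (rank_mul_le_right _ _).trans (rank_barB hq hp σ).le
      · refine (greenL_mul_of_rank ?_).symm.trans (greenH_barB hq hp _ _).2
        rw [rank_barB]
        exact hr.ge.trans (rank_mul_le_left _ _)
    have hur : GreenH (barB hq hp σ * r) (barB hq hp 1) := by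
      constructor
      · refine (greenR_mul_of_rank ?_).symm.trans (greenH_barB hq hp _ _).1
        rw [rank_barB]
        rw [mul_assoc] at hr
        exact hr.ge.trans (rank_mul_le_right _ _)
      · rw [← h1, mul_assoc]
        apply greenL_mul_of_rank
        rw [← mul_assoc, hr]
        exact (rank_mul_le_left _ _).trans (rank_barB hq hp σ).le
    obtain ⟨π, hπ⟩ := exists_eq_barB hq hp hpu
    obtain ⟨ρ, hρ⟩ := exists_eq_barB hq hp hur
    have key : ∀ ω : Equiv.Perm (Fin q),
        p * (barB hq hp σ * barB hq hp ω * barB hq hp σ) * r = barB hq hp (ρ * ω * π) := by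
      intro ω
      calc p * (barB hq hp σ * barB hq hp ω * barB hq hp σ) * r
          = (p * barB hq hp σ) * barB hq hp ω * (barB hq hp σ * r) := by simp only [mul_assoc]
        _ = _ := by rw [hπ, hρ, barB_mul, barB_mul, mul_assoc]
    have k1 := key σ⁻¹
    rw [barB_mul, barB_mul, inv_mul_cancel, mul_one, h1] at k1
    have k2 := key (σ⁻¹ * τ * σ⁻¹)
    have e : σ * (σ⁻¹ * τ * σ⁻¹ * σ) = τ := by group
    rw [barB_mul, barB_mul, e] at k2
    rw [k2, barB_mem_barSubgroup]
    have k3 := barB_injective hq hp k1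
    have k4 : ρ * (σ⁻¹ * τ * σ⁻¹) * π = (ρ * σ⁻¹) * (τ * σ⁻¹) * (ρ * σ⁻¹)⁻¹ := by
      have : π = (ρ * σ⁻¹)⁻¹ := eq_inv_of_mul_eq_one_right k3.symm
      rw [this]
      group
    rw [k4]
    exact hN.conj_mem _ (N.mul_mem hτ (N.inv_mem hσ)) _
  · rintro ⟨ha, hH, h⟩
    obtain ⟨s, t, s', t', h1, h2⟩ := exists_translation hq hp ha
    refine ⟨_, (barB_mem_barSubgroup hq hp).2 N.one_mem, _, h s t h1, s', t', ?_,
      (h2 b hH).symm, ?_, ?_⟩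
    · rw [← h1, h2 a (.refl a)]
    · rw [greenJ_iff, ha, rank_barB]
    · obtain ⟨σ, -, hσ⟩ := (mem_barSubgroup hq hp).1 (h s t h1)
      rw [hσ, greenJ_iff, ← rank_eq_of_greenR hH.1, ha, rank_barB]

theorem exists_mul_mul_eq_barB {a b s t : Brauer n} (hab : GreenH a b) (ha : a.1.rank = q)
    (h : s * a * t = barB hq hp 1) : ∃ σ, s * b * t = barB hq hp σ := by
  have h1 := hab.mul_mul (s := s) (t := t) (by rw [h, rank_barB, ha])
  rw [h] at h1
  exact exists_eq_barB hq hp h1.symm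

variable {N : Subgroup (Equiv.Perm (Fin q))}

theorem nuRel_symm {S : Type*} [Monoid S] {N : Set S} {a b : S} (h : nuRel N a b) :
    nuRel N b a := by
  obtain ⟨u, hu, v, hv, s, t, h1, h2, h3, h4⟩ := h
  exact ⟨v, hv, u, hu, s, t, h2, h1, h4, h3⟩

theorem nuRel_star (hq : q ≤ n) (hp : q ≡ n [MOD 2]) 
    {a b : Brauer n} (h : nuRel (barSubgroup n N) a b) :
    nuRel (barSubgroup n N) (brauerStar a) (brauerStar b) := by
  have key : ∀ u ∈ barSubgroup n N, brauerStar u ∈ barSubgroup n N := by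
    intro u hu
    obtain ⟨σ, hσ, rfl⟩ := (mem_barSubgroup hq hp).1 hu
    rw [star_barB]
    exact (barB_mem_barSubgroup hq hp).2 (N.inv_mem hσ)
  obtain ⟨u, hu, v, hv, s, t, rfl, rfl, h3, h4⟩ := h
  rw [greenJ_iff] at h3 h4
  refine ⟨_, key u hu, _, key v hv, brauerStar t, brauerStar s, ?_, ?_, ?_, ?_⟩
  · simp [mul_assoc]
  · simp [mul_assoc]
  · rw [greenJ_iff, rank_star, rank_star, h3]
  · rw [greenJ_iff, rank_star, rank_star, h4]

theorem rank_of_nuRel (hq : q ≤ n) (hp : q ≡ n [MOD 2]) 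
    {a b : Brauer n} (h : nuRel (barSubgroup n N) a b) : a.1.rank = q := by
  obtain ⟨u, hu, v, hv, s, t, h1, h2, h3, h4⟩ := h
  obtain ⟨σ, hσ, rfl⟩ := (mem_barSubgroup hq hp).1 hu
  rw [greenJ_iff.1 h3, rank_barB]

theorem nuRel_trans (hq : q ≤ n) (hp : q ≡ n [MOD 2]) 
    (hN : N.Normal) {a b c : Brauer n} (h : nuRel (barSubgroup n N) a b)
    (h' : nuRel (barSubgroup n N) b c) : nuRel (barSubgroup n N) a c := by
  rw [nuRel_iff hq hp hN] at h h' ⊢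
  obtain ⟨ha, hab, h⟩ := h
  obtain ⟨hb, hbc, h'⟩ := h'
  refine ⟨ha, hab.trans hbc, fun s t hst => ?_⟩
  obtain ⟨σ, hσ, h1⟩ := (mem_barSubgroup hq hp).1 (h s t hst)
  have h2 := h' s (t * barB hq hp σ⁻¹) (by
    rw [← mul_assoc, h1, barB_mul, inv_mul_cancel])
  obtain ⟨τ, h3⟩ := exists_mul_mul_eq_barB hq hp (hab.trans hbc) ha hst
  rw [← mul_assoc, h3, barB_mul, barB_mem_barSubgroup] at h2
  rw [h3, barB_mem_barSubgroup]
  have := N.mul_mem hσ h2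
  rwa [mul_inv_cancel_left] at this

theorem nuRel_mul_left (hq : q ≤ n) (hp : q ≡ n [MOD 2]) 
    (hN : N.Normal) {a b : Brauer n} (h : nuRel (barSubgroup n N) a b)
    {x : Brauer n} (hx : (x * a).1.rank = q) : nuRel (barSubgroup n N) (x * a) (x * b) := by
  rw [nuRel_iff hq hp hN] at h ⊢
  obtain ⟨ha, hab, h⟩ := h
  refine ⟨hx, ?_, fun s t hst => ?_⟩
  · have := hab.mul_mul (s := x) (t := 1) (by rw [mul_one, hx, ha])
    rwa [mul_one, mul_one] at this
  · have := h (s * x) t (by rw [← hst]; simp only [mul_assoc])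
    simpa only [mul_assoc] using this

theorem greenH_of_nuRel (hq : q ≤ n) (hp : q ≡ n [MOD 2]) 
    (hN : N.Normal) {a b : Brauer n} (h : nuRel (barSubgroup n N) a b) :
    GreenH a b := ((nuRel_iff hq hp hN).1 h).2.1

theorem nuRel_barB_iff (hN : N.Normal) {σ : Equiv.Perm (Fin q)} :
    nuRel (barSubgroup n N) (barB hq hp 1) (barB hq hp σ) ↔ σ ∈ N := by
  constructor
  · intro h
    have := ((nuRel_iff hq hp hN).1 h).2.2 1 1 (by simp)
    rwa [one_mul, mul_one, barB_mem_barSubgroup] at this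
  · intro h
    refine ⟨_, (barB_mem_barSubgroup hq hp).2 N.one_mem, _, (barB_mem_barSubgroup hq hp).2 h, 1, 1,
      by simp, by simp, Eq.refl _, Eq.refl _⟩

theorem eq_of_nuRel_bot {a b : Brauer n}
    (h : nuRel (barSubgroup n (⊥ : Subgroup (Equiv.Perm (Fin q)))) a b) : a = b := by
  obtain ⟨u, ⟨σ, hσ, hu⟩, v, ⟨τ, hτ, hv⟩, s, t, rfl, rfl, -⟩ := h
  rw [Subgroup.mem_bot] at hσ hτ
  have : u = v := Subtype.ext (by rw [hu, hv, hσ, hτ])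
  rw [this]

theorem nuRel_mono {S : Type*} [Monoid S] {N N' : Set S} (hN : N ⊆ N') {a b : S}
    (h : nuRel N a b) : nuRel N' a b := by
  obtain ⟨u, hu, v, hv, h⟩ := h
  exact ⟨u, hN hu, v, hN hv, h⟩

/-- The permutations identified with the identity by a congruence. -/
def conSubgroup (c : Con (Brauer n)) : Subgroup (Equiv.Perm (Fin q)) where
  carrier := {σ | c (barB hq hp 1) (barB hq hp σ)}
  one_mem' := c.refl _
  mul_mem' {σ τ} hσ hτ := by
    have := c.mul hτ hσ
    rwa [barB_mul, barB_mul, one_mul] at this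
  inv_mem' {σ} hσ := by
    have := c.mul hσ (c.refl (barB hq hp σ⁻¹))
    rw [barB_mul, barB_mul, mul_one, inv_mul_cancel] at this
    exact c.symm this

theorem mem_conSubgroup {c : Con (Brauer n)} {σ : Equiv.Perm (Fin q)} :
    σ ∈ conSubgroup hq hp c ↔ c (barB hq hp 1) (barB hq hp σ) := Iff.rfl

theorem conSubgroup_normal (c : Con (Brauer n)) : (conSubgroup hq hp c).Normal := by
  constructor
  intro σ hσ τ
  have := c.mul (c.mul (c.refl (barB hq hp τ⁻¹)) hσ) (c.refl (barB hq hp τ))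
  rw [barB_mul, barB_mul, barB_mul, barB_mul, one_mul, mul_inv_cancel] at this
  rw [mem_conSubgroup, mul_assoc]
  exact this

/-- On `H`-related pairs of rank `q`, a congruence is the relation `ν_N` of its subgroup. -/
theorem con_iff_nuRel {c : Con (Brauer n)} {a b : Brauer n} (ha : a.1.rank = q)
    (hab : GreenH a b) : c a b ↔ nuRel (barSubgroup n (conSubgroup hq hp c)) a b := by
  constructor
  · intro h
    rw [nuRel_iff hq hp (conSubgroup_normal hq hp c)]
    refine ⟨ha, hab, fun s t hst => ?_⟩
    obtain ⟨σ, hσ⟩ := exists_mul_mul_eq_barB hq hp hab ha hst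
    rw [hσ, barB_mem_barSubgroup, mem_conSubgroup, ← hst, ← hσ]
    exact c.mul (c.mul (c.refl s) h) (c.refl t)
  · rintro ⟨u, hu, v, hv, s, t, rfl, rfl, -⟩
    obtain ⟨σ, hσ, rfl⟩ := (mem_barSubgroup hq hp).1 hu
    obtain ⟨τ, hτ, rfl⟩ := (mem_barSubgroup hq hp).1 hv
    exact c.mul (c.mul (c.refl s) (c.trans (c.symm hσ) hτ)) (c.refl t)

end Nu

/-! ### The retraction onto the minimal ideal -/

section Retraction

variable {n : ℕ}

/-- An element of the minimal ideal. -/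
noncomputable def lowElt (n : ℕ) : Brauer n := (exists_rank_le_one n).choose

theorem rank_lowElt : (lowElt n).1.rank ≤ 1 := (exists_rank_le_one n).choose_spec

/-- The map `x ↦ x m x` for an element `m` of the minimal ideal.  On the elements of rank at most
`2` it is the retraction onto the minimal ideal, and does not depend on `m`. -/
noncomputable def retr (x : Brauer n) : Brauer n := x * lowElt n * x

theorem rank_retr (x : Brauer n) : (retr x).1.rank ≤ 1 :=
  mul_rank_le_one_left (mul_rank_le_one_right x rank_lowElt) x

theorem retr_eq_self {x : Brauer n} (hx : x.1.rank ≤ 1) : retr x = x := mul_mul_eq_self hx _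

/-- If `x` has at most two transversals, then there is only one way to close them up. -/
theorem greenR_mul_low {x m m' : Brauer n} (hx : x.1.rank ≤ 2) (hm : m.1.rank ≤ 1)
    (hm' : m'.1.rank ≤ 1) : GreenR (x * m) (x * m') := by
  have hr := mul_rank_le_one_right x hm
  have hr' := mul_rank_le_one_right x hm'
  refine greenR_of_upper (fun i j hij => ?_) (rank_eq_of_le_one hr hr').le
  by_cases hi : i ∈ dom x
  · have key : ∀ {m : Brauer n} {j}, mate (x * m) (Sum.inl i) = Sum.inl j → j ∈ dom x ∧ i ≠ j := by
      intro m j hij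
      constructor
      · by_contra hj
        obtain ⟨k, hk⟩ := notMem_dom.1 hj
        have h1 := mate_mul_upper m hk
        rw [mate_comm hij] at h1
        cases h1
        exact notMem_dom.2 ⟨_, mate_comm hk⟩ hi
      · rintro rfl
        exact mate_ne _ _ hij
    obtain ⟨hj, hne⟩ := key hij
    have h2 : 2 ≤ x.1.rank := by
      rw [← card_dom]
      exact Finset.one_lt_card.2 ⟨i, hi, j, hj, hne⟩
    have h3 := rank_mod_two x
    have h4 := rank_mod_two (x * m')
    have h5 : i ∉ dom (x * m') := by
      have : dom (x * m') = ∅ := by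
        rw [← Finset.card_eq_zero, card_dom]
        omega
      simp [this]
    obtain ⟨k, hk⟩ := notMem_dom.1 h5
    obtain ⟨hk', hne'⟩ := key hk
    have h6 : k = j := by
      by_contra hkj
      have : ({i, j, k} : Finset (Fin n)) ⊆ dom x := by
        intro a ha
        simp only [Finset.mem_insert, Finset.mem_singleton] at ha
        rcases ha with rfl | rfl | rfl <;> assumption
      have h7 := Finset.card_le_card this
      rw [card_dom, Finset.card_eq_three.2 ⟨i, j, k, hne, hne', Ne.symm hkj, rfl⟩] at h7
      omega
    rw [hk, h6]
  · obtain ⟨k, hk⟩ := notMem_dom.1 hi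
    rw [mate_mul_upper m' hk, ← mate_mul_upper m hk, hij]

theorem greenL_low_mul {x m m' : Brauer n} (hx : x.1.rank ≤ 2) (hm : m.1.rank ≤ 1)
    (hm' : m'.1.rank ≤ 1) : GreenL (m * x) (m' * x) := by
  rw [← greenR_star, star_mul, star_mul]
  exact greenR_mul_low (by rwa [rank_star]) (by rwa [rank_star]) (by rwa [rank_star])

theorem greenR_retr {x m : Brauer n} (hx : x.1.rank ≤ 2) (hm : m.1.rank ≤ 1) :
    GreenR (retr x) (x * m) := by
  rw [retr, mul_assoc]
  exact greenR_mul_low hx (mul_rank_le_one_left rank_lowElt x) hm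

theorem greenL_retr {x m : Brauer n} (hx : x.1.rank ≤ 2) (hm : m.1.rank ≤ 1) :
    GreenL (retr x) (m * x) :=
  greenL_low_mul hx (mul_rank_le_one_right x rank_lowElt) hm

theorem eq_retr {x y : Brauer n} (hx : x.1.rank ≤ 2) (hy : y.1.rank ≤ 1)
    (hR : ∃ m : Brauer n, m.1.rank ≤ 1 ∧ GreenR (x * m) y)
    (hL : ∃ m : Brauer n, m.1.rank ≤ 1 ∧ GreenL (m * x) y) : y = retr x := by
  obtain ⟨m, hm, hR⟩ := hR
  obtain ⟨m', hm', hL⟩ := hL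
  exact eq_of_greenH hy
    ⟨hR.symm.trans (greenR_retr hx hm).symm, hL.symm.trans (greenL_retr hx hm').symm⟩

theorem retr_mul {x y : Brauer n} (hx : x.1.rank ≤ 2) (hy : y.1.rank ≤ 2) :
    retr (x * y) = retr x * retr y := by
  symm
  refine eq_retr ((rank_mul_le_left x y).trans hx) (mul_rank_le_one_left (rank_retr x) _)
    ⟨lowElt n, rank_lowElt, ?_⟩ ⟨lowElt n, rank_lowElt, ?_⟩
  · rw [mul_assoc]
    exact (greenR_retr hx (mul_rank_le_one_right y rank_lowElt)).symm.trans
      (greenR_mul (rank_retr x) _)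
  · rw [← mul_assoc]
    exact (greenL_retr hy (mul_rank_le_one_left rank_lowElt x)).symm.trans
      (greenL_mul (rank_retr y) _)

theorem retr_star {x : Brauer n} (hx : x.1.rank ≤ 2) :
    retr (brauerStar x) = brauerStar (retr x) := by
  symm
  have h1 : (brauerStar (lowElt n)).1.rank ≤ 1 := by
    rw [rank_star]
    exact rank_lowElt
  refine eq_retr (by rwa [rank_star]) (by rw [rank_star]; exact rank_retr x)
    ⟨brauerStar (lowElt n), h1, ?_⟩ ⟨brauerStar (lowElt n), h1, ?_⟩
  · rw [← star_mul, greenR_star]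
    exact (greenL_retr hx rank_lowElt).symm
  · rw [← star_mul, greenL_star]
    exact (greenR_retr hx rank_lowElt).symm

/-- The elements of rank at most `1` form the minimal ideal also if this rank does not occur. -/
theorem rankIdeal_zero (hn : Even n) : rankIdeal n 0 = rankIdeal n 1 := by
  ext α
  have := rank_mod_two α
  have := Nat.even_iff.1 hn
  rw [mem_rankIdeal, mem_rankIdeal]
  omega

theorem rankIdeal_one_subset {r : ℕ} (hr : r ≡ n [MOD 2]) : rankIdeal n 1 ⊆ rankIdeal n r := by
  intro α hα
  have := rank_mod_two α
  have : r % 2 = n % 2 := hr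
  rw [mem_rankIdeal] at hα ⊢
  omega

theorem isRetraction_retr {r : ℕ} (hr : r ≤ 2) :
    IsRetraction (rankIdeal n r) (rankIdeal n 1) (retr (n := n)) :=
  ⟨fun x _ => rank_retr x,
    fun _ hx _ hy => retr_mul (le_trans hx hr) (le_trans hy hr),
    fun _ hx => retr_eq_self hx⟩

/-- Every retraction onto the minimal ideal has the form `x ↦ x m x`, for any `m`. -/
theorem IsRetraction.eq_mul_mul {I : Set (Brauer n)} {f : Brauer n → Brauer n}
    (h : IsRetraction I (rankIdeal n 1) f) (hI : rankIdeal n 1 ⊆ I) {x m : Brauer n} (hx : x ∈ I)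
    (hI' : IsIdeal I) (hm : m.1.rank ≤ 1) : f x = x * m * x := by
  obtain ⟨h1, h2, h3⟩ := h
  have e1 : f (x * m * x) = x * m * x :=
    h3 _ (mul_rank_le_one_left (mul_rank_le_one_right x hm) x)
  rw [h2 _ (hI'.2 x hx m |>.2) _ hx, h2 _ hx _ (hI hm), h3 m hm, mul_mul_eq_self (h1 x hx)] at e1
  exact e1

/-- An ideal that contains an element with three transversals is not retractable: these
transversals can be closed up in different ways. -/
theorem not_isRetraction {I : Set (Brauer n)} {f : Brauer n → Brauer n}
    (h : IsRetraction I (rankIdeal n 1) f) (hI : rankIdeal n 1 ⊆ I) (hI' : IsIdeal I)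
    {x : Brauer n} (hx : x ∈ I) : x.1.rank ≤ 2 := by
  by_contra h3
  rw [not_le, ← card_dom] at h3
  obtain ⟨a, ha, b, hb, y, hy, hab, hay, hby⟩ := Finset.two_lt_card.1 h3
  obtain ⟨a', ha'⟩ := mem_dom.1 ha
  obtain ⟨b', hb'⟩ := mem_dom.1 hb
  obtain ⟨y', hy'⟩ := mem_dom.1 hy
  have key : ∀ {i j i' j'}, i ≠ j → mate x (Sum.inl i) = Sum.inr i' →
      mate x (Sum.inl j) = Sum.inr j' → mate (f x) (Sum.inl i) = Sum.inl j := by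
    intro i j i' j' hij hi hj
    obtain ⟨m, hm, hm'⟩ := exists_upper (i := i') (j := j') (by
      rintro rfl
      rw [← hj] at hi
      exact hij (Sum.inl_injective (mate_injective x hi)))
    rw [h.eq_mul_mul hI hx hI' hm]
    exact mate_mul_upper x (mate_mul_upper_cross hm' hi hj)
  have h1 := key hab ha' hb'
  rw [key hay ha' hy'] at h1
  exact hby (Sum.inl_injective h1).symm

theorem pullbackRel_iff {r : ℕ} (hr : r ≤ 2) (hp : r ≡ n [MOD 2]) (hrn : r ≤ n)
    {K : Brauer n → Brauer n → Prop} {a b : Brauer n} :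
    pullbackRel (rankIdeal n r) K a b ↔
      a.1.rank ≤ r ∧ b.1.rank ≤ r ∧ K (retr a) (retr b) := by
  constructor
  · rintro ⟨ha, hb, M, f, hM, hf, hK⟩
    rw [(isMinimalIdeal_iff M).1 hM] at hf
    have hI := isIdeal_rankIdeal hrn hp
    rw [hf.eq_mul_mul (rankIdeal_one_subset hp) ha hI rank_lowElt,
      hf.eq_mul_mul (rankIdeal_one_subset hp) hb hI rank_lowElt] at hK
    exact ⟨ha, hb, hK⟩
  · rintro ⟨ha, hb, hK⟩
    exact ⟨ha, hb, _, _, (isMinimalIdeal_iff _).2 rfl, isRetraction_retr hr, hK⟩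

/-- The retraction closes up the two transversals of an element of rank `2`. -/
theorem coe_retr_eq_hat (hn : Even n) {α : Brauer n} (hα : α.1.rank ≤ 2) :
    (retr α).1 = α.1.hat := by
  have hn2 := Nat.even_iff.1 hn
  have hdom : ∀ β : Brauer n, β.1.rank ≤ 1 → ∀ i, i ∉ dom β := by
    intro β hβ i
    have := rank_mod_two β
    have : dom β = ∅ := by
      rw [← Finset.card_eq_zero, card_dom]
      omega
    simp [this]
  have hT : ∀ x, α.1.OnTransversal x ↔ x.isLeft ≠ (mate α x).isLeft := by
    intro x
    have hx : ∀ z, α.1.Rel x z ↔ z = x ∨ z = mate α x := fun z => rel_iff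
    simp only [Diagram.OnTransversal, hx]
    rcases x with i | i
    · rcases mate α (Sum.inl i) with j | j <;> simp
    · rcases mate α (Sum.inr i) with j | j <;> simp
  -- `retr β` has no transversals and keeps the upper blocks of `β`
  have key : ∀ {β : Brauer n} {i : Fin n}, β.1.rank ≤ 2 →
      (∃ j, mate (retr β) (Sum.inl i) = Sum.inl j) ∧ ∀ j, mate β (Sum.inl i) = Sum.inl j →
        mate (retr β) (Sum.inl i) = Sum.inl j := by
    intro β i _
    refine ⟨notMem_dom.1 (hdom _ (rank_retr β) i), fun j hj => ?_⟩
    rw [retr, mul_assoc]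
    exact mate_mul_upper _ hj
  have hleft : ∀ x, (mate (retr α) x).isLeft = x.isLeft ∧
      ((mate α x).isLeft = x.isLeft → mate (retr α) x = mate α x) := by
    rintro (i | i)
    · obtain ⟨⟨j, hj⟩, h⟩ := key (i := i) hα
      refine ⟨by rw [hj]; rfl, ?_⟩
      rcases hi : mate α (Sum.inl i) with k | k
      · exact fun _ => h k hi
      · simp
    · obtain ⟨⟨j, hj⟩, h⟩ := key (β := brauerStar α) (i := i) (by rwa [rank_star])
      rw [retr_star hα, mate_star, Sum.swap_inl] at hj h
      have hj' : mate (retr α) (Sum.inr i) = Sum.inr j := Sum.swap_leftInverse.injective hj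
      refine ⟨by rw [hj']; rfl, ?_⟩
      rcases hi : mate α (Sum.inr i) with k | k
      · simp
      · intro _
        have := h k (by rw [hi]; rfl)
        rw [mate_star, Sum.swap_inl] at this
        exact Sum.swap_leftInverse.injective this
  have h1 : ∀ x, α.1.hat.Rel x (mate (retr α) x) := by
    intro x
    refine ⟨(hleft x).1.symm, ?_⟩
    by_cases h : (mate α x).isLeft = x.isLeft
    · rw [(hleft x).2 h]
      exact Or.inl (rel_mate α x)
    · refine Or.inr ⟨(hT x).2 (Ne.symm h), (hT _).2 fun h' => h ?_⟩
      have h2 := (hleft (mate (retr α) x)).2 h'.symm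
      rw [mate_mate] at h2
      have h3 := mate_comm h2.symm
      rw [h3]
      exact (hleft x).1
  -- there are at most two ends of transversals in each row
  have h2 : ∀ {β : Brauer n}, β.1.rank ≤ 2 → ∀ i j k, i ∈ dom β → j ∈ dom β → k ∈ dom β →
      i ≠ j → i ≠ k → j = k := by
    intro β hβ i j k hi hj hk hij hik
    by_contra hjk
    have : 2 < (dom β).card := Finset.two_lt_card.2 ⟨i, hi, j, hj, k, hk, hij, hik, hjk⟩
    rw [card_dom] at this
    omega
  apply Diagram.rel_ext
  intro x y
  constructor
  · intro h
    rcases rel_iff.1 h with rfl | rfl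
    · exact Diagram.rel_refl _ _
    · exact h1 x
  · rintro ⟨hxy, h | ⟨hx, hy⟩⟩
    · rcases rel_iff.1 h with rfl | rfl
      · exact Diagram.rel_refl _ _
      · exact rel_iff.2 (Or.inr ((hleft x).2 hxy.symm).symm)
    · by_cases hne : y = x
      · rw [hne]
        exact Diagram.rel_refl _ _
      refine rel_iff.2 (Or.inr ?_)
      have hz : α.1.OnTransversal (mate (retr α) x) := by
        rcases (h1 x).2 with h | h
        · exact hx.of_rel h
        · exact h.2
      have hz1 := (hleft x).1
      have hz2 := mate_ne (retr α) x
      generalize mate (retr α) x = z at hz hz1 hz2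
      rw [hT] at hx hy hz
      have hd : ∀ {β : Brauer n} {i}, (mate β (Sum.inl i)).isLeft = false → i ∈ dom β := by
        intro β i h
        rcases hm : mate β (Sum.inl i) with j | j
        · simp [hm] at h
        · exact mem_dom.2 ⟨j, hm⟩
      have hd' : ∀ {i}, (mate α (Sum.inr i)).isLeft = true → i ∈ dom (brauerStar α) := by
        intro i h
        apply hd
        rw [mate_star, Sum.swap_inl]
        rcases hm : mate α (Sum.inr i) with j | j
        · rfl
        · simp [hm] at h
      rcases x with i | i <;> rcases y with j | j <;> rcases z with k | k <;>
        simp at hxy hz1 hx hy hz hne hz2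
      · rw [h2 hα i j k (hd (by simpa using hx)) (hd (by simpa using hy)) (hd (by simpa using hz)) (Ne.symm hne)
          (Ne.symm hz2)]
      · rw [h2 (β := brauerStar α) (by rwa [rank_star]) i j k (hd' (by simpa using hx)) (hd' (by simpa using hy))
          (hd' (by simpa using hz)) (Ne.symm hne) (Ne.symm hz2)]

end Retraction

/-! ### The action of the distinguished subgroups on the minimal ideal -/

section Action

variable {n q : ℕ}

/-- All elements of `N` act in the same way on the minimal ideal. -/
def ActsAlike (N : Set (Brauer n)) : Prop :=
  ∀ x : Brauer n, x.1.rank ≤ 1 → ∀ u ∈ N, ∀ v ∈ N, x * u = x * v ∧ u * x = v * x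

variable (hq : q ≤ n) (hp : q ≡ n [MOD 2])

theorem actsAlike_barSubgroup_iff {N : Subgroup (Equiv.Perm (Fin q))} :
    ActsAlike (barSubgroup n N) ↔
      ∀ σ ∈ N, ∀ m : Brauer n, m.1.rank ≤ 1 → m * barB hq hp σ = m * barB hq hp 1 := by
  constructor
  · intro h σ hσ m hm
    exact (h m hm _ ((barB_mem_barSubgroup hq hp).2 hσ) _
      ((barB_mem_barSubgroup hq hp).2 N.one_mem)).1
  · intro h x hx u hu v hv
    obtain ⟨σ, hσ, rfl⟩ := (mem_barSubgroup hq hp).1 hu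
    obtain ⟨τ, hτ, rfl⟩ := (mem_barSubgroup hq hp).1 hv
    have key : ∀ σ ∈ N, barB hq hp σ * x = barB hq hp 1 * x := by
      intro σ hσ
      have := h σ⁻¹ (N.inv_mem hσ) (brauerStar x) (by rwa [rank_star])
      have := congrArg brauerStar this
      simpa [star_barB] using this
    exact ⟨(h σ hσ x hx).trans (h τ hτ x hx).symm, (key σ hσ).trans (key τ hτ).symm⟩

/-- If `σ` acts trivially, then it maps every pair of letters to itself or to a disjoint pair. -/
theorem pairs_of_acts {σ : Equiv.Perm (Fin q)}
    (h : ∀ m : Brauer n, m.1.rank ≤ 1 → m * barB hq hp σ = m * barB hq hp 1) :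
    ∀ a b, a ≠ b → (σ a = a → σ b = b) ∧ (σ a = b → σ b = a) := by
  intro a b hab
  have hab' : Fin.castLE hq a ≠ Fin.castLE hq b := fun h => hab (Fin.castLE_injective hq h)
  obtain ⟨m, hm, hm'⟩ := exists_lower hab'
  have h1 := mate_mul_lower_cross hm' (mate_barB_inl hq hp σ a) (mate_barB_inl hq hp σ b)
  have h2 := mate_mul_lower_cross hm' (mate_barB_inl hq hp 1 a) (mate_barB_inl hq hp 1 b)
  rw [h m hm] at h1
  constructor
  · intro e
    rw [e] at h1
    rw [Equiv.Perm.one_apply, Equiv.Perm.one_apply, h1] at h2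
    exact Fin.castLE_injective hq (Sum.inr_injective h2)
  · intro e
    rw [e] at h1
    rw [Equiv.Perm.one_apply, Equiv.Perm.one_apply] at h2
    rw [mate_comm h2] at h1
    exact (Fin.castLE_injective hq (Sum.inr_injective h1)).symm

/-- A permutation acts trivially if it maps the lower blocks of the elements of the minimal ideal
to lower blocks. -/
theorem mul_barB_of_blocks {σ : Equiv.Perm (Fin q)} {y : Brauer n} (hy : y.1.rank ≤ 1)
    (hy1 : y * barB hq hp 1 = y)
    (h : ∀ a b : Fin q, mate y (Sum.inr (Fin.castLE hq a)) = Sum.inr (Fin.castLE hq b) →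
      mate y (Sum.inr (Fin.castLE hq (σ⁻¹ a))) = Sum.inr (Fin.castLE hq (σ⁻¹ b))) :
    y * barB hq hp σ = y := by
  have hr := mul_rank_le_one_left hy (barB hq hp σ)
  have htail : ∀ {i : Fin n} (hi : q ≤ i.val), mate y (Sum.inr i) = Sum.inr (tailMate hp i hi) := by
    intro i hi
    have := mate_mul_lower y (mate_barB_inr_of_le hq hp 1 hi)
    rwa [hy1] at this
  refine eq_of_greenH hr ⟨(greenR_mul hy _).symm, ?_⟩
  rw [← greenR_star]
  refine (greenR_of_upper ?_ ?_).symm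
  · intro i j hij
    have hij' : mate y (Sum.inr i) = Sum.inr j := by
      rw [mate_star] at hij
      exact Sum.swap_leftInverse.injective hij
    have : mate (y * barB hq hp σ) (Sum.inr i) = Sum.inr j := by
      rcases exists_castLE_or_le hq i with ⟨a, rfl⟩ | hi
      · rcases exists_castLE_or_le hq j with ⟨b, rfl⟩ | hj
        · have h1 := mate_mul_lower_cross (h a b hij') (mate_barB_inl hq hp σ _)
            (mate_barB_inl hq hp σ _)
          simpa using h1
        · have h1 := mate_comm hij'
          rw [htail hj] at h1
          have h2 := le_tailMate hp j hj
          rw [Sum.inr_injective h1] at h2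
          exact absurd a.2 (not_lt.2 h2)
      · rw [mate_mul_lower y (mate_barB_inr_of_le hq hp σ hi), ← htail hi, hij']
    rw [mate_star, Sum.swap_inl, this]
    rfl
  · rw [rank_star, rank_star]
    exact (rank_eq_of_le_one hy hr).le

theorem mul_barB_eq_of_blocks {σ : Equiv.Perm (Fin q)}
    (h : ∀ y : Brauer n, y.1.rank ≤ 1 → y * barB hq hp 1 = y → ∀ a b : Fin q,
      mate y (Sum.inr (Fin.castLE hq a)) = Sum.inr (Fin.castLE hq b) →
      mate y (Sum.inr (Fin.castLE hq (σ⁻¹ a))) = Sum.inr (Fin.castLE hq (σ⁻¹ b)))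
    (m : Brauer n) (hm : m.1.rank ≤ 1) : m * barB hq hp σ = m * barB hq hp 1 := by
  have hr := mul_rank_le_one_left hm (barB hq hp 1)
  have h1 : m * barB hq hp 1 * barB hq hp 1 = m * barB hq hp 1 := by
    rw [mul_assoc, barB_mul_one]
  have h2 := mul_barB_of_blocks hq hp hr h1 (h _ hr h1)
  rwa [mul_assoc, barB_one_mul] at h2

end Action

section SmallActions

variable {n : ℕ}

theorem actsAlike_two (hq : 2 ≤ n) (hp : 2 ≡ n [MOD 2]) (N : Subgroup (Equiv.Perm (Fin 2))) :
    ActsAlike (barSubgroup n N) := by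
  rw [actsAlike_barSubgroup_iff hq hp]
  intro σ _
  refine mul_barB_eq_of_blocks hq hp fun y _ _ a b hab => ?_
  have hne : a ≠ b := by
    rintro rfl
    exact mate_ne _ _ hab
  have key : ∀ τ : Equiv.Perm (Fin 2), ∀ a b, a ≠ b → (τ a = a ∧ τ b = b) ∨ (τ a = b ∧ τ b = a) := by
    decide
  rcases key σ⁻¹ a b hne with ⟨h1, h2⟩ | ⟨h1, h2⟩
  · rw [h1, h2, hab]
  · rw [h1, h2, mate_comm hab]

theorem actsAlike_bot {q : ℕ} (hq : q ≤ n) (hp : q ≡ n [MOD 2]) :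
    ActsAlike (barSubgroup n (⊥ : Subgroup (Equiv.Perm (Fin q)))) := by
  rw [actsAlike_barSubgroup_iff hq hp]
  intro σ hσ m _
  rw [Subgroup.mem_bot.1 hσ]

theorem eq_one_of_actsAlike_three (hq : 3 ≤ n) (hp : 3 ≡ n [MOD 2])
    {N : Subgroup (Equiv.Perm (Fin 3))} (h : ActsAlike (barSubgroup n N)) : N = ⊥ := by
  rw [actsAlike_barSubgroup_iff hq hp] at h
  rw [Subgroup.eq_bot_iff_forall]
  intro σ hσ
  have key : ∀ σ : Equiv.Perm (Fin 3),
      (∀ a b, a ≠ b → (σ a = a → σ b = b) ∧ (σ a = b → σ b = a)) → σ = 1 := by decide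
  exact key σ (pairs_of_acts hq hp (h σ hσ))

theorem mem_klein_iff (σ : Equiv.Perm (Fin 4)) : σ ∈ klein ↔ σ = 1 ∨
    σ = Equiv.swap 0 1 * Equiv.swap 2 3 ∨ σ = Equiv.swap 0 2 * Equiv.swap 1 3 ∨
    σ = Equiv.swap 0 3 * Equiv.swap 1 2 := Iff.rfl

set_option maxRecDepth 4000 in
theorem mem_klein_of_acts (hq : 4 ≤ n) (hp : 4 ≡ n [MOD 2]) {σ : Equiv.Perm (Fin 4)}
    (h : ∀ m : Brauer n, m.1.rank ≤ 1 → m * barB hq hp σ = m * barB hq hp 1) : σ ∈ klein := by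
  have key : ∀ σ : Equiv.Perm (Fin 4),
      (∀ a b, a ≠ b → (σ a = a → σ b = b) ∧ (σ a = b → σ b = a)) →
        σ = 1 ∨ σ = Equiv.swap 0 1 * Equiv.swap 2 3 ∨ σ = Equiv.swap 0 2 * Equiv.swap 1 3 ∨
          σ = Equiv.swap 0 3 * Equiv.swap 1 2 := by decide
  exact key σ (pairs_of_acts hq hp h)

theorem actsAlike_of_le_klein (hq : 4 ≤ n) (hp : 4 ≡ n [MOD 2])
    {N : Subgroup (Equiv.Perm (Fin 4))} (h : N ≤ klein) : ActsAlike (barSubgroup n N) := by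
  rw [actsAlike_barSubgroup_iff hq hp]
  intro σ hσ
  refine mul_barB_eq_of_blocks hq hp fun y hy hy1 a b hab => ?_
  have hne : a ≠ b := by
    rintro rfl
    exact mate_ne _ _ hab
  have h1 : ∀ σ : Equiv.Perm (Fin 4), (σ = 1 ∨ σ = Equiv.swap 0 1 * Equiv.swap 2 3 ∨
      σ = Equiv.swap 0 2 * Equiv.swap 1 3 ∨ σ = Equiv.swap 0 3 * Equiv.swap 1 2) → ∀ a b, a ≠ b →
      (σ a = a ∧ σ b = b) ∨ (σ a = b ∧ σ b = a) ∨
        (σ a ≠ a ∧ σ a ≠ b ∧ σ b ≠ a ∧ σ b ≠ b) := by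
    rintro _ (rfl | rfl | rfl | rfl) <;> decide
  have h2 : ∀ a b c d e : Fin 4, a ≠ b → c ≠ a → c ≠ b → d ≠ a → d ≠ b → c ≠ d → e ≠ a → e ≠ b →
      e ≠ c → e = d := by decide
  rcases h1 σ⁻¹ (klein.inv_mem (h hσ)) a b hne with ⟨h3, h4⟩ | ⟨h3, h4⟩ | ⟨h3, h4, h5, h6⟩
  · rw [h3, h4, hab]
  · rw [h3, h4, mate_comm hab]
  · -- the two letters outside `{a, b}` are joined because there are no transversals
    have hinj : Function.Injective (fun i : Fin 4 => (Sum.inr (Fin.castLE hq i) : Vertex n)) :=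
      fun i j h => Fin.castLE_injective hq (Sum.inr_injective h)
    have hr : y.1.rank = 0 := by
      have e1 := rank_mod_two y
      have e2 : 4 % 2 = n % 2 := hp
      omega
    rcases hm : mate y (Sum.inr (Fin.castLE hq (σ⁻¹ a))) with k | k
    · have := Finset.card_pos.2 ⟨k, mem_dom.2 ⟨_, mate_comm hm⟩⟩
      rw [card_dom] at this
      omega
    · rcases exists_castLE_or_le hq k with ⟨e, rfl⟩ | hk
      · rw [h2 a b (σ⁻¹ a) (σ⁻¹ b) e hne h3 h4 h5 h6 (fun h => hne (σ⁻¹.injective h))]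
        · rintro rfl
          rw [mate_comm hm] at hab
          exact h4 (hinj hab)
        · rintro rfl
          have := mate_comm hab
          rw [mate_comm hm] at this
          exact h3 (hinj this)
        · rintro rfl
          exact mate_ne _ _ hm
      · have e1 := mate_mul_lower y (mate_barB_inr_of_le hq hp 1 hk)
        rw [hy1, mate_comm hm] at e1
        have e2 := le_tailMate hp k hk
        rw [← Sum.inr_injective e1] at e2
        exact absurd (σ⁻¹ a).2 (not_lt.2 e2)

theorem actsAlike_four_iff (hq : 4 ≤ n) (hp : 4 ≡ n [MOD 2])
    {N : Subgroup (Equiv.Perm (Fin 4))} : ActsAlike (barSubgroup n N) ↔ N ≤ klein :=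
  ⟨fun h σ hσ => mem_klein_of_acts hq hp ((actsAlike_barSubgroup_iff hq hp).1 h σ hσ),
    actsAlike_of_le_klein hq hp⟩

/-- Elements of a distinguished subgroup that a congruence identifies, but which act differently
on the minimal ideal, collapse the minimal ideal. -/
theorem full_of_acts_ne {q : ℕ} (hq : q ≤ n) (hp : q ≡ n [MOD 2]) {c : Con (Brauer n)}
    {σ : Equiv.Perm (Fin q)} (h : c (barB hq hp 1) (barB hq hp σ)) {m : Brauer n}
    (hm : m.1.rank ≤ 1) (hne : m * barB hq hp σ ≠ m * barB hq hp 1) : Full c := by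
  have key : ∀ c : Con (Brauer n), c (barB hq hp 1) (barB hq hp σ) → LowFull c := by
    intro c h
    refine lowFull_of_not_greenL (mul_rank_le_one_left hm _) (mul_rank_le_one_left hm _)
      (c.mul (c.refl m) h) fun hL => hne ?_
    exact (eq_of_greenH (mul_rank_le_one_left hm _)
      ⟨(greenR_mul hm _).symm.trans (greenR_mul hm _), hL⟩).symm
  refine full_iff.2 ⟨key c h, lowFull_starCon.1 (key _ ?_)⟩
  rw [starCon_iff, star_barB, star_barB, inv_one]
  exact (conSubgroup hq hp c).inv_mem h

end SmallActions

/-! ### Normal subgroups of symmetric groups -/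

section NormalSubgroups

theorem eq_or_eq_top_of_alternatingGroup_le {q : ℕ} {N : Subgroup (Equiv.Perm (Fin q))}
    (h : alternatingGroup (Fin q) ≤ N) : N = alternatingGroup (Fin q) ∨ N = ⊤ := by
  by_cases h' : N ≤ alternatingGroup (Fin q)
  · exact Or.inl (le_antisymm h' h)
  · right
    obtain ⟨σ, hσ, hodd⟩ := SetLike.not_le_iff_exists.1 h'
    rw [eq_top_iff]
    intro τ _
    by_cases hτ : τ ∈ alternatingGroup (Fin q)
    · exact h hτ
    · rw [Equiv.Perm.mem_alternatingGroup] at hodd hτ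
      have h1 := (Int.units_eq_one_or (Equiv.Perm.sign σ)).resolve_left hodd
      have h2 := (Int.units_eq_one_or (Equiv.Perm.sign τ)).resolve_left hτ
      have h3 : τ * σ⁻¹ ∈ alternatingGroup (Fin q) := by
        rw [Equiv.Perm.mem_alternatingGroup, Equiv.Perm.sign_mul, Equiv.Perm.sign_inv, h1, h2]
        rfl
      have := N.mul_mem (h h3) hσ
      rwa [inv_mul_cancel_right] at this

theorem conj_mul_conj_mem {G : Type*} [Group G] {N : Subgroup G} (hN : N.Normal) {σ : G}
    (hσ : σ ∈ N) (g h : G) : g * σ * g⁻¹ * (h * σ * h⁻¹) ∈ N :=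
  N.mul_mem (hN.conj_mem σ hσ g) (hN.conj_mem σ hσ h)

theorem alternatingGroup_le_of_isThreeCycle {q : ℕ} {N : Subgroup (Equiv.Perm (Fin q))}
    (hN : N.Normal) {τ : Equiv.Perm (Fin q)} (hτ : τ.IsThreeCycle) (h : τ ∈ N) :
    alternatingGroup (Fin q) ≤ N := by
  rw [← Equiv.Perm.closure_three_cycles_eq_alternating, Subgroup.closure_le]
  intro ρ hρ
  obtain ⟨g, rfl⟩ := isConj_iff.1 (Equiv.Perm.isConj_iff_cycleType_eq.2
    (show τ.cycleType = ρ.cycleType by rw [hτ.cycleType, (show ρ.IsThreeCycle from hρ).cycleType]))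
  exact hN.conj_mem τ h g

theorem isThreeCycle_swap_mul_swap {α : Type*} [Fintype α] [DecidableEq α] {a b c : α}
    (hab : a ≠ b) (hac : a ≠ c) (hbc : b ≠ c) :
    (Equiv.swap a b * Equiv.swap a c).IsThreeCycle :=
  Equiv.Perm.isThreeCycle_swap_mul_swap_same hab hac hbc

set_option maxRecDepth 100000 in
theorem alternatingGroup_le_three {N : Subgroup (Equiv.Perm (Fin 3))} (hN : N.Normal)
    (h : N ≠ ⊥) : alternatingGroup (Fin 3) ≤ N := by
  obtain ⟨⟨σ, hσ⟩, h1⟩ := Subgroup.ne_bot_iff_exists_ne_one.1 h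
  have key : ∀ σ : Equiv.Perm (Fin 3), σ ≠ 1 → ∃ g h : Equiv.Perm (Fin 3),
      g * σ * g⁻¹ * (h * σ * h⁻¹) = Equiv.swap 0 1 * Equiv.swap 0 2 := by decide
  obtain ⟨g, k, hgk⟩ := key σ fun e => h1 (Subtype.ext e)
  refine alternatingGroup_le_of_isThreeCycle hN
    (isThreeCycle_swap_mul_swap (a := 0) (b := 1) (c := 2) (by decide) (by decide) (by decide)) ?_
  rw [← hgk]
  exact conj_mul_conj_mem hN hσ g k

theorem klein_le_alternatingGroup : klein ≤ alternatingGroup (Fin 4) := by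
  rintro σ (rfl | rfl | rfl | rfl) <;> rw [Equiv.Perm.mem_alternatingGroup] <;> decide

theorem klein_ne_alternatingGroup : klein ≠ alternatingGroup (Fin 4) := by
  intro h
  have h1 : Equiv.swap 0 1 * Equiv.swap 0 2 ∈ klein := by
    rw [h, Equiv.Perm.mem_alternatingGroup]
    decide
  rw [mem_klein_iff] at h1
  revert h1
  decide

theorem klein_normal : klein.Normal := by
  constructor
  intro σ hσ g
  have key : ∀ g : Equiv.Perm (Fin 4), ∀ σ ∈ [1, Equiv.swap 0 1 * Equiv.swap 2 3,
      Equiv.swap 0 2 * Equiv.swap 1 3, Equiv.swap 0 3 * Equiv.swap 1 2],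
      g * σ * g⁻¹ ∈ [1, Equiv.swap 0 1 * Equiv.swap 2 3,
        Equiv.swap 0 2 * Equiv.swap 1 3, Equiv.swap 0 3 * Equiv.swap 1 2] := by decide
  have := key g σ (by simpa [mem_klein_iff] using hσ)
  simpa [mem_klein_iff] using this

theorem klein_ne_bot : klein ≠ ⊥ := by
  intro h
  have h1 : Equiv.swap 0 1 * Equiv.swap 2 3 ∈ klein := Or.inr (Or.inl rfl)
  rw [h, Subgroup.mem_bot] at h1
  revert h1
  decide

/-- The conjugates of a double transposition exhaust the Klein four-group. -/
theorem klein_le_of_mem {N : Subgroup (Equiv.Perm (Fin 4))} (hN : N.Normal)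
    {σ : Equiv.Perm (Fin 4)} (hσ : σ ∈ N) (h1 : σ ≠ 1) (hK : σ ∈ klein) : klein ≤ N := by
  have key : ∀ σ ∈ [Equiv.swap 0 1 * Equiv.swap 2 3,
      Equiv.swap 0 2 * Equiv.swap 1 3, Equiv.swap 0 3 * Equiv.swap 1 2],
      ∀ τ ∈ [Equiv.swap 0 1 * Equiv.swap 2 3,
      Equiv.swap 0 2 * Equiv.swap 1 3, Equiv.swap 0 3 * Equiv.swap 1 2],
      ∃ g : Equiv.Perm (Fin 4), g * σ * g⁻¹ = τ := by decide
  intro τ hτ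
  by_cases hτ1 : τ = 1
  · rw [hτ1]
    exact N.one_mem
  obtain ⟨g, rfl⟩ := key σ (by simpa [mem_klein_iff, h1] using hK) τ
    (by simpa [mem_klein_iff, hτ1] using hτ)
  exact hN.conj_mem σ hσ g

set_option maxRecDepth 100000 in
theorem eq_klein_or_of_normal {N : Subgroup (Equiv.Perm (Fin 4))} (hN : N.Normal) (h : N ≠ ⊥) :
    N = klein ∨ alternatingGroup (Fin 4) ≤ N := by
  by_cases hK : N ≤ klein
  · left
    obtain ⟨⟨σ, hσ⟩, h1⟩ := Subgroup.ne_bot_iff_exists_ne_one.1 h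
    exact le_antisymm hK (klein_le_of_mem hN hσ (fun e => h1 (Subtype.ext e)) (hK hσ))
  · right
    obtain ⟨σ, hσ, hσK⟩ := SetLike.not_le_iff_exists.1 hK
    rw [mem_klein_iff] at hσK
    have key : ∀ σ : Equiv.Perm (Fin 4), ¬ (σ = 1 ∨ σ = Equiv.swap 0 1 * Equiv.swap 2 3 ∨
        σ = Equiv.swap 0 2 * Equiv.swap 1 3 ∨ σ = Equiv.swap 0 3 * Equiv.swap 1 2) →
        ∃ g h : Equiv.Perm (Fin 4),
          g * σ * g⁻¹ * (h * σ * h⁻¹) = Equiv.swap 0 1 * Equiv.swap 0 2 := by decide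
    obtain ⟨g, k, hgk⟩ := key σ hσK
    refine alternatingGroup_le_of_isThreeCycle hN
      (isThreeCycle_swap_mul_swap (a := 0) (b := 1) (c := 2) (by decide) (by decide) (by decide)) ?_
    rw [← hgk]
    exact conj_mul_conj_mem hN hσ g k

theorem alternatingGroup_two : alternatingGroup (Fin 2) = ⊥ := by
  rw [Subgroup.eq_bot_iff_forall]
  intro σ hσ
  rw [Equiv.Perm.mem_alternatingGroup] at hσ
  revert σ
  decide

/-- The normal subgroups of the symmetric group of degree `q ≥ 2`. -/
theorem normal_cases {q : ℕ} (hq : 2 ≤ q) {N : Subgroup (Equiv.Perm (Fin q))} (hN : N.Normal) :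
    N = ⊥ ∨ N = alternatingGroup (Fin q) ∨ N = ⊤ ∨ ∃ h : 4 = q, N = h ▸ klein := by
  by_cases hbot : N = ⊥
  · exact Or.inl hbot
  right
  by_cases h4 : 4 = q
  · subst h4
    rcases eq_klein_or_of_normal hN hbot with h | h
    · exact Or.inr (Or.inr ⟨rfl, h⟩)
    · rcases eq_or_eq_top_of_alternatingGroup_le h with h | h
      · exact Or.inl h
      · exact Or.inr (Or.inl h)
  · have h : alternatingGroup (Fin q) ≤ N := by
      by_cases h5 : 5 ≤ q
      · have : N.Normal := hN
        exact Equiv.Perm.alternatingGroup_le_of_normal (by simpa using h5)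
          ((Subgroup.nontrivial_iff_ne_bot N).2 hbot)
      · obtain rfl | rfl : q = 2 ∨ q = 3 := by omega
        · rw [alternatingGroup_two]
          exact bot_le
        · exact alternatingGroup_le_three hN hbot
    rcases eq_or_eq_top_of_alternatingGroup_le h with h | h
    · exact Or.inl h
    · exact Or.inr (Or.inl h)

theorem alternatingGroup_ne_top {q : ℕ} (hq : 2 ≤ q) : alternatingGroup (Fin q) ≠ ⊤ := by
  intro h
  have h1 : Equiv.swap (⟨0, by omega⟩ : Fin q) ⟨1, by omega⟩ ∈ alternatingGroup (Fin q) := by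
    rw [h]
    exact Subgroup.mem_top _
  rw [Equiv.Perm.mem_alternatingGroup, Equiv.Perm.sign_swap (by simp)] at h1
  revert h1
  decide

theorem alternatingGroup_ne_bot {q : ℕ} (hq : 3 ≤ q) : alternatingGroup (Fin q) ≠ ⊥ := by
  intro h
  have h1 := isThreeCycle_swap_mul_swap (a := (⟨0, by omega⟩ : Fin q)) (b := ⟨1, by omega⟩)
    (c := ⟨2, by omega⟩) (by simp) (by simp) (by simp)
  have h2 := h1.mem_alternatingGroup
  rw [h, Subgroup.mem_bot] at h2
  have h3 := h1.orderOf
  rw [h2, orderOf_one] at h3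
  omega

theorem top_ne_bot_perm {q : ℕ} (hq : 2 ≤ q) : (⊤ : Subgroup (Equiv.Perm (Fin q))) ≠ ⊥ := by
  intro h
  exact alternatingGroup_ne_top hq (top_le_iff.1 (h ▸ bot_le))

open Classical in
/-- The position of a normal subgroup in the chain `1 < K < A_q < S_q`, where `K` occurs for `q = 4`
only. -/
noncomputable def normalIndex {q : ℕ} (N : Subgroup (Equiv.Perm (Fin q))) : ℕ :=
  if N = ⊥ then 0 else if N = ⊤ then 3 else if N = alternatingGroup (Fin q) then 2 else 1

@[simp] theorem normalIndex_bot {q : ℕ} :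
    normalIndex (⊥ : Subgroup (Equiv.Perm (Fin q))) = 0 := by simp [normalIndex]

theorem normalIndex_top {q : ℕ} (hq : 2 ≤ q) :
    normalIndex (⊤ : Subgroup (Equiv.Perm (Fin q))) = 3 := by
  simp [normalIndex, top_ne_bot_perm hq]

theorem normalIndex_alternatingGroup {q : ℕ} (hq : 3 ≤ q) :
    normalIndex (alternatingGroup (Fin q)) = 2 := by
  simp [normalIndex, alternatingGroup_ne_bot hq, alternatingGroup_ne_top (by omega : 2 ≤ q)]

theorem normalIndex_klein : normalIndex klein = 1 := by
  have : klein ≠ ⊤ := by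
    intro h
    have h1 := klein_le_alternatingGroup
    rw [h, top_le_iff] at h1
    exact alternatingGroup_ne_top (by omega) h1
  simp [normalIndex, klein_ne_bot, klein_ne_alternatingGroup, this]

theorem normalIndex_le {q : ℕ} (N : Subgroup (Equiv.Perm (Fin q))) : normalIndex N ≤ 3 := by
  rw [normalIndex]
  split_ifs <;> omega

theorem normalIndex_pos {q : ℕ} {N : Subgroup (Equiv.Perm (Fin q))} (h : N ≠ ⊥) :
    0 < normalIndex N := by
  rw [normalIndex, if_neg h]
  split_ifs <;> omega

theorem eq_klein_of_normalIndex {q : ℕ} (hq : 2 ≤ q) {N : Subgroup (Equiv.Perm (Fin q))}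
    (hN : N.Normal) (h : normalIndex N = 1) : ∃ h : 4 = q, N = h ▸ klein := by
  rcases normal_cases hq hN with rfl | rfl | rfl | h'
  · simp at h
  · exfalso
    rw [normalIndex] at h
    split_ifs at h <;> simp_all
  · rw [normalIndex_top hq] at h
    omega
  · exact h'

theorem eq_alternatingGroup_of_normalIndex {q : ℕ} {N : Subgroup (Equiv.Perm (Fin q))}
    (h : normalIndex N = 2) : N = alternatingGroup (Fin q) ∧ N ≠ ⊥ := by
  rw [normalIndex] at h
  split_ifs at h with h1 h2 h3 <;> first | omega | exact ⟨h3, h1⟩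

theorem eq_top_of_normalIndex {q : ℕ} {N : Subgroup (Equiv.Perm (Fin q))}
    (h : normalIndex N = 3) : N = ⊤ := by
  rw [normalIndex] at h
  split_ifs at h with h1 h2 h3
  · exact h2
  · omega
  · omega

theorem eq_bot_of_normalIndex {q : ℕ} {N : Subgroup (Equiv.Perm (Fin q))}
    (h : normalIndex N = 0) : N = ⊥ := by
  by_contra h'
  have := normalIndex_pos h'
  omega

/-- The normal subgroups of a symmetric group form a chain. -/
theorem le_iff_normalIndex {q : ℕ} (hq : 2 ≤ q) {N N' : Subgroup (Equiv.Perm (Fin q))}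
    (hN : N.Normal) (hN' : N'.Normal) : N ≤ N' ↔ normalIndex N ≤ normalIndex N' := by
  have key : ∀ {N N' : Subgroup (Equiv.Perm (Fin q))}, N.Normal → N'.Normal →
      normalIndex N ≤ normalIndex N' → N ≤ N' := by
    intro N N' hN hN' h
    have h3 := normalIndex_le N'
    obtain h' | h' | h' | h' : normalIndex N' = 0 ∨ normalIndex N' = 1 ∨ normalIndex N' = 2 ∨
      normalIndex N' = 3 := by omega
    · rw [eq_bot_of_normalIndex (N := N) (by omega)]
      exact bot_le
    · obtain h0 | h0 : normalIndex N = 0 ∨ normalIndex N = 1 := by omega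
      · rw [eq_bot_of_normalIndex h0]
        exact bot_le
      · obtain ⟨h4, rfl⟩ := eq_klein_of_normalIndex hq hN h0
        obtain ⟨_, rfl⟩ := eq_klein_of_normalIndex hq hN' h'
        exact le_rfl
    · rw [(eq_alternatingGroup_of_normalIndex h').1]
      obtain h0 | h0 | h0 : normalIndex N = 0 ∨ normalIndex N = 1 ∨ normalIndex N = 2 := by omega
      · rw [eq_bot_of_normalIndex h0]
        exact bot_le
      · obtain ⟨h4, rfl⟩ := eq_klein_of_normalIndex hq hN h0
        subst h4
        exact klein_le_alternatingGroup
      · rw [(eq_alternatingGroup_of_normalIndex h0).1]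
    · rw [eq_top_of_normalIndex h']
      exact le_top
  refine ⟨fun h => ?_, key hN hN'⟩
  by_contra h'
  have h1 := le_antisymm h (key hN' hN (by omega))
  rw [h1] at h'
  exact h' le_rfl

end NormalSubgroups

/-! ### A common form of the congruences -/

section LatRel

variable {n : ℕ}

/-- The four relations `H`, `L`, `R` and the universal relation on the minimal ideal, encoded by a
pair of truth values: the first one drops the condition `R`, the second one the condition `L`. -/
def SideRel (s : Bool × Bool) (a b : Brauer n) : Prop :=
  (s.1 = false → GreenR a b) ∧ (s.2 = false → GreenL a b)

theorem SideRel.refl (s : Bool × Bool) (a : Brauer n) : SideRel s a a :=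
  ⟨fun _ => .refl _, fun _ => .refl _⟩

theorem SideRel.symm {s : Bool × Bool} {a b : Brauer n} (h : SideRel s a b) : SideRel s b a :=
  ⟨fun hs => (h.1 hs).symm, fun hs => (h.2 hs).symm⟩

theorem SideRel.trans {s : Bool × Bool} {a b c : Brauer n} (h : SideRel s a b)
    (h' : SideRel s b c) : SideRel s a c :=
  ⟨fun hs => (h.1 hs).trans (h'.1 hs), fun hs => (h.2 hs).trans (h'.2 hs)⟩

theorem SideRel.star {s : Bool × Bool} {a b : Brauer n} (h : SideRel s a b) :
    SideRel s.swap (brauerStar a) (brauerStar b) :=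
  ⟨fun hs => greenR_star.2 (h.2 hs), fun hs => greenL_star.2 (h.1 hs)⟩

theorem sideRel_top (a b : Brauer n) : SideRel (true, true) a b :=
  ⟨fun h => Bool.noConfusion h, fun h => Bool.noConfusion h⟩

theorem SideRel.mono {s s' : Bool × Bool} (hs : s ≤ s') {a b : Brauer n} (h : SideRel s a b) :
    SideRel s' a b := by
  obtain ⟨s1, s2⟩ := s
  obtain ⟨t1, t2⟩ := s'
  obtain ⟨h1, h2⟩ := hs
  constructor
  · rintro (rfl : t1 = false)
    exact h.1 (le_bot_iff.1 h1)
  · rintro (rfl : t2 = false)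
    exact h.2 (le_bot_iff.1 h2)

/-- The relation that identifies elements of rank `r + 2` according to `N`, and elements of rank
at most `r` if their images in the minimal ideal are related by `SideRel s`. -/
def LatRel (s : Bool × Bool) (r : ℕ) (N : Subgroup (Equiv.Perm (Fin (r + 2)))) (a b : Brauer n) :
    Prop :=
  a = b ∨ nuRel (barSubgroup n N) a b ∨
    (a.1.rank ≤ r ∧ b.1.rank ≤ r ∧ SideRel s (retr a) (retr b))

/-- The data for which `LatRel` is one of the relations of the classification.  If `r = n`, then
there are no elements of rank `r + 2`, and the group is required to be trivial. -/
structure LatData (n : ℕ) (s : Bool × Bool) (r : ℕ) (N : Subgroup (Equiv.Perm (Fin (r + 2)))) :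
    Prop where
  le : r ≤ n
  mod : r ≡ n [MOD 2]
  normal : N.Normal
  group : N = ⊥ ∨ r + 2 ≤ n
  side : s = (true, true) ∨ r ≤ 2 ∧ ActsAlike (barSubgroup n N)

variable {s : Bool × Bool} {r : ℕ} {N : Subgroup (Equiv.Perm (Fin (r + 2)))}

theorem LatData.mod_add_two (h : LatData n s r N) : r + 2 ≡ n [MOD 2] := by
  have := h.mod
  simp only [Nat.ModEq] at this ⊢
  omega

theorem LatData.swap (h : LatData n s r N) : LatData n s.swap r N := by
  refine ⟨h.le, h.mod, h.normal, h.group, h.side.imp_left ?_⟩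
  rintro rfl
  rfl

theorem LatData.nu_cases (h : LatData n s r N) {a b : Brauer n}
    (hab : nuRel (barSubgroup n N) a b) : a = b ∨ r + 2 ≤ n := by
  rcases h.group with rfl | h2
  · exact Or.inl (eq_of_nuRel_bot hab)
  · exact Or.inr h2

theorem LatRel.symm {a b : Brauer n} (h : LatRel s r N a b) : LatRel s r N b a := by
  rcases h with h | h | ⟨h1, h2, h3⟩
  · exact Or.inl h.symm
  · exact Or.inr (Or.inl (nuRel_symm h))
  · exact Or.inr (Or.inr ⟨h2, h1, h3.symm⟩)

theorem LatRel.trans (hd : LatData n s r N) {a b c : Brauer n} (h : LatRel s r N a b)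
    (h' : LatRel s r N b c) : LatRel s r N a c := by
  have hd2 := hd.mod_add_two
  rcases h with rfl | h | ⟨h1, h2, h3⟩
  · exact h'
  · rcases hd.nu_cases h with rfl | hn
    · exact h'
    have hb := rank_of_nuRel hn hd2 (nuRel_symm h)
    rcases h' with rfl | h' | ⟨h1', h2', h3'⟩
    · exact Or.inr (Or.inl h)
    · exact Or.inr (Or.inl (nuRel_trans hn hd2 hd.normal h h'))
    · omega
  · rcases h' with rfl | h' | ⟨h1', h2', h3'⟩
    · exact Or.inr (Or.inr ⟨h1, h2, h3⟩)
    · rcases hd.nu_cases h' with rfl | hn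
      · exact Or.inr (Or.inr ⟨h1, h2, h3⟩)
      have hb := rank_of_nuRel hn hd2 h'
      omega
    · exact Or.inr (Or.inr ⟨h1, h2', h3.trans h3'⟩)

theorem LatRel.star (hd : LatData n s r N) {a b : Brauer n} (h : LatRel s r N a b) :
    LatRel s.swap r N (brauerStar a) (brauerStar b) := by
  rcases h with rfl | h | ⟨h1, h2, h3⟩
  · exact Or.inl rfl
  · rcases hd.nu_cases h with rfl | hn
    · exact Or.inl rfl
    · exact Or.inr (Or.inl (nuRel_star hn hd.mod_add_two h))
  · refine Or.inr (Or.inr ⟨by rwa [rank_star], by rwa [rank_star], ?_⟩)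
    rcases hd.side with rfl | ⟨hr, -⟩
    · exact sideRel_top _ _
    · rw [retr_star (h1.trans hr), retr_star (h2.trans hr)]
      exact h3.star

/-- Elements related by `ν_N` act alike on the minimal ideal if the elements of `N` do. -/
theorem mul_eq_of_nuRel {N : Set (Brauer n)} (hN : ActsAlike N) {a b m : Brauer n}
    (h : nuRel N a b) (hm : m.1.rank ≤ 1) : m * a = m * b ∧ a * m = b * m := by
  obtain ⟨u, hu, v, hv, s, t, rfl, rfl, -⟩ := h
  constructor
  · have := (hN (m * s) (mul_rank_le_one_left hm s) u hu v hv).1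
    simp only [← mul_assoc]
    rw [this]
  · have := (hN (t * m) (mul_rank_le_one_right t hm) u hu v hv).2
    rw [mul_assoc (s * u), mul_assoc s, this]
    simp only [mul_assoc]

theorem greenR_retr_mul {a x : Brauer n} (ha : a.1.rank ≤ 2) :
    GreenR (retr (x * a)) (x * retr a) := by
  refine (greenR_retr ((rank_mul_le_right x a).trans ha) rank_lowElt).trans ?_
  rw [mul_assoc]
  exact ((greenR_retr ha rank_lowElt).mul_left x).symm

theorem greenL_retr_mul {a x : Brauer n} (ha : a.1.rank ≤ 2) :
    GreenL (retr (x * a)) (retr a) := by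
  refine (greenL_retr ((rank_mul_le_right x a).trans ha) rank_lowElt).trans ?_
  rw [← mul_assoc]
  exact (greenL_retr ha (mul_rank_le_one_left rank_lowElt x)).symm

theorem LatRel.mul_left (hd : LatData n s r N) {a b : Brauer n} (h : LatRel s r N a b)
    (x : Brauer n) : LatRel s r N (x * a) (x * b) := by
  have hd2 := hd.mod_add_two
  rcases h with rfl | h | ⟨h1, h2, h3⟩
  · exact Or.inl rfl
  · rcases hd.nu_cases h with rfl | hn
    · exact Or.inl rfl
    by_cases hr : (x * a).1.rank = r + 2
    · exact Or.inr (Or.inl (nuRel_mul_left hn hd2 hd.normal h hr))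
    have ha := rank_of_nuRel hn hd2 h
    have h1 := rank_mul_le_right x a
    have h2 := rank_mod_two (x * a)
    have h3 := hd.mod
    simp only [Nat.ModEq] at h3
    have h4 := rank_eq_of_greenR ((greenH_of_nuRel hn hd2 hd.normal h).1.mul_left x)
    refine Or.inr (Or.inr ⟨by omega, by omega, ?_⟩)
    rcases hd.side with rfl | ⟨-, hA⟩
    · exact sideRel_top _ _
    · have h5 : retr (x * a) = retr (x * b) := by
        have e1 := (mul_eq_of_nuRel hA h (mul_rank_le_one_left
          (rank_lowElt (n := n)) x)).1
        have e2 := (mul_eq_of_nuRel hA h (mul_rank_le_one_left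
          (mul_rank_le_one_left (rank_lowElt (n := n)) x) b)).2
        calc retr (x * a) = x * a * (lowElt n * x * a) := by simp only [retr, mul_assoc]
          _ = x * (a * (lowElt n * x * b)) := by rw [e1, mul_assoc]
          _ = retr (x * b) := by rw [e2]; simp only [retr, mul_assoc]
      rw [h5]
      exact .refl _ _
  · refine Or.inr (Or.inr ⟨(rank_mul_le_right x a).trans h1, (rank_mul_le_right x b).trans h2, ?_⟩)
    rcases hd.side with rfl | ⟨hr, -⟩
    · exact sideRel_top _ _
    · refine ⟨fun hs => ?_, fun hs => ?_⟩
      · exact (greenR_retr_mul (h1.trans hr)).trans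
          (((h3.1 hs).mul_left x).trans (greenR_retr_mul (h2.trans hr)).symm)
      · exact (greenL_retr_mul (h1.trans hr)).trans
          ((h3.2 hs).trans (greenL_retr_mul (h2.trans hr)).symm)

theorem LatRel.mul_right (hd : LatData n s r N) {a b : Brauer n} (h : LatRel s r N a b)
    (x : Brauer n) : LatRel s r N (a * x) (b * x) := by
  have h1 := ((h.star hd).mul_left hd.swap (brauerStar x)).star hd.swap
  simpa only [star_mul, star_star, Prod.swap_swap] using h1

/-- The congruence with the given data. -/
def latCon (hd : LatData n s r N) : Con (Brauer n) where
  r := LatRel s r N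
  iseqv := ⟨fun _ => Or.inl rfl, LatRel.symm, LatRel.trans hd⟩
  mul' {_ x y _} h h' := (h.mul_right hd y).trans hd (h'.mul_left hd x)

theorem retr_retr (a : Brauer n) : retr (retr a) = retr a := retr_eq_self (rank_retr a)

/-! ### Comparing the congruences -/

/-- Two elements of the minimal ideal with the same lower row and different upper rows. -/
theorem exists_greenL_not_greenR (hn : 3 ≤ n) :
    ∃ x y : Brauer n, x.1.rank ≤ 1 ∧ y.1.rank ≤ 1 ∧ GreenL x y ∧ ¬ GreenR x y := by
  obtain ⟨a, ha, ha'⟩ := exists_upper (n := n) (i := ⟨0, by omega⟩) (j := ⟨1, by omega⟩) (by simp)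
  obtain ⟨b, hb, hb'⟩ := exists_upper (n := n) (i := ⟨0, by omega⟩) (j := ⟨2, by omega⟩) (by simp)
  refine ⟨a * lowElt n, b * lowElt n, mul_rank_le_one_left ha _, mul_rank_le_one_left hb _,
    (greenL_mul rank_lowElt a).symm.trans (greenL_mul rank_lowElt b), fun h => ?_⟩
  have h1 := (greenR_mul ha (lowElt n)).trans (h.trans (greenR_mul hb (lowElt n)).symm)
  have h2 := (greenR_iff.1 h1 _ _).1 ha'
  rw [hb'] at h2
  simp at h2

theorem exists_greenR_not_greenL (hn : 3 ≤ n) :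
    ∃ x y : Brauer n, x.1.rank ≤ 1 ∧ y.1.rank ≤ 1 ∧ GreenR x y ∧ ¬ GreenL x y := by
  obtain ⟨x, y, hx, hy, hL, hR⟩ := exists_greenL_not_greenR hn
  refine ⟨brauerStar x, brauerStar y, by rwa [rank_star], by rwa [rank_star], greenR_star.2 hL, ?_⟩
  rwa [greenL_star]

/-- On the minimal ideal, `LatRel` is `SideRel`. -/
theorem latRel_low_iff (hd : LatData n s r N) {x y : Brauer n} (hx : x.1.rank ≤ 1)
    (hy : y.1.rank ≤ 1) : LatRel s r N x y ↔ SideRel s x y := by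
  constructor
  · rintro (rfl | h | ⟨-, -, h⟩)
    · exact .refl _ _
    · rcases hd.nu_cases h with rfl | hn'
      · exact .refl _ _
      · have := rank_of_nuRel hn' hd.mod_add_two h
        omega
    · rwa [retr_eq_self hx, retr_eq_self hy] at h
  · intro h
    have h1 : ∀ {x : Brauer n}, x.1.rank ≤ 1 → x.1.rank ≤ r :=
      fun hx => rankIdeal_one_subset hd.mod hx
    refine Or.inr (Or.inr ⟨h1 hx, h1 hy, ?_⟩)
    rwa [retr_eq_self hx, retr_eq_self hy]

variable {s' : Bool × Bool} {r' : ℕ} {N' : Subgroup (Equiv.Perm (Fin (r' + 2)))}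

theorem side_le_of_latCon_le (hn : 3 ≤ n) (hd : LatData n s r N) (hd' : LatData n s' r' N')
    (h : latCon hd ≤ latCon hd') : s ≤ s' := by
  have key : ∀ x y : Brauer n, x.1.rank ≤ 1 → y.1.rank ≤ 1 → SideRel s x y → SideRel s' x y :=
    fun x y hx hy hxy => (latRel_low_iff hd' hx hy).1 (h ((latRel_low_iff hd hx hy).2 hxy))
  obtain ⟨s1, s2⟩ := s
  obtain ⟨t1, t2⟩ := s'
  constructor
  · obtain ⟨x, y, hx, hy, hL, hR⟩ := exists_greenL_not_greenR hn
    rintro (rfl : s1 = true)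
    by_contra ht
    exact hR ((key x y hx hy ⟨fun h => Bool.noConfusion h, fun _ => hL⟩).1 (by simpa using ht))
  · obtain ⟨x, y, hx, hy, hR, hL⟩ := exists_greenR_not_greenL hn
    rintro (rfl : s2 = true)
    by_contra ht
    exact hL ((key x y hx hy ⟨fun _ => hR, fun h => Bool.noConfusion h⟩).2 (by simpa using ht))

/-- The congruences are ordered by their side, and by rank and group lexicographically. -/
theorem latCon_le_iff (hn : 3 ≤ n) (hd : LatData n s r N) (hd' : LatData n s' r' N') :
    latCon hd ≤ latCon hd' ↔
      s ≤ s' ∧ (r < r' ∨ r = r' ∧ normalIndex N ≤ normalIndex N') := by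
  have hm := hd.mod
  have hm' := hd'.mod
  simp only [Nat.ModEq] at hm hm'
  constructor
  · intro h
    refine ⟨side_le_of_latCon_le hn hd hd' h, ?_⟩
    rcases lt_trichotomy r r' with hr | rfl | hr
    · exact Or.inl hr
    · refine Or.inr ⟨rfl, ?_⟩
      rw [← le_iff_normalIndex (by omega) hd.normal hd'.normal]
      rcases hd.group with rfl | hr
      · exact bot_le
      intro σ hσ
      have h1 : LatRel s' r N' (barB hr hd.mod_add_two 1) (barB hr hd.mod_add_two σ) :=
        h (Or.inr (Or.inl ((nuRel_barB_iff hr hd.mod_add_two hd.normal).2 hσ)))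
      rcases h1 with h1 | h1 | ⟨h1, -⟩
      · rw [← barB_injective hr hd.mod_add_two h1]
        exact N'.one_mem
      · exact (nuRel_barB_iff hr hd.mod_add_two hd'.normal).1 h1
      · rw [rank_barB] at h1
        omega
    · exfalso
      -- an element of rank `r` is identified with its image in the minimal ideal by the first
      -- congruence only
      obtain ⟨α, hα⟩ := exists_rank hd.le hd.mod
      have h0 := rank_retr α
      have h1 : LatRel s' r' N' α (retr α) := h (Or.inr (Or.inr ⟨hα.le, by omega, by
        rw [retr_retr]
        exact .refl _ _⟩))
      rcases h1 with h1 | h1 | ⟨h1, -⟩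
      · rw [← h1] at h0
        omega
      · rcases hd'.nu_cases h1 with h2 | h2
        · rw [← h2] at h0
          omega
        · have h3 := rank_of_nuRel h2 hd'.mod_add_two (nuRel_symm h1)
          omega
      · omega
  · rintro ⟨hs, hr⟩ a b (h | h | ⟨h1, h2, h3⟩)
    · exact Or.inl h
    · rcases hd.nu_cases h with h0 | h0
      · exact Or.inl h0
      rcases hr with hr | ⟨rfl, hN⟩
      · have ha := rank_of_nuRel h0 hd.mod_add_two h
        have hb := rank_of_nuRel h0 hd.mod_add_two (nuRel_symm h)
        refine Or.inr (Or.inr ⟨by omega, by omega, ?_⟩)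
        rcases hd.side with rfl | ⟨-, hA⟩
        · rw [top_le_iff.1 (show (⊤ : Bool × Bool) ≤ s' from hs)]
          exact sideRel_top _ _
        · have e1 := (mul_eq_of_nuRel hA h (rank_lowElt (n := n))).1
          have e2 := (mul_eq_of_nuRel hA h
            (mul_rank_le_one_left (rank_lowElt (n := n)) b)).2
          have : retr a = retr b := by
            rw [retr, retr, mul_assoc, e1, e2, mul_assoc]
          rw [this]
          exact .refl _ _
      · rw [← le_iff_normalIndex (by omega) hd.normal hd'.normal] at hN
        refine Or.inr (Or.inl (nuRel_mono ?_ h))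
        rintro _ ⟨σ, hσ, h⟩
        exact ⟨σ, hN hσ, h⟩
    · exact Or.inr (Or.inr ⟨by omega, by omega, h3.mono hs⟩)

end LatRel

/-! ### Every congruence has the common form -/

section Classification

variable {n : ℕ}

/-- A related pair outside `H` makes `c` contract every element of at most its rank to the minimal
ideal. -/
theorem retr_rel_of_not_greenH {c : Con (Brauer n)} {f g : Brauer n} (h : c f g)
    (hr : g.1.rank ≤ f.1.rank) (h2 : 2 ≤ f.1.rank) (hH : ¬ GreenH f g) :
    ∀ a : Brauer n, a.1.rank ≤ f.1.rank → c a (retr a) := by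
  intro a ha
  have h0 := rank_retr a
  by_cases h3 : 3 ≤ f.1.rank
  · exact rees_of_full (full_of_not_greenH h hr h3 hH) h hr h2 hH a _ ha (by omega)
  · obtain ⟨f', g', h', hf', hg'⟩ := exists_drop h hr h2 hH
    by_cases ha' : a.1.rank ≤ 1
    · rw [retr_eq_self ha']
      exact c.refl a
    obtain ⟨b, hab, hb⟩ := exists_rank_le_of_rank_eq h' (show a.1.rank = f'.1.rank by omega)
    have e := c.mul (c.mul hab (c.refl (lowElt n))) hab
    rw [mul_mul_eq_self (show b.1.rank ≤ 1 by omega)] at e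
    exact c.trans hab (c.symm e)

/-- The restriction of a congruence to the minimal ideal is one of `H`, `L`, `R` and the universal
relation. -/
theorem exists_sideRel_iff (c : Con (Brauer n)) : ∃ s : Bool × Bool,
    (Full c → s = (true, true)) ∧
    ∀ x y : Brauer n, x.1.rank ≤ 1 → y.1.rank ≤ 1 → (c x y ↔ SideRel s x y) := by
  classical
  refine ⟨(decide (UpFull c), decide (LowFull c)), fun h => ?_, fun x y hx hy => ⟨fun h => ?_,
    fun h => ?_⟩⟩
  · rw [full_iff] at h
    simp [h.1, h.2]
  · constructor
    · intro hu
      by_contra hR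
      exact of_decide_eq_false hu (upFull_of_not_greenR hx hy h hR)
    · intro hu
      by_contra hL
      exact of_decide_eq_false hu (lowFull_of_not_greenL hx hy h hL)
  · by_cases hu : UpFull c <;> by_cases hl : LowFull c
    · exact full_iff.2 ⟨hl, hu⟩ x y hx hy
    · exact hu x y hx (h.2 (decide_eq_false hl))
    · exact hl x y hx (h.1 (decide_eq_false hu))
    · rw [eq_of_greenH hx ⟨h.1 (decide_eq_false hu), h.2 (decide_eq_false hl)⟩]
      exact c.refl y

/-- The largest rank `r` such that `c` contracts the ideal of the elements of rank at most `r` to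
the minimal ideal. -/
theorem exists_max_retr (c : Con (Brauer n)) : ∃ r, r ≤ n ∧ r ≡ n [MOD 2] ∧
    (∀ a : Brauer n, a.1.rank ≤ r → c a (retr a)) ∧
    ∀ k, r < k → k ≤ n → k ≡ n [MOD 2] → ¬ ∀ a : Brauer n, a.1.rank ≤ k → c a (retr a) := by
  classical
  let P : ℕ → Prop := fun k => k ≡ n [MOD 2] ∧ ∀ a : Brauer n, a.1.rank ≤ k → c a (retr a)
  have h0 : P (n % 2) := ⟨Nat.mod_modEq n 2, fun a ha => by
    rw [retr_eq_self (by omega)]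
    exact c.refl a⟩
  have h1 := Nat.findGreatest_spec (P := P) (Nat.mod_le n 2) h0
  refine ⟨Nat.findGreatest P n, Nat.findGreatest_le n, h1.1, h1.2, fun k hk hkn hm h => ?_⟩
  exact Nat.findGreatest_is_greatest hk hkn ⟨hm, h⟩

/-- Every congruence has the form `latCon`: the side is its restriction to the minimal ideal, the rank
is maximal such that the ideal is contracted to the minimal ideal, and the group consists of the
permutations identified with the identity in the next rank `r + 2`. -/
theorem exists_latCon_eq (c : Con (Brauer n)) :
    ∃ (s : Bool × Bool) (r : ℕ) (N : Subgroup (Equiv.Perm (Fin (r + 2)))) (hd : LatData n s r N),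
      latCon hd = c := by
  obtain ⟨s, hs, hM⟩ := exists_sideRel_iff c
  obtain ⟨r, hr, hm, hP, hmax⟩ := exists_max_retr c
  have hm2 : r + 2 ≡ n [MOD 2] := by
    simp only [Nat.ModEq] at hm ⊢
    omega
  -- a related pair outside `H` has rank at most `r`, by the maximality of `r`
  have hH : ∀ f g : Brauer n, c f g → g.1.rank ≤ f.1.rank → r < f.1.rank → GreenH f g := by
    intro f g h hgf hf
    by_contra hH
    have h1 := rank_mod_two f
    have h2 : 2 ≤ f.1.rank := by
      simp only [Nat.ModEq] at hm
      omega
    exact hmax _ hf (rank_le f) h1 (retr_rel_of_not_greenH h hgf h2 hH)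
  -- a related pair in `H` has rank at most `r + 2`, since hooks turn it into a pair outside `H`
  have hE : ∀ f g : Brauer n, c f g → g.1.rank ≤ f.1.rank → r + 2 < f.1.rank → f = g := by
    intro f g h hgf hf
    by_contra hne
    have h1 := rank_mod_two f
    simp only [Nat.ModEq] at hm
    obtain ⟨x, y, hx, hy, hL⟩ := exists_hook_not_greenL (hH f g h hgf (by omega)) hne (by omega)
    exact hL (hH _ _ (c.mul (c.refl _) h) (by omega) (by omega)).2
  have hlow : ∀ a b : Brauer n, a.1.rank ≤ r → b.1.rank ≤ r →
      (c a b ↔ SideRel s (retr a) (retr b)) := by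
    intro a b ha hb
    rw [← hM _ _ (rank_retr a) (rank_retr b)]
    exact ⟨fun h => c.trans (c.symm (hP a ha)) (c.trans h (hP b hb)),
      fun h => c.trans (hP a ha) (c.trans h (c.symm (hP b hb)))⟩
  have hside : s = (true, true) ∨ r ≤ 2 := by
    by_contra! hcon
    obtain ⟨α, hα⟩ := exists_rank hr hm
    have h0 := rank_retr α
    exact hcon.1 (hs (full_of_rank_lt (hP α hα.le) (by omega) (by omega)))
  by_cases hrn : r + 2 ≤ n
  · have hact : s = (true, true) ∨ ActsAlike (barSubgroup n (conSubgroup hrn hm2 c)) := by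
      by_cases hA : ActsAlike (barSubgroup n (conSubgroup hrn hm2 c))
      · exact Or.inr hA
      rw [actsAlike_barSubgroup_iff hrn hm2] at hA
      push Not at hA
      obtain ⟨σ, hσ, m, hm, hne⟩ := hA
      exact Or.inl (hs (full_of_acts_ne hrn hm2 ((mem_conSubgroup hrn hm2).1 hσ) hm hne))
    have hd : LatData n s r (conSubgroup hrn hm2 c) :=
      ⟨hr, hm, conSubgroup_normal hrn hm2 c, Or.inr hrn, by tauto⟩
    refine ⟨s, r, _, hd, le_antisymm ?_ ?_⟩
    · rintro a b (rfl | h | ⟨h1, h2, h3⟩)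
      · exact c.refl a
      · exact (con_iff_nuRel hrn hm2 (rank_of_nuRel hrn hm2 h)
          (greenH_of_nuRel hrn hm2 hd.normal h)).2 h
      · exact (hlow a b h1 h2).2 h3
    · have key : ∀ a b : Brauer n, c a b → b.1.rank ≤ a.1.rank → latCon hd a b := by
        intro a b h hba
        have ha := rank_mod_two a
        simp only [Nat.ModEq] at hm
        rcases lt_or_ge r a.1.rank with h1 | h1
        · by_cases h2 : a.1.rank = r + 2
          · exact Or.inr (Or.inl ((con_iff_nuRel hrn hm2 h2 (hH a b h hba h1)).1 h))
          · exact Or.inl (hE a b h hba (by omega))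
        · exact Or.inr (Or.inr ⟨h1, hba.trans h1, (hlow a b h1 (hba.trans h1)).1 h⟩)
      intro a b h
      rcases le_total b.1.rank a.1.rank with hba | hba
      · exact key a b h hba
      · exact (latCon hd).symm (key b a (c.symm h) hba)
  · have hrn' : r = n := by
      simp only [Nat.ModEq] at hm
      omega
    have hd : LatData n s r ⊥ :=
      ⟨hr, hm, inferInstance, Or.inl rfl, hside.imp_right fun h => ⟨h, by
        rintro x - u ⟨σ, hσ, hu⟩ v ⟨τ, hτ, hv⟩
        rw [Subgroup.mem_bot] at hσ hτ
        rw [Subtype.ext (hu.trans (by rw [hσ, hv, hτ]) : u.1 = v.1)]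
        exact ⟨rfl, rfl⟩⟩⟩
    refine ⟨s, r, ⊥, hd, le_antisymm ?_ ?_⟩
    · rintro a b (rfl | h | ⟨h1, h2, h3⟩)
      · exact c.refl a
      · rw [eq_of_nuRel_bot h]
        exact c.refl b
      · exact (hlow a b h1 h2).2 h3
    · intro a b h
      have ha := rank_le a
      have hb := rank_le b
      exact Or.inr (Or.inr ⟨by omega, by omega, (hlow a b (by omega) (by omega)).1 h⟩)

end Classification

/-! ### IN-pairs -/

section Transport

variable {S : Type*} [Monoid S] {e f x y : S} {N : Set S}

theorem mul_eq_of_greenR {a : S} (he : e * e = e) (h : GreenR a e) : e * a = a := by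
  obtain ⟨-, s, rfl⟩ := greenR_iff_exists.1 h
  rw [← mul_assoc, he]

theorem mul_eq_of_greenL {a : S} (he : e * e = e) (h : GreenL a e) : a * e = a := by
  obtain ⟨-, s, rfl⟩ := greenL_iff_exists.1 h
  rw [mul_assoc, he]

theorem eq_of_greenH_of_idempotent (he : e * e = e) (hf : f * f = f) (h : GreenH e f) : e = f :=
  (mul_eq_of_greenR hf h.1).symm.trans (mul_eq_of_greenL he h.2.symm)

theorem greenH_of_inverse {a b : S} (he : e * a = a) (he' : a * e = a) (h : a * b = e)
    (h' : b * a = e) : GreenH a e :=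
  ⟨greenR_iff_exists.2 ⟨⟨b, h⟩, a, he⟩, greenL_iff_exists.2 ⟨⟨b, h'⟩, a, he'⟩⟩

/-- The image of `N` under `u ↦ y u x`.  For mutually inverse `x` and `y` this carries the subgroups
at the idempotent `x y` to subgroups at the idempotent `y x`. -/
def conjSet (x y : S) (N : Set S) : Set S := (fun u => y * u * x) '' N

theorem conj_conj (hxy : x * y = e) {u : S} (h1 : e * u = u) (h2 : u * e = u) :
    x * (y * u * x) * y = u := by
  calc x * (y * u * x) * y = x * y * u * (x * y) := by simp only [mul_assoc]
    _ = u := by rw [hxy, h1, h2]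

theorem conjSet_conjSet (h : IsNormalSubgroupAt e N) (hxy : x * y = e) :
    conjSet y x (conjSet x y N) = N := by
  obtain ⟨he, -, hH, -⟩ := h
  have key : ∀ u ∈ N, x * (y * u * x) * y = u := fun u hu =>
    conj_conj hxy (mul_eq_of_greenR he (hH u hu).1) (mul_eq_of_greenL he (hH u hu).2)
  ext u
  constructor
  · rintro ⟨_, ⟨u, hu, rfl⟩, rfl⟩
    change x * (y * u * x) * y ∈ N
    rwa [key u hu]
  · intro hu
    exact ⟨_, ⟨u, hu, rfl⟩, key u hu⟩

theorem IsNormalSubgroupAt.conjSet (h : IsNormalSubgroupAt e N) (hxy : x * y = e)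
    (hyx : y * x = f) (hx : e * x = x) (hy : y * e = y) :
    IsNormalSubgroupAt f (conjSet x y N) := by
  obtain ⟨he, heN, hH, hmul, hinv, hconj⟩ := h
  have hff : f * f = f := by
    calc f * f = y * (x * y) * x := by rw [← hyx]; simp only [mul_assoc]
      _ = f := by rw [hxy, hy, hyx]
  have hfy : f * y = y := by rw [← hyx, mul_assoc, hxy, hy]
  have hxf : x * f = x := by rw [← hyx, ← mul_assoc, hxy, hx]
  have hprod : ∀ u v : S, GreenH v e → y * u * x * (y * v * x) = y * (u * v) * x := by
    intro u v hv
    calc y * u * x * (y * v * x) = y * u * (x * y * v) * x := by simp only [mul_assoc]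
      _ = y * (u * v) * x := by rw [hxy, mul_eq_of_greenR he hv.1, mul_assoc y]
  have hye : y * e * x = f := by rw [hy, hyx]
  have hinv' : ∀ u ∈ N, ∃ v ∈ N, y * u * x * (y * v * x) = f ∧ y * v * x * (y * u * x) = f := by
    intro u hu
    obtain ⟨v, hv, h1, h2⟩ := hinv u hu
    refine ⟨v, hv, ?_, ?_⟩
    · rw [hprod u v (hH v hv), h1, hye]
    · rw [hprod v u (hH u hu), h2, hye]
  refine ⟨hff, ⟨e, heN, hye⟩, ?_, ?_, ?_, ?_⟩
  · rintro _ ⟨u, hu, rfl⟩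
    obtain ⟨v, hv, h1, h2⟩ := hinv' u hu
    refine greenH_of_inverse ?_ ?_ h1 h2
    · simp only [← mul_assoc, hfy]
    · simp only [mul_assoc, hxf]
  · rintro _ ⟨u, hu, rfl⟩ _ ⟨v, hv, rfl⟩
    exact ⟨u * v, hmul u hu v hv, (hprod u v (hH v hv)).symm⟩
  · rintro _ ⟨u, hu, rfl⟩
    obtain ⟨v, hv, h1, h2⟩ := hinv' u hu
    exact ⟨_, ⟨v, hv, rfl⟩, h1, h2⟩
  · rintro g k hg hk hgk hkg _ ⟨u, hu, rfl⟩
    have hg1 := mul_eq_of_greenR hff hg.1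
    have hg2 := mul_eq_of_greenL hff hg.2
    have hk1 := mul_eq_of_greenR hff hk.1
    have hk2 := mul_eq_of_greenL hff hk.2
    have hprod' : ∀ g k : S, f * k = k → g * k = f → x * g * y * (x * k * y) = e := by
      intro g k h1 h2
      calc x * g * y * (x * k * y) = x * (g * (y * x * k)) * y := by simp only [mul_assoc]
        _ = e := by rw [hyx, h1, h2, hxf, hxy]
    have hH' : ∀ g k : S, f * g = g → f * k = k → g * k = f → k * g = f →
        GreenH (x * g * y) e := by
      intro g k h1 h2 h3 h4
      refine greenH_of_inverse ?_ ?_ (hprod' g k h2 h3) (hprod' k g h1 h4)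
      · simp only [← mul_assoc, hx]
      · simp only [mul_assoc, hy]
    refine ⟨x * g * y * u * (x * k * y), hconj _ _ (hH' g k hg1 hk1 hgk hkg)
      (hH' k g hk1 hg1 hkg hgk) (hprod' g k hk1 hgk) (hprod' k g hg1 hkg) u hu, ?_⟩
    calc y * (x * g * y * u * (x * k * y)) * x
        = y * x * g * (y * u * x) * (k * (y * x)) := by simp only [mul_assoc]
      _ = g * (y * u * x) * k := by rw [hyx, hg1, hk2]

theorem nuRel_of_conjSet (h : IsNormalSubgroupAt e N) (hxy : x * y = e) {a b : S}
    (hab : nuRel (conjSet x y N) a b) : nuRel N a b := by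
  obtain ⟨he, -, hH, -⟩ := h
  have hJ : ∀ u ∈ N, GreenJ (y * u * x) u := fun u hu => greenJ_iff_mem.2
    ⟨⟨y, x, rfl⟩, x, y, (conj_conj hxy (mul_eq_of_greenR he (hH u hu).1)
      (mul_eq_of_greenL he (hH u hu).2)).symm⟩
  obtain ⟨_, ⟨u, hu, rfl⟩, _, ⟨v, hv, rfl⟩, s, t, rfl, rfl, h1, h2⟩ := hab
  refine ⟨u, hu, v, hv, s * y, x * t, ?_, ?_, h1.trans (hJ u hu), h2.trans (hJ v hv)⟩ <;>
    simp only [mul_assoc]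

theorem acts_conjSet {M : Set S} (hM : IsIdeal M)
    (h : ∀ m ∈ M, ∀ u ∈ N, ∀ v ∈ N, m * u = m * v ∧ u * m = v * m) :
    ∀ m ∈ M, ∀ u ∈ conjSet x y N, ∀ v ∈ conjSet x y N, m * u = m * v ∧ u * m = v * m := by
  rintro m hm _ ⟨u, hu, rfl⟩ _ ⟨v, hv, rfl⟩
  constructor
  · have := (h (m * y) (hM.2 m hm y).2 u hu v hv).1
    simp only [← mul_assoc] at this ⊢
    rw [this]
  · have := (h (x * m) (hM.2 m hm x).1 u hu v hv).2
    simp only [mul_assoc] at this ⊢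
    rw [this]

end Transport

section INPairs

variable {n : ℕ}

theorem isINPair_iff {I N : Set (Brauer n)} : IsINPair I N ↔
    ∃ (r : ℕ) (e : Brauer n), r + 2 ≤ n ∧ r ≡ n [MOD 2] ∧ I = rankIdeal n r ∧ e.1.rank = r + 2 ∧
      IsNormalSubgroupAt e N := by
  constructor
  · rintro ⟨hI, e, hN, -, -, he, hmin⟩
    obtain ⟨r, hr, hm, rfl⟩ := (isIdeal_iff I).1 hI
    rw [mem_rankIdeal, not_le] at he
    have h1 := rank_mod_two e
    have h2 := rank_le e
    have hm' := hm
    simp only [Nat.ModEq] at hm'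
    refine ⟨r, e, by omega, hm, rfl, ?_, hN⟩
    obtain ⟨b, hb⟩ := exists_rank (n := n) (q := r + 2) (by omega)
      (by simp only [Nat.ModEq]; omega)
    have := greenJ_iff.1 (hmin b (by rw [mem_rankIdeal]; omega)
      (mem_principalIdeal_iff.2 (by omega)))
    omega
  · rintro ⟨r, e, hr, hm, rfl, he, hN⟩
    refine ⟨isIdeal_rankIdeal (by omega) hm, e, hN, isStableClass e, isRegularClass e,
      by rw [mem_rankIdeal]; omega, fun b hb hbe => ?_⟩
    rw [mem_rankIdeal] at hb
    rw [mem_principalIdeal_iff] at hbe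
    have h1 := rank_mod_two b
    simp only [Nat.ModEq] at hm
    rw [greenJ_iff]
    omega

theorem isNormalSubgroupAt_barSubgroup {q : ℕ} (hq : q ≤ n) (hp : q ≡ n [MOD 2])
    {N : Subgroup (Equiv.Perm (Fin q))} (hN : N.Normal) :
    IsNormalSubgroupAt (barB hq hp 1) (barSubgroup n N) := by
  have hH : ∀ {g : Brauer n}, GreenH g (barB hq hp 1) → ∃ σ, g = barB hq hp σ :=
    fun h => exists_eq_barB hq hp h
  refine ⟨barB_one_mul hq hp 1, (barB_mem_barSubgroup hq hp).2 N.one_mem, ?_, ?_, ?_, ?_⟩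
  · intro x hx
    obtain ⟨σ, hσ, rfl⟩ := (mem_barSubgroup hq hp).1 hx
    exact greenH_barB hq hp σ 1
  · intro x hx y hy
    obtain ⟨σ, hσ, rfl⟩ := (mem_barSubgroup hq hp).1 hx
    obtain ⟨τ, hτ, rfl⟩ := (mem_barSubgroup hq hp).1 hy
    rw [barB_mul, barB_mem_barSubgroup]
    exact N.mul_mem hτ hσ
  · intro x hx
    obtain ⟨σ, hσ, rfl⟩ := (mem_barSubgroup hq hp).1 hx
    refine ⟨barB hq hp σ⁻¹, (barB_mem_barSubgroup hq hp).2 (N.inv_mem hσ), ?_, ?_⟩ <;>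
      rw [barB_mul] <;> simp
  · intro g h hg hh hgh hhg x hx
    obtain ⟨σ, hσ, rfl⟩ := (mem_barSubgroup hq hp).1 hx
    obtain ⟨γ, rfl⟩ := hH hg
    obtain ⟨δ, rfl⟩ := hH hh
    rw [barB_mul] at hgh
    have h1 := barB_injective hq hp hgh
    rw [barB_mul, barB_mul, barB_mem_barSubgroup, ← inv_eq_of_mul_eq_one_right h1, ← mul_assoc]
    exact hN.conj_mem σ hσ δ

/-- The IN-pairs with a distinguished group. -/
theorem isINPair_and_isDistinguished_iff {I N : Set (Brauer n)} :
    IsINPair I N ∧ IsDistinguished N ↔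
      ∃ (r : ℕ) (N₀ : Subgroup (Equiv.Perm (Fin (r + 2)))), r + 2 ≤ n ∧ r ≡ n [MOD 2] ∧
        N₀.Normal ∧ I = rankIdeal n r ∧ N = barSubgroup n N₀ := by
  constructor
  · rintro ⟨h, q, hq, hp, hNq⟩
    obtain ⟨r, e, hr, hm, rfl, he, hN⟩ := isINPair_iff.1 h
    obtain ⟨hee, heN, hH, hmul, hinv, hconj⟩ := hN
    obtain ⟨σ, -, rfl⟩ := (mem_barSubgroup hq hp).1 (hNq heN)
    obtain rfl : q = r + 2 := by rw [← he, rank_barB]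
    obtain rfl : σ = 1 := by
      rw [barB_mul] at hee
      simpa using barB_injective hq hp hee
    let N₀ : Subgroup (Equiv.Perm (Fin (r + 2))) :=
      { carrier := {σ | barB hq hp σ ∈ N}
        one_mem' := heN
        mul_mem' := by
          intro σ τ hσ hτ
          change barB hq hp (σ * τ) ∈ N
          rw [← barB_mul]
          exact hmul _ hτ _ hσ
        inv_mem' := by
          intro σ hσ
          obtain ⟨y, hy, h1, h2⟩ := hinv _ hσ
          obtain ⟨τ, -, rfl⟩ := (mem_barSubgroup hq hp).1 (hNq hy)
          rw [barB_mul] at h1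
          change barB hq hp σ⁻¹ ∈ N
          rwa [← eq_inv_of_mul_eq_one_left (barB_injective hq hp h1)] }
    refine ⟨r, N₀, hr, hm, ⟨fun σ hσ g => ?_⟩, rfl, ?_⟩
    · have h1 := hconj (barB hq hp g⁻¹) (barB hq hp g) (greenH_barB hq hp _ _)
        (greenH_barB hq hp _ _) (by rw [barB_mul]; simp) (by rw [barB_mul]; simp) _ hσ
      rwa [barB_mul, barB_mul, ← mul_assoc] at h1
    · ext x
      constructor
      · intro hx
        obtain ⟨σ, -, rfl⟩ := (mem_barSubgroup hq hp).1 (hNq hx)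
        exact (barB_mem_barSubgroup hq hp).2 hx
      · intro hx
        obtain ⟨σ, hσ, rfl⟩ := (mem_barSubgroup hq hp).1 hx
        exact hσ
  · rintro ⟨r, N₀, hr, hm, hN, rfl, rfl⟩
    have hm2 : r + 2 ≡ n [MOD 2] := by
      simp only [Nat.ModEq] at hm ⊢
      omega
    exact ⟨isINPair_iff.2 ⟨r, _, hr, hm, rfl, rank_barB hr hm2 1,
      isNormalSubgroupAt_barSubgroup hr hm2 hN⟩, r + 2, hr, hm2,
      fun x ⟨σ, _, hx⟩ => ⟨σ, Subgroup.mem_top σ, hx⟩⟩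

theorem isRetractableINPair_iff {r : ℕ} (hr : r ≤ n) (hm : r ≡ n [MOD 2]) {N : Set (Brauer n)} :
    IsRetractableINPair (rankIdeal n r) N ↔
      IsINPair (rankIdeal n r) N ∧ r ≤ 2 ∧ ActsAlike N := by
  constructor
  · rintro ⟨h, M, hM, ⟨f, hf⟩, hN⟩
    rw [isMinimalIdeal_iff] at hM
    subst hM
    obtain ⟨α, hα⟩ := exists_rank hr hm
    exact ⟨h, hα ▸ not_isRetraction hf (rankIdeal_one_subset hm) (isIdeal_rankIdeal hr hm)
      (mem_rankIdeal.2 hα.le), hN⟩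
  · rintro ⟨h, h2, hN⟩
    exact ⟨h, _, (isMinimalIdeal_iff _).2 rfl, ⟨_, isRetraction_retr h2⟩, hN⟩

/-- Every IN-pair may be replaced by one with a distinguished group: idempotents of equal rank are
conjugate. -/
theorem exists_distinguished {I N : Set (Brauer n)} (h : IsINPair I N) :
    ∃ N' : Set (Brauer n), IsDistinguished N' ∧ IsINPair I N' ∧ nuRel N = nuRel N' ∧
      (N.Nontrivial ↔ N'.Nontrivial) ∧ (IsRetractableINPair I N ↔ IsRetractableINPair I N') := by
  obtain ⟨r, e, hr, hm, hI, he, hN⟩ := isINPair_iff.1 h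
  have hm2 : r + 2 ≡ n [MOD 2] := by
    simp only [Nat.ModEq] at hm ⊢
    omega
  have hff := barB_one_mul hr hm2 1
  have hf := rank_barB hr hm2 1
  set f := barB hr hm2 1
  have hee := hN.1
  obtain ⟨s, t, hst⟩ := mem_principalIdeal_iff.2 (show f.1.rank ≤ e.1.rank by omega)
  let x := e * (t * f)
  let y := f * s * e
  have hyx : y * x = f := by
    calc y * x = f * (s * (e * e) * t) * f := by simp only [x, y, mul_assoc]
      _ = f := by rw [hee, ← hst, hff, hff]
  have hx : e * x = x := by simp only [x, ← mul_assoc, hee]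
  have hy : y * e = y := by simp only [y, mul_assoc, hee]
  have hxf : x * f = x := by simp only [x, mul_assoc, hff]
  have hfy : f * y = y := by simp only [y, ← mul_assoc, hff]
  clear_value x y
  have hidem : x * y * (x * y) = x * y := by
    rw [mul_assoc, ← mul_assoc y, hyx, hfy]
  have hrank : e.1.rank ≤ (x * y).1.rank := by
    have h1 := rank_mul_mul_le y (x * y) x
    have h2 : y * (x * y) * x = f := by
      rw [← mul_assoc, hyx, hfy, hyx]
    rw [h2] at h1
    omega
  -- `x y` is an idempotent of the same rank below `e`, hence equal to `e`
  have hxy : x * y = e := by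
    refine (eq_of_greenH_of_idempotent hee hidem ⟨?_, ?_⟩).symm
    · have h1 : x * y = e * (x * y) := by rw [← mul_assoc, hx]
      rw [h1] at hrank ⊢
      exact greenR_mul_of_rank hrank
    · have h1 : x * y = x * y * e := by rw [mul_assoc, hy]
      rw [h1] at hrank ⊢
      exact greenL_mul_of_rank hrank
  have hN' := hN.conjSet hxy hyx hx hy
  have hback := conjSet_conjSet hN hxy
  have hIN : IsINPair I (conjSet x y N) := isINPair_iff.2 ⟨r, f, hr, hm, hI, hf, hN'⟩
  have hinj : ∀ {x y : Brauer n} {N : Set (Brauer n)}, (conjSet x y N).Nontrivial →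
      N.Nontrivial := by
    rintro x y N ⟨_, ⟨u, hu, rfl⟩, _, ⟨v, hv, rfl⟩, hne⟩
    exact ⟨u, hu, v, hv, fun e => hne (by rw [e])⟩
  refine ⟨conjSet x y N, ⟨r + 2, hr, hm2, ?_⟩, hIN, ?_, ?_, ?_⟩
  · intro u hu
    obtain ⟨σ, rfl⟩ := exists_eq_barB hr hm2 (hN'.2.2.1 u hu)
    exact (barB_mem_barSubgroup hr hm2).2 (Subgroup.mem_top σ)
  · funext a b
    refine propext ⟨fun hab => ?_, nuRel_of_conjSet hN hxy⟩
    refine nuRel_of_conjSet hN' hyx ?_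
    rwa [hback]
  · exact ⟨fun h1 => hinj (by rwa [hback]), hinj⟩
  · constructor
    · rintro ⟨-, M, hM, hfM, hact⟩
      exact ⟨hIN, M, hM, hfM, acts_conjSet hM.prop hact⟩
    · rintro ⟨-, M, hM, hfM, hact⟩
      refine ⟨h, M, hM, hfM, ?_⟩
      have := acts_conjSet (x := y) (y := x) hM.prop hact
      rwa [hback] at this

theorem eq_bot_or_eq_top_of_two (N : Subgroup (Equiv.Perm (Fin 2))) : N = ⊥ ∨ N = ⊤ := by
  have h : alternatingGroup (Fin 2) ≤ N := by
    rw [alternatingGroup_two]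
    exact bot_le
  rcases eq_or_eq_top_of_alternatingGroup_le h with h | h
  · rw [alternatingGroup_two] at h
    exact Or.inl h
  · exact Or.inr h

theorem eq_bot_or_eq_klein {N : Subgroup (Equiv.Perm (Fin 4))} (hN : N.Normal) (h : N ≤ klein) :
    N = ⊥ ∨ N = klein := by
  by_cases h0 : N = ⊥
  · exact Or.inl h0
  · rcases eq_klein_or_of_normal hN h0 with h1 | h1
    · exact Or.inr h1
    · exact absurd (le_antisymm klein_le_alternatingGroup (h1.trans h)) klein_ne_alternatingGroup

theorem isProperINPair_iff (I N : Set (Brauer n)) : (IsProperINPair I N ∧ IsDistinguished N) ↔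
    ∃ (q : ℕ) (N₀ : Subgroup (Equiv.Perm (Fin q))), 2 ≤ q ∧ q ≤ n ∧ q ≡ n [MOD 2] ∧
      N₀.Normal ∧ N₀ ≠ ⊥ ∧ I = rankIdeal n (q - 2) ∧ N = barSubgroup n N₀ := by
  constructor
  · rintro ⟨⟨h, hnt⟩, hd⟩
    obtain ⟨r, N₀, hr, hm, hN, rfl, rfl⟩ := isINPair_and_isDistinguished_iff.1 ⟨h, hd⟩
    have hm2 : r + 2 ≡ n [MOD 2] := by
      simp only [Nat.ModEq] at hm ⊢
      omega
    exact ⟨r + 2, N₀, by omega, hr, hm2, hN, (barSubgroup_nontrivial hr hm2).1 hnt, rfl, rfl⟩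
  · rintro ⟨q, N₀, h2, hq, hp, hN, h1, rfl, rfl⟩
    obtain ⟨r, rfl⟩ : ∃ r, q = r + 2 := ⟨q - 2, by omega⟩
    have hm : r ≡ n [MOD 2] := by
      simp only [Nat.ModEq] at hp ⊢
      omega
    obtain ⟨h3, h4⟩ := isINPair_and_isDistinguished_iff.2 ⟨r, N₀, hq, hm, hN, rfl, rfl⟩
    exact ⟨⟨h3, (barSubgroup_nontrivial hq hp).2 h1⟩, h4⟩

theorem isRetractableINPair_and_isDistinguished_iff {I N : Set (Brauer n)} :
    IsRetractableINPair I N ∧ IsDistinguished N ↔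
      ∃ (r : ℕ) (N₀ : Subgroup (Equiv.Perm (Fin (r + 2)))), r + 2 ≤ n ∧ r ≡ n [MOD 2] ∧
        N₀.Normal ∧ r ≤ 2 ∧ ActsAlike (barSubgroup n N₀) ∧ I = rankIdeal n r ∧
        N = barSubgroup n N₀ := by
  constructor
  · rintro ⟨h, hd⟩
    obtain ⟨r, N₀, hr, hm, hN, rfl, rfl⟩ := isINPair_and_isDistinguished_iff.1 ⟨h.1, hd⟩
    obtain ⟨-, h2, hA⟩ := (isRetractableINPair_iff (by omega) hm).1 h
    exact ⟨r, N₀, hr, hm, hN, h2, hA, rfl, rfl⟩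
  · rintro ⟨r, N₀, hr, hm, hN, h2, hA, rfl, rfl⟩
    obtain ⟨h3, h4⟩ := isINPair_and_isDistinguished_iff.2 ⟨r, N₀, hr, hm, hN, rfl, rfl⟩
    exact ⟨(isRetractableINPair_iff (by omega) hm).2 ⟨h3, h2, hA⟩, h4⟩

theorem isRetractableINPair_iff_of_odd (hn : 3 ≤ n) (ho : Odd n) (I N : Set (Brauer n)) :
    (IsRetractableINPair I N ∧ IsDistinguished N) ↔
      I = rankIdeal n 1 ∧ N = barSubgroup n (⊥ : Subgroup (Equiv.Perm (Fin 3))) := by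
  have ho' := Nat.odd_iff.1 ho
  have h3 : 3 ≡ n [MOD 2] := by simp only [Nat.ModEq]; omega
  rw [isRetractableINPair_and_isDistinguished_iff]
  constructor
  · rintro ⟨r, N₀, hr, hm, hN, h2, hA, rfl, rfl⟩
    obtain rfl : r = 1 := by simp only [Nat.ModEq] at hm; omega
    exact ⟨rfl, by rw [eq_one_of_actsAlike_three hn h3 hA]⟩
  · rintro ⟨rfl, rfl⟩
    exact ⟨1, ⊥, hn, by simp only [Nat.ModEq]; omega, inferInstance, by omega,
      actsAlike_bot hn h3, rfl, rfl⟩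

theorem isRetractableINPair_iff_of_even (hn : 3 ≤ n) (he : Even n) (I N : Set (Brauer n)) :
    (IsRetractableINPair I N ∧ IsDistinguished N) ↔
      (I = rankIdeal n 0 ∧ N = barSubgroup n (⊥ : Subgroup (Equiv.Perm (Fin 2)))) ∨
      (I = rankIdeal n 0 ∧ N = barSubgroup n (⊤ : Subgroup (Equiv.Perm (Fin 2)))) ∨
      (I = rankIdeal n 2 ∧ N = barSubgroup n (⊥ : Subgroup (Equiv.Perm (Fin 4)))) ∨
      (I = rankIdeal n 2 ∧ N = barSubgroup n klein) := by
  have he' := Nat.even_iff.1 he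
  have h4 : 4 ≤ n := by omega
  have hm0 : 0 ≡ n [MOD 2] := by simp only [Nat.ModEq]; omega
  have hm2 : 2 ≡ n [MOD 2] := by simp only [Nat.ModEq]; omega
  have hm4 : 4 ≡ n [MOD 2] := by simp only [Nat.ModEq]; omega
  rw [isRetractableINPair_and_isDistinguished_iff]
  constructor
  · rintro ⟨r, N₀, hr, hm, hN, h2, hA, rfl, rfl⟩
    obtain rfl | rfl : r = 0 ∨ r = 2 := by simp only [Nat.ModEq] at hm; omega
    · rcases eq_bot_or_eq_top_of_two N₀ with rfl | rfl
      · exact Or.inl ⟨rfl, rfl⟩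
      · exact Or.inr (Or.inl ⟨rfl, rfl⟩)
    · rcases eq_bot_or_eq_klein hN ((actsAlike_four_iff h4 hm4).1 hA) with rfl | rfl
      · exact Or.inr (Or.inr (Or.inl ⟨rfl, rfl⟩))
      · exact Or.inr (Or.inr (Or.inr ⟨rfl, rfl⟩))
  · rintro (⟨rfl, rfl⟩ | ⟨rfl, rfl⟩ | ⟨rfl, rfl⟩ | ⟨rfl, rfl⟩)
    · exact ⟨0, ⊥, by omega, hm0, inferInstance, by omega, actsAlike_two (by omega) hm2 _, rfl, rfl⟩
    · exact ⟨0, ⊤, by omega, hm0, inferInstance, by omega, actsAlike_two (by omega) hm2 _, rfl, rfl⟩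
    · exact ⟨2, ⊥, by omega, hm2, inferInstance, by omega, actsAlike_bot h4 hm4, rfl, rfl⟩
    · exact ⟨2, klein, by omega, hm2, klein_normal, by omega,
        (actsAlike_four_iff h4 hm4).2 le_rfl, rfl, rfl⟩

theorem exists_isRetraction_hat (he : Even n) :
    ∃ f : Brauer n → Brauer n, IsRetraction (rankIdeal n 2) (rankIdeal n 0) f ∧
      ∀ α ∈ rankIdeal n 2, (f α : Diagram n) = (α : Diagram n).hat := by
  refine ⟨retr, ?_, fun α hα => coe_retr_eq_hat he hα⟩
  rw [rankIdeal_zero he]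
  exact isRetraction_retr le_rfl

end INPairs

/-! ### The positions of the named congruences -/

section Names

variable {n : ℕ}

/-- The position of `R_{I,N}` in the chain of these congruences, where `I` consists of the elements
of rank at most `r`, and `N` has index `i` among the normal subgroups of the symmetric group of
degree `r + 2`.  The indices that occur are `0, 3` for `r = 0`, all of `0, 1, 2, 3` for `r = 2`, and
`0, 2, 3` otherwise; the formula leaves no gaps between the positions of consecutive congruences. -/
def chainPos (r i : ℕ) : ℕ :=
  (if r = 2 then 2 else 3 * (r / 2)) +
    if r = 0 then (if i = 0 then 0 else 1) else if r = 2 then i else i - 1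

/-- The restrictions on the index of a normal subgroup of the symmetric group of degree `r + 2`. -/
def IndexOK (r i : ℕ) : Prop := i ≤ 3 ∧ (r = 0 → i = 0 ∨ i = 3) ∧ (i = 1 → r = 2)

theorem chainPos_le_iff {r r' i i' : ℕ} (hr : r % 2 = r' % 2) (hi : IndexOK r i)
    (hi' : IndexOK r' i') :
    chainPos r i ≤ chainPos r' i' ↔ r < r' ∨ r = r' ∧ i ≤ i' := by
  obtain ⟨h1, h2, h3⟩ := hi
  obtain ⟨h1', h2', h3'⟩ := hi'
  unfold chainPos
  split_ifs <;> omega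

theorem chainPos_eq_iff {r r' i i' : ℕ} (hr : r % 2 = r' % 2) (hi : IndexOK r i)
    (hi' : IndexOK r' i') : chainPos r i = chainPos r' i' ↔ r = r' ∧ i = i' := by
  rw [le_antisymm_iff, chainPos_le_iff hr hi hi', chainPos_le_iff hr.symm hi' hi]
  omega

theorem indexOK {r : ℕ} {N : Subgroup (Equiv.Perm (Fin (r + 2)))} (hN : N.Normal) :
    IndexOK r (normalIndex N) := by
  refine ⟨normalIndex_le N, ?_, fun h => ?_⟩
  · rintro rfl
    rcases eq_bot_or_eq_top_of_two N with rfl | rfl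
    · exact Or.inl normalIndex_bot
    · exact Or.inr (normalIndex_top le_rfl)
  · obtain ⟨h4, -⟩ := eq_klein_of_normalIndex (by omega) hN h
    omega

theorem indexOK_zero (r : ℕ) : IndexOK r 0 := ⟨by omega, by omega, by omega⟩

/-- The position of the pair in the chain of the retractable pairs. -/
def RetrPair.pos : RetrPair n → ℕ
  | C1 _ => 0
  | C0 _ => 0
  | CS2 _ => 1
  | C2 _ => 2
  | CK _ => 3

/-- The side of a named congruence and its position in the chain on that side. -/
noncomputable def CongName.code : CongName n → (Bool × Bool) × ℕ
  | R q _ _ => ((true, true), chainPos q 0)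
  | RN q _ _ _ N _ _ => ((true, true), chainPos (q - 2) (normalIndex N))
  | lam C => ((true, false), C.pos)
  | rho C => ((false, true), C.pos)
  | mu C => ((false, false), C.pos)

theorem RetrPair.exists_data (hn : 3 ≤ n) (C : RetrPair n) :
    ∃ (r : ℕ) (N : Subgroup (Equiv.Perm (Fin (r + 2)))), (∀ s, LatData n s r N) ∧ r ≤ 2 ∧
      C.ideal = rankIdeal n r ∧ C.group = barSubgroup n N ∧ C.pos = chainPos r (normalIndex N) := by
  rcases C with h | h | h | h | h
  all_goals first | have h' := Nat.odd_iff.1 h | have h' := Nat.even_iff.1 h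
  · have h3 : 3 ≡ n [MOD 2] := by simp only [Nat.ModEq]; omega
    exact ⟨1, ⊥, fun s => ⟨by omega, by simp only [Nat.ModEq]; omega, inferInstance, Or.inl rfl,
      Or.inr ⟨by omega, actsAlike_bot hn h3⟩⟩, by omega, rfl, rfl, by
        rw [normalIndex_bot]; rfl⟩
  · have h2 : 2 ≡ n [MOD 2] := by simp only [Nat.ModEq]; omega
    exact ⟨0, ⊥, fun s => ⟨by omega, by simp only [Nat.ModEq]; omega, inferInstance, Or.inl rfl,
      Or.inr ⟨by omega, actsAlike_two (by omega) h2 _⟩⟩, by omega, rfl, rfl, by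
        rw [normalIndex_bot]; rfl⟩
  · have h2 : 2 ≡ n [MOD 2] := by simp only [Nat.ModEq]; omega
    exact ⟨0, ⊤, fun s => ⟨by omega, by simp only [Nat.ModEq]; omega, inferInstance,
      Or.inr (by omega), Or.inr ⟨by omega, actsAlike_two (by omega) h2 _⟩⟩, by omega, rfl, rfl, by
        rw [normalIndex_top le_rfl]; rfl⟩
  · have h4 : 4 ≡ n [MOD 2] := by simp only [Nat.ModEq]; omega
    exact ⟨2, ⊥, fun s => ⟨by omega, by simp only [Nat.ModEq]; omega, inferInstance, Or.inl rfl,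
      Or.inr ⟨by omega, actsAlike_bot (by omega) h4⟩⟩, by omega, rfl, rfl, by
        rw [normalIndex_bot]; rfl⟩
  · have h4 : 4 ≡ n [MOD 2] := by simp only [Nat.ModEq]; omega
    exact ⟨2, klein, fun s => ⟨by omega, by simp only [Nat.ModEq]; omega, klein_normal,
      Or.inr (by omega), Or.inr ⟨by omega, (actsAlike_four_iff (by omega) h4).2 le_rfl⟩⟩,
      by omega, rfl, rfl, by rw [normalIndex_klein]; rfl⟩

theorem sideRel_iff_greenL {a b : Brauer n} : SideRel (true, false) a b ↔ GreenL a b :=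
  ⟨fun h => h.2 rfl, fun h => ⟨fun e => Bool.noConfusion e, fun _ => h⟩⟩

theorem sideRel_iff_greenR {a b : Brauer n} : SideRel (false, true) a b ↔ GreenR a b :=
  ⟨fun h => h.1 rfl, fun h => ⟨fun _ => h, fun e => Bool.noConfusion e⟩⟩

theorem sideRel_iff_greenH {a b : Brauer n} : SideRel (false, false) a b ↔ GreenH a b :=
  ⟨fun h => ⟨h.1 rfl, h.2 rfl⟩, fun h => ⟨fun _ => h.1, fun _ => h.2⟩⟩

theorem latRel_top_iff {r : ℕ} {N : Subgroup (Equiv.Perm (Fin (r + 2)))} {a b : Brauer n} :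
    LatRel (true, true) r N a b ↔ inRel (rankIdeal n r) (barSubgroup n N) a b := by
  have := sideRel_top (retr a) (retr b)
  simp only [LatRel, inRel, reesRel, mem_rankIdeal, this, and_true]
  tauto

/-- Every named relation has the common form. -/
theorem CongName.exists_data (hn : 3 ≤ n) (c : CongName n) :
    ∃ (s : Bool × Bool) (r : ℕ) (N : Subgroup (Equiv.Perm (Fin (r + 2)))), LatData n s r N ∧
      c.code = (s, chainPos r (normalIndex N)) ∧ ∀ a b, c.rel a b ↔ LatRel s r N a b := by
  rcases c with ⟨q, hq, hp⟩ | ⟨q, h2, hq, hp, N, hN, h1⟩ | C | C | C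
  · refine ⟨(true, true), q, ⊥, ⟨hq, hp, inferInstance, Or.inl rfl, Or.inl rfl⟩, ?_, fun a b => ?_⟩
    · rw [normalIndex_bot]
      rfl
    · rw [latRel_top_iff]
      refine ⟨Or.inl, ?_⟩
      rintro (h | h)
      · exact h
      · exact Or.inl (eq_of_nuRel_bot h)
  · obtain ⟨r, rfl⟩ : ∃ r, q = r + 2 := ⟨q - 2, by omega⟩
    refine ⟨(true, true), r, N, ⟨by omega, ?_, hN, Or.inr hq, Or.inl rfl⟩, rfl, fun a b => ?_⟩
    · simp only [Nat.ModEq] at hp ⊢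
      omega
    · rw [latRel_top_iff]
      rfl
  all_goals
    obtain ⟨r, N, hd, hr, hI, hG, hpos⟩ := C.exists_data hn
    have h := hd (true, true)
  · refine ⟨(true, false), r, N, hd _, by rw [← hpos]; rfl, fun a b => ?_⟩
    change lamRel C.ideal C.group a b ↔ _
    rw [hI, hG, lamRel, pullbackRel_iff hr h.mod h.le, ← sideRel_iff_greenL]
    rfl
  · refine ⟨(false, true), r, N, hd _, by rw [← hpos]; rfl, fun a b => ?_⟩
    change rhoRel C.ideal C.group a b ↔ _
    rw [hI, hG, rhoRel, pullbackRel_iff hr h.mod h.le, ← sideRel_iff_greenR]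
    rfl
  · refine ⟨(false, false), r, N, hd _, by rw [← hpos]; rfl, fun a b => ?_⟩
    change muRel C.ideal C.group a b ↔ _
    rw [hI, hG, muRel, pullbackRel_iff hr h.mod h.le, ← sideRel_iff_greenH]
    rfl

/-- The position determines the pair. -/
theorem RetrPair.pos_injective {C C' : RetrPair n} (h : C.pos = C'.pos) : C = C' := by
  cases C <;> cases C' <;> first | rfl | (simp only [RetrPair.pos] at h; omega) | skip
  all_goals
    rename_i h1 h2
    exfalso
    first
    | exact Nat.not_even_iff_odd.2 h1 h2
    | exact Nat.not_even_iff_odd.2 h2 h1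

/-- A named congruence is determined by its code. -/
theorem CongName.code_injective : Function.Injective (CongName.code (n := n)) := by
  have hRN : ∀ {q : ℕ}, 2 ≤ q → ∀ {N : Subgroup (Equiv.Perm (Fin q))}, N.Normal →
      IndexOK (q - 2) (normalIndex N) := by
    intro q h2 N hN
    obtain ⟨r, rfl⟩ : ∃ r, q = r + 2 := ⟨q - 2, by omega⟩
    exact indexOK hN
  rintro (⟨q, hq, hp⟩ | ⟨q, h2, hq, hp, N, hN, h1⟩ | C | C | C)
    (⟨q', hq', hp'⟩ | ⟨q', h2', hq', hp', N', hN', h1'⟩ | C' | C' | C') h <;>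
    simp only [CongName.code, Prod.mk.injEq, true_and, Bool.true_eq_false, Bool.false_eq_true,
      false_and, and_false, and_self] at h
  all_goals try simp only [Nat.ModEq] at hp hp'
  · rw [chainPos_eq_iff (by omega) (indexOK_zero q) (indexOK_zero q')] at h
    obtain ⟨rfl, -⟩ := h
    rfl
  · rw [chainPos_eq_iff (by omega) (indexOK_zero q) (hRN h2' hN')] at h
    have := normalIndex_pos h1'
    omega
  · rw [chainPos_eq_iff (by omega) (hRN h2 hN) (indexOK_zero q')] at h
    have := normalIndex_pos h1
    omega
  · rw [chainPos_eq_iff (by omega) (hRN h2 hN) (hRN h2' hN')] at h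
    obtain ⟨h3, h4⟩ := h
    obtain rfl : q = q' := by omega
    obtain rfl := le_antisymm ((le_iff_normalIndex h2 hN hN').2 h4.le)
      ((le_iff_normalIndex h2 hN' hN).2 h4.ge)
    rfl
  all_goals rw [RetrPair.pos_injective h]

/-- The congruence with a given name. -/
noncomputable def CongName.toCon (hn : 3 ≤ n) (c : CongName n) : Con (Brauer n) where
  r := c.rel
  iseqv := by
    obtain ⟨s, r, N, hd, -, h⟩ := c.exists_data hn
    have : c.rel = LatRel s r N := funext fun a => funext fun b => propext (h a b)
    rw [this]
    exact (latCon hd).iseqv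
  mul' {_ _ _ _} h1 h2 := by
    obtain ⟨s, r, N, hd, -, h⟩ := c.exists_data hn
    rw [h] at h1 h2 ⊢
    exact (latCon hd).mul h1 h2

theorem CongName.toCon_eq (hn : 3 ≤ n) {c : CongName n} {s : Bool × Bool} {r : ℕ}
    {N : Subgroup (Equiv.Perm (Fin (r + 2)))} (hd : LatData n s r N)
    (h : ∀ a b, c.rel a b ↔ LatRel s r N a b) : c.toCon hn = latCon hd :=
  Con.ext fun a b => h a b

/-- The named congruences are ordered as their codes. -/
theorem CongName.toCon_le_iff (hn : 3 ≤ n) {c d : CongName n} :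
    c.toCon hn ≤ d.toCon hn ↔ c.code ≤ d.code := by
  obtain ⟨s, r, N, hd, hcode, h⟩ := c.exists_data hn
  obtain ⟨s', r', N', hd', hcode', h'⟩ := d.exists_data hn
  rw [toCon_eq hn hd h, toCon_eq hn hd' h', hcode, hcode', latCon_le_iff hn hd hd',
    ← chainPos_le_iff (hd.mod.trans hd'.mod.symm) (indexOK hd.normal) (indexOK hd'.normal)]
  exact Prod.mk_le_mk.symm

theorem CongName.toCon_injective (hn : 3 ≤ n) :
    Function.Injective (CongName.toCon (n := n) hn) := fun _ _ h =>
  CongName.code_injective (le_antisymm ((CongName.toCon_le_iff hn).1 h.le)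
    ((CongName.toCon_le_iff hn).1 h.ge))

/-- The data of a congruence other than `R_{I,N}` belong to one of the retractable pairs. -/
theorem exists_retrPair (hn : 3 ≤ n) {s : Bool × Bool} {r : ℕ}
    {N : Subgroup (Equiv.Perm (Fin (r + 2)))} (hd : LatData n s r N) (hs : s ≠ (true, true)) :
    ∃ C : RetrPair n, C.pos = chainPos r (normalIndex N) := by
  obtain ⟨hr, hA⟩ := hd.side.resolve_left hs
  have hm := hd.mod
  have hm2 := hd.mod_add_two
  simp only [Nat.ModEq] at hm
  obtain rfl | rfl | rfl : r = 0 ∨ r = 1 ∨ r = 2 := by omega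
  · have he : Even n := Nat.even_iff.2 (by omega)
    rcases eq_bot_or_eq_top_of_two N with rfl | rfl
    · exact ⟨.C0 he, by rw [normalIndex_bot]; rfl⟩
    · exact ⟨.CS2 he, by rw [normalIndex_top le_rfl]; rfl⟩
  · obtain rfl := eq_one_of_actsAlike_three hn hm2 hA
    exact ⟨.C1 (Nat.odd_iff.2 (by omega)), by rw [normalIndex_bot]; rfl⟩
  · have he : Even n := Nat.even_iff.2 (by omega)
    rcases eq_bot_or_eq_klein hd.normal ((actsAlike_four_iff (by omega) hm2).1 hA) with rfl | rfl
    · exact ⟨.C2 he, by rw [normalIndex_bot]; rfl⟩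
    · exact ⟨.CK he, by rw [normalIndex_klein]; rfl⟩

theorem CongName.exists_code (hn : 3 ≤ n) {s : Bool × Bool} {r : ℕ}
    {N : Subgroup (Equiv.Perm (Fin (r + 2)))} (hd : LatData n s r N) :
    ∃ c : CongName n, c.code = (s, chainPos r (normalIndex N)) := by
  by_cases hs : s = (true, true)
  · subst hs
    by_cases h : N = ⊥
    · subst h
      exact ⟨.R r hd.le hd.mod, by rw [normalIndex_bot]; rfl⟩
    · exact ⟨.RN (r + 2) (by omega) (hd.group.resolve_left h) hd.mod_add_two N hd.normal h, rfl⟩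
  · obtain ⟨C, hC⟩ := exists_retrPair hn hd hs
    rw [← hC]
    obtain ⟨_ | _, _ | _⟩ := s
    · exact ⟨.mu C, rfl⟩
    · exact ⟨.rho C, rfl⟩
    · exact ⟨.lam C, rfl⟩
    · exact absurd rfl hs

theorem CongName.toCon_surjective (hn : 3 ≤ n) :
    Function.Surjective (CongName.toCon (n := n) hn) := by
  intro x
  obtain ⟨s, r, N, hd, rfl⟩ := exists_latCon_eq x
  obtain ⟨c, hc⟩ := CongName.exists_code hn hd
  obtain ⟨s', r', N', hd', hcode, h⟩ := c.exists_data hn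
  rw [hcode, Prod.mk.injEq,
    chainPos_eq_iff (hd'.mod.trans hd.mod.symm) (indexOK hd'.normal) (indexOK hd.normal)] at hc
  refine ⟨c, ?_⟩
  rw [toCon_eq hn hd' h]
  refine le_antisymm ((latCon_le_iff hn hd' hd).2 ?_) ((latCon_le_iff hn hd hd').2 ?_)
  · exact ⟨hc.1.le, Or.inr ⟨hc.2.1, hc.2.2.le⟩⟩
  · exact ⟨hc.1.ge, Or.inr ⟨hc.2.1.symm, hc.2.2.ge⟩⟩

/-- The bijection between names and congruences. -/
noncomputable def CongName.equivCon (hn : 3 ≤ n) : CongName n ≃ Con (Brauer n) :=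
  Equiv.ofBijective (CongName.toCon hn) ⟨CongName.toCon_injective hn, CongName.toCon_surjective hn⟩

theorem CongName.isStarCongruence_iff (hn : 3 ≤ n) (c : CongName n) :
    IsStarCongruence (c.toCon hn) ↔ ¬ c.IsOneSided := by
  obtain ⟨s, r, N, hd, hcode, h⟩ := c.exists_data hn
  rw [toCon_eq hn hd h]
  have hswap : s.swap = s → IsStarCongruence (latCon hd) := by
    intro hs α β hαβ
    have := LatRel.star hd hαβ
    rwa [hs] at this
  have hL : ∀ x y : Brauer n, x.1.rank ≤ 1 → y.1.rank ≤ 1 → SideRel s x y →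
      IsStarCongruence (latCon hd) → SideRel s (brauerStar x) (brauerStar y) := by
    intro x y hx hy hxy hstar
    exact (latRel_low_iff hd (by rwa [rank_star]) (by rwa [rank_star])).1
      (hstar x y ((latRel_low_iff hd hx hy).2 hxy))
  rcases c with ⟨q, hq, hp⟩ | ⟨q, h2, hq, hp, N, hN, h1⟩ | C | C | C <;>
    obtain rfl := congrArg Prod.fst hcode
  · exact ⟨fun _ h => h, fun _ => hswap rfl⟩
  · exact ⟨fun _ h => h, fun _ => hswap rfl⟩
  · refine iff_of_false (fun hstar => ?_) (fun h => h trivial)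
    obtain ⟨x, y, hx, hy, hxy, hne⟩ := exists_greenL_not_greenR hn
    exact hne (greenL_star.1 (sideRel_iff_greenL.1
      (hL x y hx hy (sideRel_iff_greenL.2 hxy) hstar)))
  · refine iff_of_false (fun hstar => ?_) (fun h => h trivial)
    obtain ⟨x, y, hx, hy, hxy, hne⟩ := exists_greenR_not_greenL hn
    exact hne (greenR_star.1 (sideRel_iff_greenR.1
      (hL x y hx hy (sideRel_iff_greenR.2 hxy) hstar)))
  · exact ⟨fun _ h => h, fun _ => hswap rfl⟩

end Names

/-! ### The Hasse diagram -/

section Hasse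

variable {n : ℕ}

theorem code_covBy_of_pos {s : Bool × Bool} {p p' : ℕ} (h : p' = p + 1) : (s, p) ⋖ (s, p') := by
  subst h
  rw [Prod.mk_covBy_mk_iff_right]
  exact Order.covBy_add_one p

theorem code_covBy_of_side {s s' : Bool × Bool} {p p' : ℕ} (h : s ⋖ s') (hp : p = p') :
    (s, p) ⋖ (s', p') := by
  subst hp
  rwa [Prod.mk_covBy_mk_iff_left]

theorem PairStep.pos_eq {C C' : RetrPair n} (h : PairStep C C') : C'.pos = C.pos + 1 := by
  cases h <;> rfl

theorem DiamondTop.code_eq {C : RetrPair n} {T : CongName n} (h : DiamondTop C T) :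
    T.code = ((true, true), C.pos) := by
  cases h
  · rfl
  · rfl
  · simp [CongName.code, RetrPair.pos, normalIndex_top, chainPos]
  · rfl
  · simp [CongName.code, RetrPair.pos, normalIndex_klein, chainPos]

theorem HasseEdge.code_covBy {c d : CongName n} (h : HasseEdge c d) : c.code ⋖ d.code := by
  have hbool : false ⋖ true := ⟨Bool.false_lt_true, by decide⟩
  have hbot : ((false, false) : Bool × Bool) ⋖ (true, false) := Prod.mk_covBy_mk_iff_left.2 hbool
  have hbot' : ((false, false) : Bool × Bool) ⋖ (false, true) := Prod.mk_covBy_mk_iff_right.2 hbool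
  have htop : ((true, false) : Bool × Bool) ⋖ (true, true) := Prod.mk_covBy_mk_iff_right.2 hbool
  have htop' : ((false, true) : Bool × Bool) ⋖ (true, true) := Prod.mk_covBy_mk_iff_left.2 hbool
  cases h with
  | mu_lam C => exact code_covBy_of_side hbot rfl
  | mu_rho C => exact code_covBy_of_side hbot' rfl
  | lam_top C T h =>
    rw [h.code_eq]
    exact code_covBy_of_side htop rfl
  | rho_top C T h =>
    rw [h.code_eq]
    exact code_covBy_of_side htop' rfl
  | mu_mu C C' h => exact code_covBy_of_pos h.pos_eq
  | lam_lam C C' h => exact code_covBy_of_pos h.pos_eq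
  | rho_rho C C' h => exact code_covBy_of_pos h.pos_eq
  | R_S2 hq hp h2 hq' hp' hN h1 =>
    exact code_covBy_of_pos (by rw [normalIndex_top le_rfl]; rfl)
  | R_K hq hp h2 hq' hp' hN h1 =>
    exact code_covBy_of_pos (by rw [normalIndex_klein]; rfl)
  | K_A4 h2 hq hp hN h1 hN' h1' =>
    exact code_covBy_of_pos (by
      rw [normalIndex_klein, normalIndex_alternatingGroup (by omega)]; rfl)
  | R_A q h hq hp h2 hq' hp' hN h1 =>
    refine code_covBy_of_pos ?_
    rw [normalIndex_alternatingGroup (q := q + 2) (by omega), Nat.add_sub_cancel]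
    simp [chainPos, show q ≠ 0 by omega, show q ≠ 2 by omega]
  | A_S q h h2 hq hp hN h1 hN' h1' =>
    refine code_covBy_of_pos ?_
    rw [normalIndex_alternatingGroup h, normalIndex_top h2, chainPos, chainPos]
    split_ifs <;> omega
  | S_R q h2 hq hp hN h1 hq' hp' =>
    refine code_covBy_of_pos ?_
    rw [normalIndex_top h2, chainPos, chainPos]
    split_ifs <;> first | omega | contradiction

theorem RetrPair.exists_diamondTop (hn : 3 ≤ n) (C : RetrPair n) : ∃ T, DiamondTop C T := by
  rcases C with h | h | h | h | h
  all_goals first | have h' := Nat.odd_iff.1 h | have h' := Nat.even_iff.1 h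
  · exact ⟨_, .C1 h (by omega) (by simp only [Nat.ModEq]; omega)⟩
  · exact ⟨_, .C0 h (by omega) (by simp only [Nat.ModEq]; omega)⟩
  · exact ⟨_, .CS2 h le_rfl (by omega) (by simp only [Nat.ModEq]; omega) inferInstance
      (top_ne_bot_perm le_rfl)⟩
  · exact ⟨_, .C2 h (by omega) (by simp only [Nat.ModEq]; omega)⟩
  · exact ⟨_, .CK h (by omega) (by omega) (by simp only [Nat.ModEq]; omega) klein_normal
      klein_ne_bot⟩

theorem RetrPair.exists_pairStep {C C' : RetrPair n} (h : C.pos < C'.pos) :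
    ∃ D, PairStep C D := by
  cases C <;> rename_i he
  · cases C' <;> rename_i he' <;>
      first | exact absurd h (lt_irrefl _) | exact absurd he (Nat.not_odd_iff_even.2 he')
  · exact ⟨_, .C0 he he⟩
  · exact ⟨_, .CS2 he he⟩
  · exact ⟨_, .C2 he he⟩
  · cases C' <;> simp [RetrPair.pos] at h

/-- If `R_q` is not the universal congruence, then an edge of the chain starts at it. -/
theorem exists_edge_R {q : ℕ} {hq : q ≤ n} {hp : q ≡ n [MOD 2]} (h : q + 2 ≤ n) :
    ∃ d, HasseEdge (CongName.R q hq hp) d ∧ d.code.1 = (true, true) := by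
  have hp' : q + 2 ≡ n [MOD 2] := by
    simp only [Nat.ModEq] at hp ⊢
    omega
  by_cases h0 : q = 0
  · subst h0
    exact ⟨_, .R_S2 hq hp le_rfl h hp' inferInstance (top_ne_bot_perm le_rfl), rfl⟩
  by_cases h2 : q = 2
  · subst h2
    exact ⟨_, .R_K hq hp (by omega) h hp' klein_normal klein_ne_bot, rfl⟩
  · exact ⟨_, .R_A q (by omega) hq hp (by omega) h hp' alternatingGroup.normal
      (alternatingGroup_ne_bot (by omega)), rfl⟩

theorem exists_edge_RN {q : ℕ} {h2 : 2 ≤ q} {hq : q ≤ n} {hp : q ≡ n [MOD 2]}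
    {N : Subgroup (Equiv.Perm (Fin q))} {hN : N.Normal} {h1 : N ≠ ⊥} :
    ∃ d, HasseEdge (CongName.RN q h2 hq hp N hN h1) d ∧ d.code.1 = (true, true) := by
  have hle := normalIndex_le N
  have hpos := normalIndex_pos h1
  obtain h | h | h : normalIndex N = 1 ∨ normalIndex N = 2 ∨ normalIndex N = 3 := by omega
  · obtain ⟨rfl, rfl⟩ := eq_klein_of_normalIndex h2 hN h
    exact ⟨_, .K_A4 h2 hq hp hN h1 alternatingGroup.normal
      (alternatingGroup_ne_bot (by omega)), rfl⟩
  · obtain ⟨rfl, -⟩ := eq_alternatingGroup_of_normalIndex h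
    have h3 : 3 ≤ q := by
      by_contra h3
      obtain rfl : q = 2 := by omega
      exact h1 alternatingGroup_two
    exact ⟨_, .A_S q h3 h2 hq hp hN h1 inferInstance (top_ne_bot_perm h2), rfl⟩
  · obtain rfl := eq_top_of_normalIndex h
    exact ⟨_, .S_R q h2 hq hp hN h1 hq hp, rfl⟩

/-- An edge that stays on its side leads to the next position, and so not beyond any code further up
on this side or a larger one. -/
theorem HasseEdge.code_le {c d e : CongName n} (h : HasseEdge c d) (hs : c.code.1 = d.code.1)
    (hs' : c.code.1 ≤ e.code.1) (hp : c.code.2 < e.code.2) : d.code ≤ e.code := by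
  have h1 := h.code_covBy
  rcases hc : c.code with ⟨s, p⟩
  rcases hd : d.code with ⟨s', p'⟩
  rw [hc] at h1 hs hs' hp
  rw [hd] at h1 hs
  obtain rfl : s = s' := hs
  rw [Prod.mk_covBy_mk_iff_right, Nat.covBy_iff_add_one_eq] at h1
  subst h1
  exact ⟨hs', hp⟩

/-- Every strict inequality of codes can be started with an edge of the Hasse diagram; this is why
there are no coverings besides the edges. -/
theorem exists_hasseEdge (hn : 3 ≤ n) {c d : CongName n} (hlt : c.code < d.code) :
    ∃ e, HasseEdge c e ∧ e.code ≤ d.code := by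
  have hle : c.code.1 ≤ d.code.1 := hlt.le.1
  have hp : c.code.1 = d.code.1 → c.code.2 < d.code.2 := by
    intro hs
    refine lt_of_le_of_ne hlt.le.2 fun he => hlt.ne (Prod.ext hs he)
  have htop : ∀ s : Bool × Bool, s ≤ (true, true) := by decide
  have hbt : ¬ (true, true) ≤ ((true, false) : Bool × Bool) := by decide
  have hbt' : ¬ (true, true) ≤ ((false, true) : Bool × Bool) := by decide
  have hbt'' : ¬ (true, true) ≤ ((false, false) : Bool × Bool) := by decide
  have hlr : ¬ (true, false) ≤ ((false, true) : Bool × Bool) := by decide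
  have hrl : ¬ (false, true) ≤ ((true, false) : Bool × Bool) := by decide
  have hlm : ¬ (true, false) ≤ ((false, false) : Bool × Bool) := by decide
  have hrm : ¬ (false, true) ≤ ((false, false) : Bool × Bool) := by decide
  -- the top of a diamond is below every `R_{I,N}` that lies above one of its elements
  have hdia : ∀ (C : RetrPair n), c.code.2 = C.pos → d.code.1 = (true, true) →
      ∀ T, DiamondTop C T → T.code ≤ d.code := by
    intro C hC hd T hT
    rw [hT.code_eq, ← hC]
    exact ⟨hd.ge, hlt.le.2⟩
  have hside : ∀ e : CongName n, e.code.1 = d.code.1 → e.code.2 = c.code.2 → e.code ≤ d.code :=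
    fun e h1 h2 => ⟨h1.le, h2.trans_le hlt.le.2⟩
  rcases c with ⟨q, hq, hp'⟩ | ⟨q, h2, hq, hp', N, hN, h1⟩ | C | C | C
  · have hs : d.code.1 = (true, true) := le_antisymm (htop _) hle
    have hlt2 := hp hs.symm
    have hqn : q + 2 ≤ n := by
      obtain ⟨s, r, N, hd, hcode, -⟩ := d.exists_data hn
      rw [hcode] at hlt2
      have h3 : ¬ chainPos r (normalIndex N) ≤ chainPos q 0 := not_le.2 hlt2
      rw [chainPos_le_iff (hd.mod.trans hp'.symm) (indexOK hd.normal) (indexOK_zero q)] at h3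
      have h4 := hd.mod.trans hp'.symm
      have h5 := hd.le
      simp only [Nat.ModEq] at h4
      by_cases hqr : q < r
      · omega
      · obtain rfl : r = q := by omega
        rcases hd.group with rfl | h6
        · rw [normalIndex_bot] at h3
          omega
        · exact h6
    obtain ⟨e, he, hs'⟩ := exists_edge_R (hq := hq) (hp := hp') hqn
    exact ⟨e, he, he.code_le hs'.symm hle hlt2⟩
  · have hs : d.code.1 = (true, true) := le_antisymm (htop _) hle
    obtain ⟨e, he, hs'⟩ := exists_edge_RN (h2 := h2) (hq := hq) (hp := hp') (hN := hN) (h1 := h1)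
    exact ⟨e, he, he.code_le hs'.symm hle (hp hs.symm)⟩
  · obtain ⟨T, hT⟩ := C.exists_diamondTop hn
    rcases d with _ | _ | C' | C' | C'
    · exact ⟨T, .lam_top C T hT, hdia C rfl rfl T hT⟩
    · exact ⟨T, .lam_top C T hT, hdia C rfl rfl T hT⟩
    · obtain ⟨D, hD⟩ := RetrPair.exists_pairStep (hp rfl)
      exact ⟨_, .lam_lam C D hD, (HasseEdge.lam_lam C D hD).code_le rfl le_rfl (hp rfl)⟩
    · exact absurd hle hlr
    · exact absurd hle hlm
  · obtain ⟨T, hT⟩ := C.exists_diamondTop hn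
    rcases d with _ | _ | C' | C' | C'
    · exact ⟨T, .rho_top C T hT, hdia C rfl rfl T hT⟩
    · exact ⟨T, .rho_top C T hT, hdia C rfl rfl T hT⟩
    · exact absurd hle hrl
    · obtain ⟨D, hD⟩ := RetrPair.exists_pairStep (hp rfl)
      exact ⟨_, .rho_rho C D hD, (HasseEdge.rho_rho C D hD).code_le rfl le_rfl (hp rfl)⟩
    · exact absurd hle hrm
  · rcases d with _ | _ | C' | C' | C'
    · exact ⟨.lam C, .mu_lam C, htop _, hlt.le.2⟩
    · exact ⟨.lam C, .mu_lam C, htop _, hlt.le.2⟩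
    · exact ⟨.lam C, .mu_lam C, hside (.lam C) rfl rfl⟩
    · exact ⟨.rho C, .mu_rho C, hside (.rho C) rfl rfl⟩
    · obtain ⟨D, hD⟩ := RetrPair.exists_pairStep (hp rfl)
      exact ⟨_, .mu_mu C D hD, (HasseEdge.mu_mu C D hD).code_le rfl le_rfl (hp rfl)⟩

theorem CongName.equivCon_covBy_iff (hn : 3 ≤ n) (c d : CongName n) :
    CongName.equivCon hn c ⋖ CongName.equivCon hn d ↔ HasseEdge c d := by
  have hle : ∀ c d : CongName n, equivCon hn c ≤ equivCon hn d ↔ c.code ≤ d.code :=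
    fun c d => toCon_le_iff hn
  have hlt : ∀ c d : CongName n, equivCon hn c < equivCon hn d ↔ c.code < d.code := by
    intro c d
    rw [lt_iff_le_not_ge, lt_iff_le_not_ge, hle, hle]
  constructor
  · intro h
    obtain ⟨e, he, hed⟩ := exists_hasseEdge hn ((hlt c d).1 h.lt)
    rcases h.eq_or_eq ((hle c e).2 he.code_covBy.le) ((hle e d).2 hed) with h1 | h1
    · exact absurd he.code_covBy.lt (by rw [(equivCon hn).injective h1]; exact lt_irrefl _)
    · rwa [← (equivCon hn).injective h1]
  · intro h
    have h1 := h.code_covBy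
    refine ⟨(hlt c d).2 h1.lt, fun x hx hx' => ?_⟩
    obtain ⟨e, rfl⟩ := (equivCon hn).surjective x
    exact h1.2 ((hlt c e).1 hx) ((hlt e d).1 hx')

end Hasse

end DiagramMonoid
theorem theorem7 (n : ℕ) (hn : 3 ≤ n) :
    -- the ideals
    (∀ I : Set (Brauer n), IsIdeal I ↔ ∃ q : ℕ, q ≤ n ∧ q ≡ n [MOD 2] ∧ I = rankIdeal n q) ∧
    -- the proper IN-pairs, with the group in a distinguished maximal subgroup
    (∀ I N : Set (Brauer n), (IsProperINPair I N ∧ IsDistinguished N) ↔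
      ∃ (q : ℕ) (N₀ : Subgroup (Equiv.Perm (Fin q))), 2 ≤ q ∧ q ≤ n ∧ q ≡ n [MOD 2] ∧
        N₀.Normal ∧ N₀ ≠ ⊥ ∧ I = rankIdeal n (q - 2) ∧ N = barSubgroup n N₀) ∧
    -- every IN-pair may be replaced by one whose group is in a distinguished maximal subgroup
    (∀ I N : Set (Brauer n), IsINPair I N →
      ∃ N' : Set (Brauer n), IsDistinguished N' ∧ IsINPair I N' ∧ nuRel N = nuRel N' ∧
        (N.Nontrivial ↔ N'.Nontrivial) ∧ (IsRetractableINPair I N ↔ IsRetractableINPair I N')) ∧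
    -- the retractable IN-pairs for `n` odd
    (Odd n → ∀ I N : Set (Brauer n), (IsRetractableINPair I N ∧ IsDistinguished N) ↔
      I = rankIdeal n 1 ∧ N = barSubgroup n (⊥ : Subgroup (Equiv.Perm (Fin 3)))) ∧
    -- the retractable IN-pairs for `n` even
    (Even n → ∀ I N : Set (Brauer n), (IsRetractableINPair I N ∧ IsDistinguished N) ↔
      (I = rankIdeal n 0 ∧ N = barSubgroup n (⊥ : Subgroup (Equiv.Perm (Fin 2)))) ∨
      (I = rankIdeal n 0 ∧ N = barSubgroup n (⊤ : Subgroup (Equiv.Perm (Fin 2)))) ∨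
      (I = rankIdeal n 2 ∧ N = barSubgroup n (⊥ : Subgroup (Equiv.Perm (Fin 4)))) ∨
      (I = rankIdeal n 2 ∧ N = barSubgroup n klein)) ∧
    -- the retraction behind the last two pairs
    (Even n → ∃ f : Brauer n → Brauer n, IsRetraction (rankIdeal n 2) (rankIdeal n 0) f ∧
      ∀ α ∈ rankIdeal n 2, (f α : Diagram n) = (α : Diagram n).hat) ∧
    -- the named relations are pairwise distinct congruences, there are no other congruences,
    -- and the Hasse diagram and the *-congruences are as described
    ∃ Φ : CongName n ≃ Con (Brauer n),
      (∀ (c : CongName n) (α β : Brauer n), Φ c α β ↔ c.rel α β) ∧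
      (∀ c d : CongName n, Φ c ⋖ Φ d ↔ HasseEdge c d) ∧
      (∀ c : CongName n, IsStarCongruence (Φ c) ↔ ¬ c.IsOneSided) := by
  exact ⟨isIdeal_iff, isProperINPair_iff, fun _ _ h => exists_distinguished h,
    fun ho => isRetractableINPair_iff_of_odd hn ho, fun he => isRetractableINPair_iff_of_even hn he,
    exists_isRetraction_hat, CongName.equivCon hn, fun _ _ _ => Iff.rfl,
    CongName.equivCon_covBy_iff hn, CongName.isStarCongruence_iff hn⟩
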